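/- Let $\mathcal A$ be a bicomplete abelian category with enough projectives and enough injectives. An object of an abelian category (with enough projectives and injectives) is *Gorenstein projective* if it is a cycle $\mathrm Z_j(P)$ of an acyclic $\mathbb Z$-indexed complex $P$ of projectives such that $\mathrm{Hom}(P,Q)$ is acyclic for every projective object $Q$. Dually, it is *Gorenstein injective* if it is a cycle of an acyclic $\mathbb Z$-indexed complex $I$ of injectives such that $\mathrm{Hom}(E,I)$ is acyclic for every injective object $E$. An object $M$ has Gorenstein projective dimension at most $n\ge 0$ if there is an exact sequence $0\to G_n\to\cdots\to G_0\to M\to 0$ with all $G_i$ Gorenstein projective; Gorenstein injective dimension is defined dually. Write $\mathrm{GProj}$ and $\mathrm{GInj}$ for the full subcategories of Gorenstein projective and Gorenstein injective objects, and $\mathsf U$, respectively $\mathsf V$, for the full subcategories of objects of finite Gorenstein projective, respectively finite Gorenstein injective, dimension. With the short exact sequences whose terms all lie in them, $\mathrm{GProj}$ and $\mathrm{GInj}$ are Frobenius categories. The *stable category* $\underline{\mathcal E}$ of a Frobenius category $\mathcal E$ has the objects of $\mathcal E$, and two parallel morphisms are identified if their difference factors through a projective-injective object of $\mathcal E$.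 Its suspension is given by conflations $G\rightarrowtail I\twoheadrightarrow \Sigma G$ with $I$ projective-injective, and its distinguished triangles are those isomorphic in $\underline{\mathcal E}$ to $G\xrightarrow{u}G'\xrightarrow{v}G''\xrightarrow{w}\Sigma G$, where $u$ is a morphism of $\mathcal E$, $G''$ is the pushout of $G'\xleftarrow{u}G\rightarrowtail I$, $v$ is the canonical morphism, and $w$ is induced by $I\twoheadrightarrow\Sigma G$ and $0\colon G'\to\Sigma G$. An *equivalence of triangulated categories* is an equivalence of categories that commutes with the suspensions up to a natural isomorphism and, by means of it, sends distinguished triangles to distinguished triangles. A *Sharp–Foxby adjunction* is an adjunction $S\dashv T$ of endofunctors such that 1. $S$ maps $\mathsf U$ to $\mathsf V$ and maps objects of finite projective dimension to objects of finite injective dimension; 2. $S$ maps every short exact sequence with all terms in $\mathsf U$ to a short exact sequence; 3. $T$ maps $\mathsf V$ to $\mathsf U$ and maps objects of finite injective dimension to objects of finite projective dimension; 4. $T$ maps every short exact sequence with all terms in $\mathsf V$ to a short exact sequence; 5. the unit $X\to TSX$ is an isomorphism for all $X\in\mathsf U$; 6. the counit $STY\to Y$ is an isomorphism for all $Y\in\mathsf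 V$. **Theorem.** Let $(S,T)$ be a Sharp–Foxby adjunction on $\mathcal A$; in particular, the stable categories $\underline{\mathrm{GProj}}(\mathcal A)$ and $\underline{\mathrm{GInj}}(\mathcal A)$ are equivalent as triangulated categories. Suppose that the finitistic projective dimension $\sup\{\mathrm{pd}\,M \mid \mathrm{pd}\,M<\infty\}$ and the finitistic injective dimension $\sup\{\mathrm{id}\,M\mid \mathrm{id}\,M<\infty\}$ of $\mathcal A$ are finite. Then degreewise application of $S$ and $T$, with degreewise unit and counit, is a Sharp–Foxby adjunction on the category $\mathrm{Ch}(\mathcal A)$ of unbounded chain complexes in $\mathcal A$, and hence $\underline{\mathrm{GProj}}(\mathrm{Ch}(\mathcal A))$ and $\underline{\mathrm{GInj}}(\mathrm{Ch}(\mathcal A))$ are equivalent as triangulated categories. -/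

import Mathlib

open CategoryTheory Limits

universe v u

namespace SharpFoxby

noncomputable section

/-! ## Relative projective-injective objects and stable categories of exact subcategories -/

section Stable

variable {C : Type u} [Category.{v} C] [Abelian C]

/-- The conflations of a full subcategory `E` of an abelian category: the short exact sequences
of the ambient category all of whose terms lie in `E`. -/
structure IsConflation (E : ObjectProperty C) (X : ShortComplex C) : Prop where
  shortExact : X.ShortExact
  prop₁ : E X.X₁
  prop₂ : E X.X₂
  prop₃ : E X.X₃

/-- `P` lies in `E`, and it is projective and injective relative to the conflations of `E`. -/
structure IsProInjective (E : ObjectProperty C) (P : C) : Prop where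
  prop : E P
  projective : ∀ (X : ShortComplex C), IsConflation E X →
    ∀ f : P ⟶ X.X₃, ∃ g : P ⟶ X.X₂, g ≫ X.g = f
  injective : ∀ (X : ShortComplex C), IsConflation E X →
    ∀ f : X.X₁ ⟶ P, ∃ g : X.X₂ ⟶ P, X.f ≫ g = f

/-- Each object `G` of `E` has a conflation `G ⟶ I ⟶ G'` with `I` projective-injective in `E`.
This is the property of Frobenius categories that the suspension functor is built from. -/
class HasProInjectiveEmbeddings (E : ObjectProperty C) : Prop where
  exists_embedding : ∀ G : C, E G → ∃ (I G' : C) (i : G ⟶ I) (p : I ⟶ G') (w : i ≫ p = 0),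
    IsConflation E (ShortComplex.mk i p w) ∧ IsProInjective E I

/-- Two parallel morphisms are related if their difference factors through an object that is
projective-injective in `E`. -/
def stableRel (E : ObjectProperty C) : HomRel E.FullSubcategory := fun X Y f g =>
  ∃ (P : C) (a : X.obj ⟶ P) (b : P ⟶ Y.obj), IsProInjective E P ∧ f.hom - g.hom = a ≫ b

/-- The stable category of `E`: the quotient of `E` by `stableRel E`. -/
abbrev StableCategory (E : ObjectProperty C) := CategoryTheory.Quotient (stableRel E)

/-- The projection from `E` to its stable category. -/
abbrev toStable (E : ObjectProperty C) : E.FullSubcategory ⥤ StableCategory E :=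
  CategoryTheory.Quotient.functor (stableRel E)

section Suspension

variable (E : ObjectProperty C) [HasProInjectiveEmbeddings E]

/-- The middle term of a chosen conflation `G ⟶ I ⟶ ΣG` with `I` projective-injective. -/
def susMid (G : E.FullSubcategory) : C :=
  (HasProInjectiveEmbeddings.exists_embedding G.obj G.property).choose

lemma susMid_spec (G : E.FullSubcategory) :
    ∃ (G' : C) (i : G.obj ⟶ susMid E G) (p : susMid E G ⟶ G') (w : i ≫ p = 0),
      IsConflation E (ShortComplex.mk i p w) ∧ IsProInjective E (susMid E G) :=
  (HasProInjectiveEmbeddings.exists_embedding G.obj G.property).choose_spec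

lemma susObj_spec (G : E.FullSubcategory) :
    ∃ (G' : E.FullSubcategory) (i : G.obj ⟶ susMid E G) (p : susMid E G ⟶ G'.obj) (w : i ≫ p = 0),
      IsConflation E (ShortComplex.mk i p w) ∧ IsProInjective E (susMid E G) := by
  obtain ⟨G', i, p, w, h, h'⟩ := susMid_spec E G
  exact ⟨⟨G', h.prop₃⟩, i, p, w, h, h'⟩

/-- The suspension of an object of `E`: the last term of the chosen conflation. -/
def susObj (G : E.FullSubcategory) : E.FullSubcategory := (susObj_spec E G).choose

/-- The inflation `i : G ⟶ I` of the chosen conflation. -/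
def susι (G : E.FullSubcategory) : G.obj ⟶ susMid E G := (susObj_spec E G).choose_spec.choose

/-- The deflation `p : I ⟶ ΣG` of the chosen conflation. -/
def susπ (G : E.FullSubcategory) : susMid E G ⟶ (susObj E G).obj :=
  (susObj_spec E G).choose_spec.choose_spec.choose

lemma susι_π (G : E.FullSubcategory) : susι E G ≫ susπ E G = 0 :=
  (susObj_spec E G).choose_spec.choose_spec.choose_spec.choose

lemma sus_conflation (G : E.FullSubcategory) :
    IsConflation E (ShortComplex.mk (susι E G) (susπ E G) (susι_π E G)) :=
  (susObj_spec E G).choose_spec.choose_spec.choose_spec.choose_spec.1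

lemma susMid_proInjective (G : E.FullSubcategory) : IsProInjective E (susMid E G) :=
  (susObj_spec E G).choose_spec.choose_spec.choose_spec.choose_spec.2

instance (G : E.FullSubcategory) : Epi (susπ E G) := (sus_conflation E G).shortExact.epi_g

/-- `f'` is induced by `f` through some morphism `a` between the middle terms of the chosen
conflations. -/
def IsSusLift {G H : E.FullSubcategory} (f : G ⟶ H) (f' : susObj E G ⟶ susObj E H) : Prop :=
  ∃ a : susMid E G ⟶ susMid E H, susι E G ≫ a = f.hom ≫ susι E H ∧
    susπ E G ≫ f'.hom = a ≫ susπ E H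

variable {E}

lemma exists_desc {G : E.FullSubcategory} {Z : C} (h : susMid E G ⟶ Z)
    (hh : susι E G ≫ h = 0) : ∃ s : (susObj E G).obj ⟶ Z, susπ E G ≫ s = h :=
  ⟨(sus_conflation E G).shortExact.gIsCokernel.desc (CokernelCofork.ofπ h hh),
    (sus_conflation E G).shortExact.gIsCokernel.fac (CokernelCofork.ofπ h hh)
      WalkingParallelPair.one⟩

lemma exists_susLift {G H : E.FullSubcategory} (f : G ⟶ H) :
    ∃ f' : susObj E G ⟶ susObj E H, IsSusLift E f f' := by
  obtain ⟨a, ha⟩ := (susMid_proInjective E H).injective _ (sus_conflation E G) (f.hom ≫ susι E H)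
  dsimp at a ha
  obtain ⟨s, hs⟩ := exists_desc (a ≫ susπ E H) (by
    rw [← Category.assoc, ha, Category.assoc, susι_π, comp_zero])
  exact ⟨ObjectProperty.homMk s, a, ha, hs⟩

lemma IsSusLift.sound {G H : E.FullSubcategory} {f g : G ⟶ H} {f' g' : susObj E G ⟶ susObj E H}
    (hf : IsSusLift E f f') (hg : IsSusLift E g g') (h : f = g ∨ stableRel E f g) :
    (toStable E).map f' = (toStable E).map g' := by
  obtain ⟨a, ha, ha'⟩ := hf
  obtain ⟨b, hb, hb'⟩ := hg
  obtain ⟨c, hc, hc'⟩ : ∃ c : susMid E G ⟶ susMid E H,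
      susι E G ≫ c = (f.hom - g.hom) ≫ susι E H ∧ c ≫ susπ E H = 0 := by
    obtain rfl | ⟨P, x, y, hP, hxy⟩ := h
    · exact ⟨0, by simp, by simp⟩
    · obtain ⟨z, hz⟩ := hP.injective _ (sus_conflation E G) x
      dsimp at z hz
      refine ⟨z ≫ y ≫ susι E H, ?_, ?_⟩
      · rw [hxy, ← Category.assoc, hz, Category.assoc]
      · rw [Category.assoc, Category.assoc, susι_π, comp_zero, comp_zero]
  obtain ⟨s, hs⟩ := exists_desc (a - b - c) (by
    rw [Preadditive.comp_sub, Preadditive.comp_sub, ha, hb, hc, Preadditive.sub_comp, sub_self])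
  refine CategoryTheory.Quotient.sound _ ⟨susMid E H, s, susπ E H, susMid_proInjective E H, ?_⟩
  rw [← cancel_epi (susπ E G)]
  refine (Preadditive.comp_sub ..).trans ?_
  rw [ha', hb', ← Category.assoc, hs, Preadditive.sub_comp, Preadditive.sub_comp, hc', sub_zero]

lemma IsSusLift.id (G : E.FullSubcategory) : IsSusLift E (𝟙 G) (𝟙 (susObj E G)) :=
  ⟨𝟙 _, by simp, (Category.comp_id _).trans (Category.id_comp _).symm⟩

lemma IsSusLift.comp {G H K : E.FullSubcategory} {f : G ⟶ H} {g : H ⟶ K}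
    {f' : susObj E G ⟶ susObj E H} {g' : susObj E H ⟶ susObj E K}
    (hf : IsSusLift E f f') (hg : IsSusLift E g g') : IsSusLift E (f ≫ g) (f' ≫ g') := by
  obtain ⟨a, ha, ha'⟩ := hf
  obtain ⟨b, hb, hb'⟩ := hg
  refine ⟨a ≫ b, ?_, ?_⟩
  · rw [← Category.assoc, ha, Category.assoc, hb, ObjectProperty.FullSubcategory.comp_hom,
      Category.assoc]
  · rw [ObjectProperty.FullSubcategory.comp_hom, ← Category.assoc, ha', Category.assoc, hb',
      Category.assoc]

variable (E)

/-- The functor from `E` to its stable category sending `G` to `ΣG`. -/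
def preSuspension : E.FullSubcategory ⥤ StableCategory E where
  obj G := (toStable E).obj (susObj E G)
  map f := (toStable E).map (exists_susLift f).choose
  map_id G := by
    rw [← (toStable E).map_id]
    exact IsSusLift.sound (exists_susLift (𝟙 G)).choose_spec (IsSusLift.id G) (Or.inl rfl)
  map_comp f g := by
    rw [← (toStable E).map_comp]
    exact IsSusLift.sound (exists_susLift (f ≫ g)).choose_spec
      (IsSusLift.comp (exists_susLift f).choose_spec (exists_susLift g).choose_spec) (Or.inl rfl)

/-- The suspension functor on the stable category of `E`: it sends `G` to the cokernel of the
chosen inflation of `G` into a projective-injective object. -/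
def suspension : StableCategory E ⥤ StableCategory E :=
  CategoryTheory.Quotient.lift (stableRel E) (preSuspension E) fun _ _ f g h =>
    IsSusLift.sound (exists_susLift f).choose_spec (exists_susLift g).choose_spec (Or.inr h)

end Suspension

/-! ## Triangles and triangulated equivalences -/

/-- A triangle `X ⟶ Y ⟶ Z ⟶ ΣX` in a category with an endofunctor `Σ`. -/
structure Tri {D : Type*} [Category* D] (sus : D ⥤ D) where
  {X Y Z : D}
  f : X ⟶ Y
  g : Y ⟶ Z
  h : Z ⟶ sus.obj X

/-- Isomorphism of triangles. -/
def Tri.Iso {D : Type*} [Category* D] {sus : D ⥤ D} (A B : Tri sus) : Prop :=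
  ∃ (a : A.X ≅ B.X) (b : A.Y ≅ B.Y) (c : A.Z ≅ B.Z),
    A.f ≫ b.hom = a.hom ≫ B.f ∧ A.g ≫ c.hom = b.hom ≫ B.g ∧
      A.h ≫ sus.map a.hom = c.hom ≫ B.h

/-- The image of a triangle under a functor that commutes with the suspensions up to `φ`. -/
def Tri.map {D D' : Type*} [Category* D] [Category* D'] {sus : D ⥤ D} {sus' : D' ⥤ D'}
    (F : D ⥤ D') (φ : sus ⋙ F ≅ F ⋙ sus') (A : Tri sus) : Tri sus' where
  f := F.map A.f
  g := F.map A.g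
  h := F.map A.h ≫ φ.hom.app A.X

/-- The standard triangle `X ⟶ Y ⟶ Z ⟶ ΣX` given by morphisms `u`, `v`, `w` of `E`. -/
def stdTri (E : ObjectProperty C) [HasProInjectiveEmbeddings E] {X Y Z : E.FullSubcategory}
    (u : X ⟶ Y) (v : Y ⟶ Z) (w : Z ⟶ susObj E X) : Tri (suspension E) where
  f := (toStable E).map u
  g := (toStable E).map v
  h := (toStable E).map w

/-- `(u, v, w)` fits into a commutative diagram with rows the chosen conflation
`X ⟶ I ⟶ ΣX` and `Y ⟶ Z ⟶ ΣX`, whose left-hand square is a pushout and whose right-hand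
vertical map is the identity. -/
def IsStandard (E : ObjectProperty C) [HasProInjectiveEmbeddings E] {X Y Z : E.FullSubcategory}
    (u : X ⟶ Y) (v : Y ⟶ Z) (w : Z ⟶ susObj E X) : Prop :=
  ∃ t : susMid E X ⟶ Z.obj,
    IsPushout (susι E X) u.hom t v.hom ∧ t ≫ w.hom = susπ E X ∧ v.hom ≫ w.hom = 0

/-- The distinguished triangles of the stable category: those isomorphic to a standard one. -/
def IsDistinguished (E : ObjectProperty C) [HasProInjectiveEmbeddings E]
    (A : Tri (suspension E)) : Prop :=
  ∃ (X Y Z : E.FullSubcategory) (u : X ⟶ Y) (v : Y ⟶ Z) (w : Z ⟶ susObj E X),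
    IsStandard E u v w ∧ A.Iso (stdTri E u v w)

/-- The stable categories of `E` and `E'` are equivalent as triangulated categories: there are an
equivalence of categories and a natural isomorphism making it commute with the suspensions, such
that distinguished triangles are sent to distinguished triangles. -/
def TriangulatedEquivalent {C' : Type*} [Category* C'] [Abelian C']
    (E : ObjectProperty C) [HasProInjectiveEmbeddings E]
    (E' : ObjectProperty C') [HasProInjectiveEmbeddings E'] : Prop :=
  ∃ (e : StableCategory E ≌ StableCategory E')
    (φ : suspension E ⋙ e.functor ≅ e.functor ⋙ suspension E'),
    ∀ A : Tri (suspension E), IsDistinguished E A → IsDistinguished E' (A.map e.functor φ)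

end Stable

/-! ## Gorenstein projective and Gorenstein injective objects -/

section Gorenstein

variable {C : Type u} [Category.{v} C] [Abelian C]

/-- An acyclic complex of projectives `⋯ ⟶ P₁ ⟶ P₀ ⟶ P₋₁ ⟶ ⋯` is totally acyclic if
`Hom(P, Q)` is acyclic for each projective object `Q`. -/
structure IsTotallyAcyclicProj (P : ChainComplex C ℤ) : Prop where
  projective : ∀ n, Projective (P.X n)
  acyclic : P.Acyclic
  hom_exact : ∀ Q : C, Projective Q → ∀ (n : ℤ) (f : P.X n ⟶ Q), P.d (n + 1) n ≫ f = 0 →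
    ∃ g : P.X (n - 1) ⟶ Q, P.d n (n - 1) ≫ g = f

/-- An acyclic complex of injectives `⋯ ⟶ I₁ ⟶ I₀ ⟶ I₋₁ ⟶ ⋯` is totally acyclic if
`Hom(J, I)` is acyclic for each injective object `J`. -/
structure IsTotallyAcyclicInj (I : ChainComplex C ℤ) : Prop where
  injective : ∀ n, Injective (I.X n)
  acyclic : I.Acyclic
  hom_exact : ∀ J : C, Injective J → ∀ (n : ℤ) (f : J ⟶ I.X n), f ≫ I.d n (n - 1) = 0 →
    ∃ g : J ⟶ I.X (n + 1), g ≫ I.d (n + 1) n = f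

variable (C) in
/-- Gorenstein projective objects: the cycles of totally acyclic complexes of projectives. -/
def GProj : ObjectProperty C := fun G =>
  ∃ P : ChainComplex C ℤ, IsTotallyAcyclicProj P ∧ ∃ j : ℤ, Nonempty (G ≅ P.cycles j)

variable (C) in
/-- Gorenstein injective objects: the cycles of totally acyclic complexes of injectives. -/
def GInj : ObjectProperty C := fun H =>
  ∃ I : ChainComplex C ℤ, IsTotallyAcyclicInj I ∧ ∃ j : ℤ, Nonempty (H ≅ I.cycles j)

/-- `GpdLE n M`: there is an exact sequence `0 ⟶ Gₙ ⟶ ⋯ ⟶ G₀ ⟶ M ⟶ 0` with Gorenstein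
projective `Gᵢ`. The sequence is given by the short exact sequences it is spliced from. -/
def GpdLE : ℕ → C → Prop
  | 0, M => GProj C M
  | n + 1, M => ∃ X : ShortComplex C, X.ShortExact ∧ X.X₃ = M ∧ GProj C X.X₂ ∧ GpdLE n X.X₁

/-- `GidLE n M`: there is an exact sequence `0 ⟶ M ⟶ H₀ ⟶ ⋯ ⟶ H₋ₙ ⟶ 0` with Gorenstein
injective terms. The sequence is given by the short exact sequences it is spliced from. -/
def GidLE : ℕ → C → Prop
  | 0, M => GInj C M
  | n + 1, M => ∃ X : ShortComplex C, X.ShortExact ∧ X.X₁ = M ∧ GInj C X.X₂ ∧ GidLE n X.X₃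

variable (C) in
/-- Objects of finite Gorenstein projective dimension. -/
def FinGpd : ObjectProperty C := fun M => ∃ n, GpdLE n M

variable (C) in
/-- Objects of finite Gorenstein injective dimension. -/
def FinGid : ObjectProperty C := fun M => ∃ n, GidLE n M

variable (C) in
/-- Objects of finite projective dimension. -/
def FinPd : ObjectProperty C := fun M => projectiveDimension M < ⊤

variable (C) in
/-- Objects of finite injective dimension. -/
def FinId : ObjectProperty C := fun M => injectiveDimension M < ⊤

variable (C) in
/-- The finitistic projective dimension: the supremum of the finite projective dimensions. -/
def finitisticProjectiveDimension : WithBot ℕ∞ :=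
  ⨆ M : {M : C // FinPd C M}, projectiveDimension M.1

variable (C) in
/-- The finitistic injective dimension: the supremum of the finite injective dimensions. -/
def finitisticInjectiveDimension : WithBot ℕ∞ :=
  ⨆ M : {M : C // FinId C M}, injectiveDimension M.1

lemma iCycles_toCycles (K : ChainComplex C ℤ) (j : ℤ) :
    K.iCycles j ≫ K.toCycles j (j - 1) = 0 := by
  rw [← cancel_mono (K.iCycles (j - 1))]; simp

lemma cycles_shortExact (K : ChainComplex C ℤ) (hK : K.Acyclic) (j : ℤ) :
    (ShortComplex.mk (K.iCycles j) (K.toCycles j (j - 1)) (iCycles_toCycles K j)).ShortExact := by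
  have hr : (ComplexShape.down ℤ).Rel j (j - 1) := by simp
  have h := (K.exactAt_iff' j (j - 1) (j - 1 - 1) ((ComplexShape.down ℤ).prev_eq' hr)
    ((ComplexShape.down ℤ).next_eq' (by simp))).1 (hK (j - 1))
  rw [ShortComplex.exact_iff_exact_up_to_refinements] at h
  have h1 : Epi (K.toCycles j (j - 1)) := by
    rw [epi_iff_surjective_up_to_refinements]
    intro A y
    obtain ⟨A', π, hπ, x, hx⟩ := h (y ≫ K.iCycles (j - 1))
      (show (y ≫ K.iCycles (j - 1)) ≫ K.d (j - 1) (j - 1 - 1) = 0 by simp)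
    change A' ⟶ K.X j at x
    replace hx : π ≫ y ≫ K.iCycles (j - 1) = x ≫ K.d j (j - 1) := hx
    refine ⟨A', π, hπ, x, ?_⟩
    rw [← cancel_mono (K.iCycles (j - 1))]
    simpa using hx
  refine ShortComplex.ShortExact.mk' ?_ (inferInstanceAs (Mono (K.iCycles j))) h1
  rw [ShortComplex.exact_iff_exact_up_to_refinements]
  intro A x hx
  change A ⟶ K.X j at x
  replace hx : x ≫ K.toCycles j (j - 1) = 0 := hx
  refine ⟨A, 𝟙 _, inferInstance, K.liftCycles x (j - 1)
    ((ComplexShape.down ℤ).next_eq' hr) ?_, ?_⟩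
  · rw [← K.toCycles_i, ← Category.assoc, hx, zero_comp]
  · exact (Category.id_comp _).trans (K.liftCycles_i ..).symm

lemma exists_desc_of_map {X Y : ShortComplex C} (hX : X.ShortExact) (hY : Y.ShortExact)
    (a : Y.X₁ ⟶ X.X₁) (b : Y.X₂ ⟶ X.X₂) (e : Y.X₃ ≅ X.X₃) (hab : a ≫ X.f = Y.f ≫ b)
    (hbe : b ≫ X.g = Y.g ≫ e.hom) {Q : C} (s : X.X₁ ⟶ Q) (t : Y.X₂ ⟶ Q)
    (hst : a ≫ s = Y.f ≫ t) : ∃ w : X.X₂ ⟶ Q, X.f ≫ w = s := by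
  have := hX.mono_f
  have := hX.epi_g
  have := hY.mono_f
  have := hY.epi_g
  let W : ShortComplex C := ShortComplex.mk (biprod.lift a (-Y.f)) (biprod.desc X.f b)
    (by simp [hab])
  have hW : W.Exact := by
    rw [ShortComplex.exact_iff_exact_up_to_refinements]
    intro A x hx
    change A ⟶ X.X₁ ⊞ Y.X₂ at x
    replace hx : x ≫ biprod.desc X.f b = 0 := hx
    have hx' : (x ≫ biprod.fst) ≫ X.f + (x ≫ biprod.snd) ≫ b = 0 := by
      rw [biprod.desc_eq, Preadditive.comp_add] at hx
      simpa using hx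
    have h0 : (x ≫ biprod.snd) ≫ Y.g = 0 := by
      have := hx' =≫ X.g
      rw [← cancel_mono e.hom]
      simpa [hbe] using this
    obtain ⟨k, hk⟩ : ∃ k : A ⟶ Y.X₁, k ≫ Y.f = x ≫ biprod.snd :=
      ⟨hY.exact.lift _ h0, hY.exact.lift_f _ h0⟩
    have h1 : x ≫ biprod.fst = -(k ≫ a) := by
      have h2 : (k ≫ a) ≫ X.f = (x ≫ biprod.snd) ≫ b := by
        rw [Category.assoc, hab, ← Category.assoc, hk]
      rw [← cancel_mono X.f, Preadditive.neg_comp, h2]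
      exact eq_neg_of_add_eq_zero_left hx'
    refine ⟨A, 𝟙 _, inferInstance, -k, ?_⟩
    change 𝟙 _ ≫ x = (-k) ≫ biprod.lift a (-Y.f)
    rw [Category.id_comp]
    apply biprod.hom_ext
    · simp [h1]
    · simp [hk]
  have : Epi W.g := by
    change Epi (biprod.desc X.f b)
    rw [epi_iff_surjective_up_to_refinements]
    intro A y
    obtain ⟨A', π, hπ, p, hp⟩ := surjective_up_to_refinements_of_epi Y.g (y ≫ X.g ≫ e.inv)
    have h0 : (π ≫ y - p ≫ b) ≫ X.g = 0 := by
      have := hp =≫ e.hom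
      simp only [Category.assoc, Iso.inv_hom_id, Category.comp_id] at this
      rw [Preadditive.sub_comp, Category.assoc, Category.assoc, hbe, this, sub_self]
    refine ⟨A', π, hπ, biprod.lift (hX.exact.lift _ h0) p, ?_⟩
    rw [biprod.lift_desc, hX.exact.lift_f]
    abel
  have hd : W.f ≫ biprod.desc s t = 0 := by
    change biprod.lift a (-Y.f) ≫ biprod.desc s t = 0
    simp [hst]
  refine ⟨hW.desc _ hd, ?_⟩
  have h := hW.g_desc _ hd
  change biprod.desc X.f b ≫ _ = _ at h
  simpa using biprod.inl ≫= h

lemma exists_lift_of_map {X Y : ShortComplex C} (hX : X.ShortExact) (hY : Y.ShortExact)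
    (e : X.X₁ ≅ Y.X₁) (b : X.X₂ ⟶ Y.X₂) (c : X.X₃ ⟶ Y.X₃) (heb : e.hom ≫ Y.f = X.f ≫ b)
    (hbc : b ≫ Y.g = X.g ≫ c) {Q : C} (s : Q ⟶ X.X₃) (t : Q ⟶ Y.X₂)
    (hst : s ≫ c = t ≫ Y.g) : ∃ w : Q ⟶ X.X₂, w ≫ X.g = s := by
  have := hX.mono_f
  have := hX.epi_g
  have := hY.mono_f
  have := hY.epi_g
  let W : ShortComplex C := ShortComplex.mk (biprod.lift X.g b) (biprod.desc c (-Y.g))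
    (by simp [hbc])
  have hW : W.Exact := by
    rw [ShortComplex.exact_iff_exact_up_to_refinements]
    intro A x hx
    change A ⟶ X.X₃ ⊞ Y.X₂ at x
    replace hx : x ≫ biprod.desc c (-Y.g) = 0 := hx
    have hx' : (x ≫ biprod.fst) ≫ c = (x ≫ biprod.snd) ≫ Y.g := by
      rw [biprod.desc_eq, Preadditive.comp_add] at hx
      rw [← sub_eq_zero]
      simpa [sub_eq_add_neg] using hx
    obtain ⟨A', π, hπ, y, hy⟩ := surjective_up_to_refinements_of_epi X.g (x ≫ biprod.fst)
    have h0 : (π ≫ x ≫ biprod.snd - y ≫ b) ≫ Y.g = 0 := by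
      have h1 := π ≫= hx'
      rw [← Category.assoc, hy] at h1
      simp only [Category.assoc] at h1
      simp only [Preadditive.sub_comp, Category.assoc, hbc, h1, sub_self]
    obtain ⟨k, hk⟩ : ∃ k : A' ⟶ Y.X₁, k ≫ Y.f = π ≫ x ≫ biprod.snd - y ≫ b :=
      ⟨hY.exact.lift _ h0, hY.exact.lift_f _ h0⟩
    have h2 : (k ≫ e.inv ≫ X.f) ≫ b = k ≫ Y.f := by
      rw [Category.assoc, Category.assoc, ← heb, Iso.inv_hom_id_assoc]
    refine ⟨A', π, hπ, y + k ≫ e.inv ≫ X.f, ?_⟩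
    change π ≫ x = (y + k ≫ e.inv ≫ X.f) ≫ biprod.lift X.g b
    apply biprod.hom_ext
    · simp [hy]
    · rw [Category.assoc, Category.assoc, biprod.lift_snd, Preadditive.add_comp, h2, hk]
      abel
  have : Mono W.f := by
    change Mono (biprod.lift X.g b)
    refine Preadditive.mono_of_cancel_zero _ fun {A} y hy => ?_
    have h0 : y ≫ X.g = 0 := by simpa using hy =≫ biprod.fst
    have h1 : y ≫ b = 0 := by simpa using hy =≫ biprod.snd
    have h2 := hX.exact.lift_f _ h0
    have h3 : hX.exact.lift _ h0 = 0 := by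
      rw [← cancel_mono e.hom, ← cancel_mono Y.f, Category.assoc, heb, ← Category.assoc, h2, h1]
      simp
    rw [← h2, h3, zero_comp]
  have hd : biprod.lift s t ≫ W.g = 0 := by
    change biprod.lift s t ≫ biprod.desc c (-Y.g) = 0
    simp [hst]
  refine ⟨hW.lift _ hd, ?_⟩
  have h := hW.lift_f _ hd
  change _ ≫ biprod.lift X.g b = _ at h
  simpa using h =≫ biprod.fst

/-- The contractible complex `Q ⟶ Q` in degrees `1` and `0`. -/
def disk (Q : C) : ChainComplex C ℤ :=
  HomologicalComplex.double (𝟙 Q) (show (ComplexShape.down ℤ).Rel 1 0 by simp)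

lemma disk_isZero (Q : C) (n : ℤ) (h₁ : n ≠ 1) (h₀ : n ≠ 0) : IsZero ((disk Q).X n) :=
  HomologicalComplex.isZero_double_X _ _ _ h₁ h₀

instance (Q : C) : IsIso ((disk Q).d 1 0) := by
  unfold disk
  rw [HomologicalComplex.double_d _ _ (by simp)]
  infer_instance

lemma disk_acyclic (Q : C) : (disk Q).Acyclic := by
  intro n
  rw [(disk Q).exactAt_iff' (n + 1) n (n - 1) (by simp) (by simp)]
  by_cases h₁ : n = 1
  · subst h₁
    have h : (disk Q).d (1 + 1) 1 = 0 :=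
      (disk_isZero Q (1 + 1) (by simp) (by simp)).eq_of_src _ _
    refine (ShortComplex.exact_iff_mono _ h).2 ?_
    change Mono ((disk Q).d 1 0)
    infer_instance
  · by_cases h₀ : n = 0
    · subst h₀
      have h : (disk Q).d 0 (0 - 1) = 0 :=
        (disk_isZero Q (0 - 1) (by simp) (by simp)).eq_of_tgt _ _
      refine (ShortComplex.exact_iff_epi _ h).2 ?_
      change Epi ((disk Q).d 1 0)
      infer_instance
    · exact ShortComplex.exact_of_isZero_X₂ _ (disk_isZero Q n h₁ h₀)

/-- A property that holds for `Q` and for zero objects holds for the terms of `disk Q`. -/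
lemma disk_prop (Q : C) (R : C → Prop) (hQ : ∀ X, Nonempty (X ≅ Q) → R X)
    (h0 : ∀ X, IsZero X → R X) (n : ℤ) : R ((disk Q).X n) := by
  by_cases h₁ : n = 1
  · subst h₁
    exact hQ _ ⟨HomologicalComplex.doubleXIso₀ (𝟙 Q) _⟩
  · by_cases h₀ : n = 0
    · subst h₀
      exact hQ _ ⟨HomologicalComplex.doubleXIso₁ (𝟙 Q) _ (by simp)⟩
    · exact h0 _ (disk_isZero Q n h₁ h₀)

lemma disk_cycles (Q : C) : Nonempty (Q ≅ (disk Q).cycles 0) := by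
  have h : (disk Q).d 0 (-1) = 0 := (disk_isZero Q (-1) (by simp) (by simp)).eq_of_tgt _ _
  have := (disk Q).isIso_iCycles 0 (-1) (by simp) h
  exact ⟨(HomologicalComplex.doubleXIso₁ (𝟙 Q) _ (by simp)).symm ≪≫
    (asIso ((disk Q).iCycles 0)).symm⟩

lemma disk_totallyAcyclicProj (Q : C) [Projective Q] : IsTotallyAcyclicProj (disk Q) where
  projective n := disk_prop Q (fun X => Projective X)
    (fun X ⟨e⟩ => Projective.of_iso e.symm inferInstance) (fun X h => h.projective) n
  acyclic := disk_acyclic Q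
  hom_exact R _ n f hf := by
    by_cases h₁ : n = 1
    · subst h₁
      exact ⟨inv ((disk Q).d 1 0) ≫ f, by
        change (disk Q).d 1 0 ≫ inv ((disk Q).d 1 0) ≫ f = f
        simp⟩
    · refine ⟨0, ?_⟩
      by_cases h₀ : n = 0
      · subst h₀
        replace hf : (disk Q).d 1 0 ≫ f = 0 := hf
        rw [← cancel_epi ((disk Q).d 1 0), hf, comp_zero, comp_zero]
      · exact (disk_isZero Q n h₁ h₀).eq_of_src _ _

lemma disk_totallyAcyclicInj (Q : C) [Injective Q] : IsTotallyAcyclicInj (disk Q) where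
  injective n := disk_prop Q (fun X => Injective X)
    (fun X ⟨e⟩ => Injective.of_iso e.symm inferInstance) (fun X h => h.injective) n
  acyclic := disk_acyclic Q
  hom_exact J _ n f hf := by
    by_cases h₀ : n = 0
    · subst h₀
      exact ⟨f ≫ inv ((disk Q).d 1 0), by
        change (f ≫ inv ((disk Q).d 1 0)) ≫ (disk Q).d 1 0 = f
        simp⟩
    · refine ⟨0, ?_⟩
      by_cases h₁ : n = 1
      · subst h₁
        replace hf : f ≫ (disk Q).d 1 0 = 0 := hf
        rw [← cancel_mono ((disk Q).d 1 0), hf, zero_comp, zero_comp]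
      · exact (disk_isZero Q n h₁ h₀).eq_of_tgt _ _

/-- Projective objects are projective-injective in the category of Gorenstein projectives. -/
lemma isProInjective_GProj (Q : C) [Projective Q] : IsProInjective (GProj C) Q where
  prop := ⟨disk Q, disk_totallyAcyclicProj Q, 0, disk_cycles Q⟩
  projective X hX f := by
    have := hX.shortExact.epi_g
    exact ⟨Projective.factorThru f X.g, by simp⟩
  injective X hX f := by
    obtain ⟨P, hP, j, ⟨e⟩⟩ := hX.prop₃
    obtain ⟨j, rfl⟩ : ∃ j', j = j' - 1 := ⟨j + 1, by simp⟩
    have hXs := hX.shortExact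
    have := hXs.epi_g
    have := hXs.mono_f
    have := hP.projective j
    have hY := cycles_shortExact P hP.acyclic j
    have hb := Projective.factorThru_comp (P.toCycles j (j - 1) ≫ e.inv) X.g
    generalize Projective.factorThru (P.toCycles j (j - 1) ≫ e.inv) X.g = b at hb
    have h0 : (P.iCycles j ≫ b) ≫ X.g = 0 := by
      rw [Category.assoc, hb, ← Category.assoc, iCycles_toCycles, zero_comp]
    obtain ⟨a, ha⟩ : ∃ a : P.cycles j ⟶ X.X₁, a ≫ X.f = P.iCycles j ≫ b :=
      ⟨hXs.exact.lift _ h0, hXs.exact.lift_f _ h0⟩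
    have hepi : Epi (P.toCycles (j + 1) j) := by
      have := (cycles_shortExact P hP.acyclic (j + 1)).epi_g
      change Epi (P.toCycles (j + 1) (j + 1 - 1)) at this
      rwa [show j + 1 - 1 = j by simp] at this
    obtain ⟨t, ht⟩ : ∃ t : P.X j ⟶ Q, P.d (j + 1) j ≫ t = P.toCycles (j + 1) j ≫ a ≫ f := by
      have hd : P.d (j + 1 + 1) (j + 1) ≫ P.toCycles (j + 1) j ≫ a ≫ f = 0 := by simp
      have := hP.hom_exact Q inferInstance (j + 1) _ hd
      rwa [show j + 1 - 1 = j by simp] at this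
    refine exists_desc_of_map hXs hY a b e.symm ha hb f t ?_
    rw [← cancel_epi (P.toCycles (j + 1) j)]
    change _ = P.toCycles (j + 1) j ≫ P.iCycles j ≫ t
    rw [← ht, ← Category.assoc, P.toCycles_i]

/-- Injective objects are projective-injective in the category of Gorenstein injectives. -/
lemma isProInjective_GInj (Q : C) [Injective Q] : IsProInjective (GInj C) Q where
  prop := ⟨disk Q, disk_totallyAcyclicInj Q, 0, disk_cycles Q⟩
  projective X hX f := by
    obtain ⟨I, hI, j, ⟨e⟩⟩ := hX.prop₁
    have hXs := hX.shortExact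
    have := hXs.epi_g
    have := hXs.mono_f
    have := hI.injective j
    have hY := cycles_shortExact I hI.acyclic j
    have hb := Injective.comp_factorThru (e.hom ≫ I.iCycles j) X.f
    generalize Injective.factorThru (e.hom ≫ I.iCycles j) X.f = b at hb
    have h0 : X.f ≫ b ≫ I.toCycles j (j - 1) = 0 := by
      rw [← Category.assoc, hb, Category.assoc, iCycles_toCycles, comp_zero]
    obtain ⟨c, hc⟩ : ∃ c : X.X₃ ⟶ I.cycles (j - 1), X.g ≫ c = b ≫ I.toCycles j (j - 1) :=
      ⟨hXs.exact.desc _ h0, hXs.exact.g_desc _ h0⟩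
    obtain ⟨t, ht⟩ : ∃ t : Q ⟶ I.X j, t ≫ I.d j (j - 1) = f ≫ c ≫ I.iCycles (j - 1) := by
      have := hI.hom_exact Q inferInstance (j - 1) (f ≫ c ≫ I.iCycles (j - 1)) (by simp)
      rwa [show j - 1 + 1 = j by simp] at this
    refine exists_lift_of_map hXs hY e b c hb.symm hc.symm f t ?_
    rw [← cancel_mono (I.iCycles (j - 1))]
    change (f ≫ c) ≫ _ = (t ≫ I.toCycles j (j - 1)) ≫ _
    rw [Category.assoc, ← ht, Category.assoc, I.toCycles_i]
  injective X hX f := by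
    have := hX.shortExact.mono_f
    exact ⟨Injective.factorThru f X.f, by simp⟩

lemma exists_embedding_of_cycles (E : ObjectProperty C) (K : ChainComplex C ℤ) (hK : K.Acyclic)
    (hE : ∀ G j, Nonempty (G ≅ K.cycles j) → E G) (hI : ∀ j, IsProInjective E (K.X j))
    (G : C) (j : ℤ) (e : G ≅ K.cycles j) :
    ∃ (I G' : C) (i : G ⟶ I) (p : I ⟶ G') (w : i ≫ p = 0),
      IsConflation E (ShortComplex.mk i p w) ∧ IsProInjective E I := by
  refine ⟨K.X j, K.cycles (j - 1), e.hom ≫ K.iCycles j, K.toCycles j (j - 1), ?_,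
    ⟨?_, hE _ j ⟨e⟩, (hI j).prop, hE _ (j - 1) ⟨Iso.refl _⟩⟩, hI j⟩
  · rw [Category.assoc, iCycles_toCycles, comp_zero]
  · exact ShortComplex.shortExact_of_iso
      (ShortComplex.isoMk (S₁ := ShortComplex.mk (K.iCycles j)
        (K.toCycles j (j - 1)) (iCycles_toCycles K j)) (S₂ := ShortComplex.mk (e.hom ≫ K.iCycles j) (K.toCycles j (j - 1))
        (by rw [Category.assoc, iCycles_toCycles, comp_zero])) e.symm (Iso.refl _) (Iso.refl _)
        (by simp) (by simp)) (cycles_shortExact K hK j)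

instance : HasProInjectiveEmbeddings (GProj C) where
  exists_embedding G := by
    rintro ⟨P, hP, j, ⟨e⟩⟩
    exact exists_embedding_of_cycles _ P hP.acyclic (fun _ j h => ⟨P, hP, j, h⟩)
      (fun j => by have := hP.projective j; exact isProInjective_GProj _) G j e

instance : HasProInjectiveEmbeddings (GInj C) where
  exists_embedding G := by
    rintro ⟨P, hP, j, ⟨e⟩⟩
    exact exists_embedding_of_cycles _ P hP.acyclic (fun _ j h => ⟨P, hP, j, h⟩)
      (fun j => by have := hP.injective j; exact isProInjective_GInj _) G j e

end Gorenstein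

/-! ## Sharp–Foxby adjunctions -/

section Adjunction

variable {C : Type u} [Category.{v} C] [Abelian C] {S T : C ⥤ C}

/-- Sharp–Foxby adjunctions `S ⊣ T` on an abelian category. Let `U` and `V` be the full
subcategories of objects of finite Gorenstein projective, respectively, finite Gorenstein injective
dimension. Then `S` maps `U` to `V` and objects of finite projective dimension to objects of finite
injective dimension, and it is exact on `U`; `T` maps `V` to `U` and objects of finite injective
dimension to objects of finite projective dimension, and it is exact on `V`; the unit is invertible
on `U` and the counit is invertible on `V`. The equations `w` hold for any adjoint functors; they
only serve to form the image of a short complex. -/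
structure IsSharpFoxby (adj : S ⊣ T) : Prop where
  map_finGpd : ∀ X, FinGpd C X → FinGid C (S.obj X)
  map_finPd : ∀ X, FinPd C X → FinId C (S.obj X)
  exact_left : ∀ X : ShortComplex C, X.ShortExact →
    FinGpd C X.X₁ → FinGpd C X.X₂ → FinGpd C X.X₃ →
    ∃ w : S.map X.f ≫ S.map X.g = 0, (ShortComplex.mk (S.map X.f) (S.map X.g) w).ShortExact
  map_finGid : ∀ Y, FinGid C Y → FinGpd C (T.obj Y)
  map_finId : ∀ Y, FinId C Y → FinPd C (T.obj Y)
  exact_right : ∀ Y : ShortComplex C, Y.ShortExact →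
    FinGid C Y.X₁ → FinGid C Y.X₂ → FinGid C Y.X₃ →
    ∃ w : T.map Y.f ≫ T.map Y.g = 0, (ShortComplex.mk (T.map Y.f) (T.map Y.g) w).ShortExact
  isIso_unit : ∀ X, FinGpd C X → IsIso (adj.unit.app X)
  isIso_counit : ∀ Y, FinGid C Y → IsIso (adj.counit.app Y)

/-- Degreewise application of the left adjoint to chain complexes. -/
def degreewiseLeft (adj : S ⊣ T) : ChainComplex C ℤ ⥤ ChainComplex C ℤ :=
  haveI := adj.isLeftAdjoint
  S.mapHomologicalComplex _

/-- Degreewise application of the right adjoint to chain complexes. -/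
def degreewiseRight (adj : S ⊣ T) : ChainComplex C ℤ ⥤ ChainComplex C ℤ :=
  haveI := adj.isRightAdjoint
  T.mapHomologicalComplex _

/-- The adjunction between the degreewise functors, with degreewise unit and counit. -/
def degreewiseAdjunction (adj : S ⊣ T) : degreewiseLeft adj ⊣ degreewiseRight adj where
  unit :=
    { app := fun X => { f := fun n => adj.unit.app (X.X n)
                        comm' := fun i j _ => (adj.unit.naturality (X.d i j)).symm }
      naturality := fun X Y f => by
        ext n
        exact adj.unit.naturality (f.f n) }
  counit :=
    { app := fun X => { f := fun n => adj.counit.app (X.X n)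
                        comm' := fun i j _ => (adj.counit.naturality (X.d i j)).symm }
      naturality := fun X Y f => by
        ext n
        exact adj.counit.naturality (f.f n) }
  left_triangle_components X := by
    ext n
    exact adj.left_triangle_components (X.X n)
  right_triangle_components X := by
    ext n
    exact adj.right_triangle_components (X.X n)

end Adjunction

end

end SharpFoxby

-- There are two independent halves: every Sharp–Foxby adjunction gives a triangulated equivalence,
-- and the degreewise adjunction is again Sharp–Foxby. The last claim of the theorem applies the
-- first half to complexes.
--
-- Equivalence. For `G` in GProj, `S G` has finite Gorenstein injective dimension, so it embeds in
-- some `H` in GInj with cokernel of finite injective dimension; the induced functor sends `G` to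
-- `H`. All verifications use Ext. If `0 ⟶ H₀ ⟶ I ⟶ H ⟶ 0` is exact with `I` injective and `H₀` in
-- GInj, then Hom(Y, H) modulo injectives is Ext¹(Y, H₀). Hence a morphism that induces isomorphisms
-- on positive Ext into GInj (`IsExtIso`) becomes invertible wherever it joins two objects of GInj.
-- Such morphisms include monomorphisms with cokernel, and epimorphisms with kernel, of finite
-- injective dimension, and they satisfy a five lemma. Full faithfulness combines this with its dual
-- on the GProj side through the adjunction bijection; essential surjectivity applies `S` to a GProj
-- cover of `T H`. Suspension and cones are compared by applying the five lemma to the images under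
-- `S` of their defining sequences.
--
-- Complexes. The evaluations Ch(A) ⟶ A form a Frobenius family: they are exact and jointly
-- faithful, and the disk complexes are at once free and cofree for them. Therefore a complex is
-- Gorenstein projective exactly when its terms are, and likewise for each bound on the Gorenstein
-- dimension (`gproj_iff`, `gpdLE_iff`, `gidLE_iff`). Termwise finite dimensions need not be
-- bounded; the finitistic dimensions supply the bound, because the Gorenstein dimension never
-- exceeds the dimension of a hull (`GpdLE.of_bound`). Thus most axioms hold degree by degree.
-- Finite projective dimension of a complex is not a termwise condition; here one reduces to
-- projective complexes, which are retracts of disks on projectives, and degreewise functors send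
-- disks to disks.

universe w

open scoped ZeroObject

namespace SharpFoxby

noncomputable section

/-! ## Short exact sequences, unbundled -/

section ShortExact

variable {C : Type u} [Category.{v} C] [Abelian C]

/-- `0 ⟶ X ⟶ Y ⟶ Z ⟶ 0` is a short exact sequence. -/
def IsSES {X Y Z : C} (f : X ⟶ Y) (g : Y ⟶ Z) : Prop :=
  ∃ w : f ≫ g = 0, (ShortComplex.mk f g w).ShortExact

namespace IsSES

variable {X Y Z : C} {f : X ⟶ Y} {g : Y ⟶ Z}

lemma w (h : IsSES f g) : f ≫ g = 0 := h.choose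

lemma shortExact (h : IsSES f g) : (ShortComplex.mk f g h.w).ShortExact := h.choose_spec

lemma mono (h : IsSES f g) : Mono f := h.shortExact.mono_f

lemma epi (h : IsSES f g) : Epi g := h.shortExact.epi_g

lemma exists_lift (h : IsSES f g) {A : C} (x : A ⟶ Y) (hx : x ≫ g = 0) :
    ∃ y : A ⟶ X, y ≫ f = x :=
  have := h.mono
  ⟨h.shortExact.exact.lift x hx, h.shortExact.exact.lift_f x hx⟩

lemma exists_desc (h : IsSES f g) {A : C} (x : Y ⟶ A) (hx : f ≫ x = 0) :
    ∃ y : Z ⟶ A, g ≫ y = x :=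
  have := h.epi
  ⟨h.shortExact.exact.desc x hx, h.shortExact.exact.g_desc x hx⟩

lemma of_lift (w : f ≫ g = 0) [Mono f] [Epi g]
    (hl : ∀ {A : C} (x : A ⟶ Y), x ≫ g = 0 → ∃ y : A ⟶ X, y ≫ f = x) : IsSES f g := by
  refine ⟨w, ShortComplex.ShortExact.mk' ?_ ‹_› ‹_›⟩
  rw [ShortComplex.exact_iff_exact_up_to_refinements]
  intro A x hx
  obtain ⟨y, hy⟩ := hl x hx
  exact ⟨A, 𝟙 _, inferInstance, y, by simpa using hy.symm⟩

lemma op (h : IsSES f g) : IsSES g.op f.op :=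
  ⟨by rw [← op_comp, h.w, op_zero], h.shortExact.op⟩

lemma unop {X Y Z : Cᵒᵖ} {f : X ⟶ Y} {g : Y ⟶ Z} (h : IsSES f g) : IsSES g.unop f.unop :=
  ⟨by rw [← unop_comp, h.w, unop_zero], h.shortExact.unop⟩

lemma of_desc (w : f ≫ g = 0) [Mono f] [Epi g]
    (hl : ∀ {A : C} (x : Y ⟶ A), f ≫ x = 0 → ∃ y : Z ⟶ A, g ≫ y = x) : IsSES f g := by
  refine IsSES.unop (f := g.op) (g := f.op) (of_lift (by rw [← op_comp, w, op_zero]) ?_)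
  intro A x hx
  obtain ⟨y, hy⟩ := hl x.unop (by simpa using congrArg Quiver.Hom.unop hx)
  exact ⟨y.op, by rw [← op_comp, hy]; rfl⟩

lemma of_mono (f : X ⟶ Y) [Mono f] : IsSES f (cokernel.π f) :=
  of_desc (by simp) fun x hx => ⟨cokernel.desc f x hx, by simp⟩

lemma of_epi (g : Y ⟶ Z) [Epi g] : IsSES (kernel.ι g) g :=
  of_lift (by simp) fun x hx => ⟨kernel.lift g x hx, by simp⟩

lemma of_iso (h : IsSES f g) {X' Y' Z' : C} {f' : X' ⟶ Y'} {g' : Y' ⟶ Z'} (a : X ≅ X')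
    (b : Y ≅ Y') (c : Z ≅ Z') (hab : a.hom ≫ f' = f ≫ b.hom) (hbc : b.hom ≫ g' = g ≫ c.hom) :
    IsSES f' g' := by
  have w : f' ≫ g' = 0 := by
    rw [← cancel_epi a.hom, ← Category.assoc, hab, Category.assoc, hbc, ← Category.assoc, h.w]
    simp
  exact ⟨w, ShortComplex.shortExact_of_iso
    (ShortComplex.isoMk (S₁ := ShortComplex.mk f g h.w) (S₂ := ShortComplex.mk f' g' w)
      a b c hab hbc) h.shortExact⟩

lemma iso_left (h : IsSES f g) {X' : C} (e : X' ≅ X) : IsSES (e.hom ≫ f) g :=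
  h.of_iso e.symm (Iso.refl _) (Iso.refl _) (by simp) (by simp)

lemma iso_right (h : IsSES f g) {Z' : C} (e : Z ≅ Z') : IsSES f (g ≫ e.hom) :=
  h.of_iso (Iso.refl _) (Iso.refl _) e (by simp) (by simp)

lemma inl_snd (X Z : C) : IsSES (biprod.inl : X ⟶ X ⊞ Z) (biprod.snd : X ⊞ Z ⟶ Z) :=
  of_lift (by simp) fun x hx => ⟨x ≫ biprod.fst, by
    apply biprod.hom_ext
    · simp
    · simp [hx]⟩

lemma inr_fst (X Z : C) : IsSES (biprod.inr : X ⟶ Z ⊞ X) (biprod.fst : Z ⊞ X ⟶ Z) :=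
  of_lift (by simp) fun x hx => ⟨x ≫ biprod.snd, by
    apply biprod.hom_ext
    · simp [hx]
    · simp⟩

lemma id_zero (X : C) : IsSES (𝟙 X) (0 : X ⟶ 0) :=
  of_lift (by simp) fun x _ => ⟨x, by simp⟩

lemma zero_id (X : C) : IsSES (0 : 0 ⟶ X) (𝟙 X) :=
  of_lift (by simp) fun x hx => ⟨0, by simpa using hx.symm⟩

lemma biprod_map (h : IsSES f g) {X' Y' Z' : C} {f' : X' ⟶ Y'} {g' : Y' ⟶ Z'}
    (h' : IsSES f' g') : IsSES (biprod.map f f') (biprod.map g g') := by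
  have := h.mono
  have := h.epi
  have := h'.mono
  have := h'.epi
  refine of_lift ?_ fun x hx => ?_
  · apply biprod.hom_ext <;> apply biprod.hom_ext' <;> simp [h.w, h'.w]
  · obtain ⟨y, hy⟩ := h.exists_lift (x ≫ biprod.fst) (by simpa using hx =≫ biprod.fst)
    obtain ⟨y', hy'⟩ := h'.exists_lift (x ≫ biprod.snd) (by simpa using hx =≫ biprod.snd)
    refine ⟨biprod.lift y y', ?_⟩
    apply biprod.hom_ext
    · simp [hy]
    · simp [hy']

lemma biprod_right (h : IsSES f g) (W : C) : IsSES (f ≫ biprod.inl) (biprod.map g (𝟙 W)) := by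
  have := h.mono
  have := h.epi
  refine of_lift (by apply biprod.hom_ext <;> simp [h.w]) fun x hx => ?_
  obtain ⟨y, hy⟩ := h.exists_lift (x ≫ biprod.fst) (by simpa using hx =≫ biprod.fst)
  have h2 : x ≫ biprod.snd = 0 := by simpa using hx =≫ biprod.snd
  exact ⟨y, by apply biprod.hom_ext <;> simp [hy, h2]⟩

lemma of_isPushout (h : IsSES f g) {X' Y' : C} {a : X ⟶ X'} {f' : X' ⟶ Y'} {b : Y ⟶ Y'}
    (sq : IsPushout f a b f') : ∃ g' : Y' ⟶ Z, b ≫ g' = g ∧ IsSES f' g' := by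
  have := h.mono
  have hepi := h.epi
  have : Mono f' := (MorphismProperty.monomorphisms C).of_isPushout sq.flip ‹Mono f›
  have w : f ≫ g = a ≫ (0 : X' ⟶ Z) := by simp [h.w]
  have hb := sq.inl_desc g 0 w
  have : Epi (sq.desc g 0 w) := by
    rw [← hb] at hepi
    exact epi_of_epi b _
  refine ⟨sq.desc g 0 w, hb, of_desc (by simp) fun y hy => ?_⟩
  obtain ⟨z, hz⟩ := h.exists_desc (b ≫ y) (by rw [sq.w_assoc, hy, comp_zero])
  refine ⟨z, sq.hom_ext ?_ ?_⟩
  · rw [reassoc_of% hb, hz]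
  · simp [hy]

lemma of_isPullback (h : IsSES f g) {Y' Z' : C} {a : Z' ⟶ Z} {g' : Y' ⟶ Z'} {b : Y' ⟶ Y}
    (sq : IsPullback b g' g a) : ∃ f' : X ⟶ Y', f' ≫ b = f ∧ IsSES f' g' := by
  obtain ⟨f', hf, hs⟩ := h.op.of_isPushout sq.op.flip
  exact ⟨f'.unop, congrArg Quiver.Hom.unop hf, hs.unop⟩

lemma exists_pushout (h : IsSES f g) {X' : C} (a : X ⟶ X') :
    ∃ (Y' : C) (f' : X' ⟶ Y') (b : Y ⟶ Y') (g' : Y' ⟶ Z), IsPushout f a b f' ∧ b ≫ g' = g ∧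
      IsSES f' g' := by
  obtain ⟨g', h1, h2⟩ := h.of_isPushout (IsPushout.of_hasPushout f a)
  exact ⟨_, _, _, g', IsPushout.of_hasPushout f a, h1, h2⟩

lemma exists_pullback (h : IsSES f g) {Z' : C} (a : Z' ⟶ Z) :
    ∃ (Y' : C) (g' : Y' ⟶ Z') (b : Y' ⟶ Y) (f' : X ⟶ Y'), IsPullback b g' g a ∧ f' ≫ b = f ∧
      IsSES f' g' := by
  obtain ⟨f', h1, h2⟩ := h.of_isPullback (IsPullback.of_hasPullback g a)
  exact ⟨_, _, _, f', IsPullback.of_hasPullback g a, h1, h2⟩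

/-- The kernel of a composition of epimorphisms is an extension of the kernels. -/
lemma comp_epi {K K' : C} {k : K ⟶ X} {e : X ⟶ Y} {k' : K' ⟶ Y} {e' : Y ⟶ Z} (h : IsSES k e)
    (h' : IsSES k' e') : ∃ (N : C) (n : N ⟶ X) (c : K ⟶ N) (d : N ⟶ K'), IsSES n (e ≫ e') ∧
      IsSES c d ∧ c ≫ n = k ∧ n ≫ e = d ≫ k' := by
  obtain ⟨N, d, n, c, sq, h1, h2⟩ := h.exists_pullback k'
  have := h.epi
  have := h'.epi
  have := h'.mono
  have : Mono n := (MorphismProperty.monomorphisms C).of_isPullback sq.flip ‹Mono k'›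
  have : Epi (e ≫ e') := epi_comp _ _
  refine ⟨N, n, c, d, of_lift (by rw [sq.w_assoc, h'.w, comp_zero]) fun x hx => ?_, h2, h1, sq.w⟩
  obtain ⟨y, hy⟩ := h'.exists_lift (x ≫ e) (by simpa using hx)
  exact ⟨sq.lift x y hy.symm, sq.lift_fst _ _ _⟩

/-- The cokernel of a composition of monomorphisms is an extension of the cokernels. -/
lemma comp_mono {K K' : C} {m : X ⟶ Y} {q : Y ⟶ K} {m' : Y ⟶ Z} {q' : Z ⟶ K'} (h : IsSES m q)
    (h' : IsSES m' q') : ∃ (N : C) (n : Z ⟶ N) (c : K ⟶ N) (d : N ⟶ K'), IsSES (m ≫ m') n ∧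
      IsSES c d ∧ n ≫ d = q' ∧ q ≫ c = m' ≫ n := by
  obtain ⟨N, n, c, d, h1, h2, h3, h4⟩ := h'.op.comp_epi h.op
  exact ⟨N.unop, n.unop, d.unop, c.unop, h1.unop, h2.unop,
    congrArg Quiver.Hom.unop h3, (congrArg Quiver.Hom.unop h4).symm⟩

lemma nonempty_iso_of_section (h : IsSES f g) (s : Z ⟶ Y) (hs : s ≫ g = 𝟙 Z) :
    Nonempty (Y ≅ X ⊞ Z) :=
  have := h.mono
  ⟨(ShortComplex.Splitting.ofExactOfSection _ h.shortExact.exact s hs ‹_›).isoBinaryBiproduct⟩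

lemma nonempty_iso_of_retraction (h : IsSES f g) (r : Y ⟶ X) (hr : f ≫ r = 𝟙 X) :
    Nonempty (Y ≅ X ⊞ Z) :=
  have := h.epi
  ⟨(ShortComplex.Splitting.ofExactOfRetraction _ h.shortExact.exact r hr ‹_›).isoBinaryBiproduct⟩

lemma nonempty_iso_of_projective (h : IsSES f g) [Projective Z] : Nonempty (Y ≅ X ⊞ Z) :=
  have := h.epi
  h.nonempty_iso_of_section (Projective.factorThru (𝟙 Z) g) (by simp)

lemma map (h : IsSES f g) {D : Type*} [Category* D] [Abelian D] (F : C ⥤ D)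
    [F.PreservesZeroMorphisms] [PreservesFiniteLimits F] [PreservesFiniteColimits F] :
    IsSES (F.map f) (F.map g) :=
  ⟨_, h.shortExact.map_of_exact F⟩

end IsSES

lemma _root_.CategoryTheory.ShortComplex.ShortExact.isSES {X : ShortComplex C}
    (h : X.ShortExact) : IsSES X.f X.g := ⟨X.zero, h⟩

end ShortExact

/-! ## A coinductive description of Gorenstein projective and injective objects -/

section Coinduction

/-- Dependent choice in both directions along the integers. -/
lemma exists_int_chain {α : Type*} (R : α → α → Prop) (hl : ∀ a, ∃ b, R b a)
    (hr : ∀ a, ∃ b, R a b) (a : α) : ∃ z : ℤ → α, z 0 = a ∧ ∀ n, R (z (n + 1)) (z n) := by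
  choose l hl using hl
  choose r hr using hr
  refine ⟨fun n => match n with
    | Int.ofNat k => l^[k] a
    | Int.negSucc k => r^[k + 1] a, rfl, fun n => ?_⟩
  match n with
  | Int.ofNat k =>
    change R (l^[k + 1] a) (l^[k] a)
    rw [Function.iterate_succ_apply']
    exact hl _
  | Int.negSucc 0 => exact hr a
  | Int.negSucc (k + 1) =>
    change R (r^[k + 1] a) (r^[k + 1 + 1] a)
    rw [Function.iterate_succ_apply' r (k + 1)]
    exact hr _

variable {C : Type u} [Category.{v} C] [Abelian C]

section Splice

variable {K : ChainComplex C ℤ} {Z : ℤ → C} {i : ∀ n, Z n ⟶ K.X n} {p : ∀ n, K.X (n + 1) ⟶ Z n}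

/-- The complex spliced from short exact sequences `Z (n + 1) ⟶ X (n + 1) ⟶ Z n`. -/
def splice {X : ℤ → C} {i : ∀ n, Z n ⟶ X n} {p : ∀ n, X (n + 1) ⟶ Z n}
    (h : ∀ n, IsSES (i (n + 1)) (p n)) : ChainComplex C ℤ :=
  ChainComplex.of X (fun n => p n ≫ i n) fun n => by
    rw [Category.assoc, ← Category.assoc (i (n + 1)), (h n).w, zero_comp, comp_zero]

lemma mono_of_splicing (h : ∀ n, IsSES (i (n + 1)) (p n)) (n : ℤ) : Mono (i n) := by
  obtain ⟨k, rfl⟩ : ∃ k, n = k + 1 := ⟨n - 1, by simp⟩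
  exact (h k).mono

lemma exists_lift_of_splicing (h : ∀ n, IsSES (i (n + 1)) (p n))
    (hd : ∀ n, K.d (n + 1) n = p n ≫ i n) (n : ℤ) {A : C} (x : A ⟶ K.X (n + 1))
    (hx : x ≫ K.d (n + 1) n = 0) :
    ∃ y : A ⟶ Z (n + 1), y ≫ i (n + 1) = x := by
  have := mono_of_splicing h n
  rw [hd, ← Category.assoc] at hx
  exact (h n).exists_lift x (zero_of_comp_mono (i n) hx)

lemma acyclic_of_splicing (h : ∀ n, IsSES (i (n + 1)) (p n))
    (hd : ∀ n, K.d (n + 1) n = p n ≫ i n) : K.Acyclic := by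
  intro n
  obtain ⟨k, rfl⟩ : ∃ k, n = k + 1 := ⟨n - 1, by simp⟩
  rw [K.exactAt_iff' (k + 1 + 1) (k + 1) k (by simp) (by simp),
    ShortComplex.exact_iff_exact_up_to_refinements]
  intro A x hx
  obtain ⟨y, hy⟩ := exists_lift_of_splicing h hd k x hx
  have := (h (k + 1)).epi
  obtain ⟨A', π, hπ, z, hz⟩ := surjective_up_to_refinements_of_epi (p (k + 1)) y
  have hz' : π ≫ y ≫ i (k + 1) = z ≫ K.d (k + 1 + 1) (k + 1) := by rw [hd, reassoc_of% hz]
  rw [hy] at hz'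
  exact ⟨A', π, hπ, z, hz'⟩

lemma cycles_of_splicing (h : ∀ n, IsSES (i (n + 1)) (p n))
    (hd : ∀ n, K.d (n + 1) n = p n ≫ i n) (n : ℤ) : Nonempty (Z n ≅ K.cycles n) := by
  obtain ⟨k, rfl⟩ : ∃ k, n = k + 1 := ⟨n - 1, by simp⟩
  have w : i (k + 1) ≫ K.d (k + 1) k = 0 := by
    rw [hd, ← Category.assoc, (h k).w, zero_comp]
  have := (h k).mono
  obtain ⟨y, hy⟩ := exists_lift_of_splicing h hd k (K.iCycles (k + 1)) (by simp)
  refine ⟨K.liftCycles (i (k + 1)) k (by simp) w, y, ?_, ?_⟩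
  · rw [← cancel_mono (i (k + 1)), Category.assoc, hy]
    simp
  · rw [← cancel_mono (K.iCycles (k + 1)), Category.assoc, HomologicalComplex.liftCycles_i, hy]
    simp

end Splice

lemma epi_toCycles {K : ChainComplex C ℤ} (hK : K.Acyclic) (j : ℤ) :
    Epi (K.toCycles (j + 1) j) := by
  have := (cycles_shortExact K hK (j + 1)).epi_g
  change Epi (K.toCycles (j + 1) (j + 1 - 1)) at this
  rwa [show j + 1 - 1 = j by simp] at this

lemma cycles_isSES (K : ChainComplex C ℤ) (hK : K.Acyclic) (j : ℤ) :
    IsSES (K.iCycles (j + 1)) (K.toCycles (j + 1) j) := by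
  have := (cycles_shortExact K hK (j + 1)).isSES
  dsimp only at this
  convert this <;> simp

/-- `0 ⟶ G ⟶ P ⟶ G' ⟶ 0` is exact with `P` projective, and morphisms from `G` to
projective objects extend to `P`. -/
structure IsProjStep {G P G' : C} (i : G ⟶ P) (p : P ⟶ G') : Prop where
  ses : IsSES i p
  projective : Projective P
  exists_ext : ∀ Q : C, Projective Q → ∀ f : G ⟶ Q, ∃ g : P ⟶ Q, i ≫ g = f

/-- `0 ⟶ G ⟶ I ⟶ G' ⟶ 0` is exact with `I` injective, and morphisms from
injective objects to `G'` lift to `I`. -/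
structure IsInjStep {G I G' : C} (i : G ⟶ I) (p : I ⟶ G') : Prop where
  ses : IsSES i p
  injective : Injective I
  exists_lift : ∀ J : C, Injective J → ∀ f : J ⟶ G', ∃ g : J ⟶ I, g ≫ p = f

lemma IsProjStep.of_iso {G P G' : C} {i : G ⟶ P} {p : P ⟶ G'} (h : IsProjStep i p) {H H' : C}
    (e : H ≅ G) (e' : G' ≅ H') : IsProjStep (e.hom ≫ i) (p ≫ e'.hom) where
  ses := (h.ses.iso_left e).iso_right e'
  projective := h.projective
  exists_ext Q hQ f := by
    obtain ⟨g, hg⟩ := h.exists_ext Q hQ (e.inv ≫ f)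
    exact ⟨g, by simp [hg]⟩

lemma IsInjStep.of_iso {G P G' : C} {i : G ⟶ P} {p : P ⟶ G'} (h : IsInjStep i p) {H H' : C}
    (e : H ≅ G) (e' : G' ≅ H') : IsInjStep (e.hom ≫ i) (p ≫ e'.hom) where
  ses := (h.ses.iso_left e).iso_right e'
  injective := h.injective
  exists_lift Q hQ f := by
    obtain ⟨g, hg⟩ := h.exists_lift Q hQ (f ≫ e'.inv)
    exact ⟨g, by simp [reassoc_of% hg]⟩

/-- There is a projective step from `G` to `G'`. -/
def ProjStep (G G' : C) : Prop := ∃ (P : C) (i : G ⟶ P) (p : P ⟶ G'), IsProjStep i p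

/-- There is an injective step from `G` to `G'`. -/
def InjStep (G G' : C) : Prop := ∃ (P : C) (i : G ⟶ P) (p : P ⟶ G'), IsInjStep i p

/-- Choosing steps in both directions and splicing them yields a totally acyclic complex. Later
proofs only exhibit a class stable under steps and never handle a complex. -/
theorem GProj.of_coinduction (E : C → Prop) (hl : ∀ G, E G → ∃ G', E G' ∧ ProjStep G' G)
    (hr : ∀ G, E G → ∃ G', E G' ∧ ProjStep G G') {G : C} (hG : E G) : GProj C G := by
  obtain ⟨z, hz0, hz⟩ := exists_int_chain (α := {G // E G}) (fun a b => ProjStep a.1 b.1)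
    (fun a => let ⟨b, hb, hb'⟩ := hl a.1 a.2; ⟨⟨b, hb⟩, hb'⟩)
    (fun a => let ⟨b, hb, hb'⟩ := hr a.1 a.2; ⟨⟨b, hb⟩, hb'⟩) ⟨G, hG⟩
  obtain ⟨X, i, p, h⟩ : ∃ (X : ℤ → C) (i : ∀ n, (z n).1 ⟶ X n) (p : ∀ n, X (n + 1) ⟶ (z n).1),
      ∀ n, IsProjStep (i (n + 1)) (p n) := by
    choose P i p h using hz
    have aux : ∀ n : ℤ, n - 1 + 1 = n := by simp
    -- The object `P n` lies between `z (n + 1)` and `z n`, hence belongs in degree `n + 1`; this is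
    -- the source of the shift and of the transports. Freeing the index in `key` removes the
    -- transports.
    refine ⟨fun n => P (n - 1), fun n => eqToHom (by rw [aux]) ≫ i (n - 1),
      fun n => eqToHom (by simp) ≫ p n, fun n => ?_⟩
    have key : ∀ m (hm : m = n), IsProjStep (eqToHom (by rw [hm]) ≫ i m :
        (z (n + 1)).1 ⟶ P m) (eqToHom (by rw [hm]) ≫ p n : P m ⟶ (z n).1) := by
      rintro m rfl
      simpa using h m
    exact key _ (by simp)
  obtain ⟨K, i, p, h, hd⟩ : ∃ (K : ChainComplex C ℤ) (i : ∀ n, (z n).1 ⟶ K.X n)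
      (p : ∀ n, K.X (n + 1) ⟶ (z n).1), (∀ n, IsProjStep (i (n + 1)) (p n)) ∧
        ∀ n, K.d (n + 1) n = p n ≫ i n :=
    ⟨splice fun n => (h n).ses, i, p, h, fun n => ChainComplex.of_d _ (fun n => p n ≫ i n) ..⟩
  have hs := fun n => (h n).ses
  refine ⟨K, ⟨fun n => ?_, acyclic_of_splicing hs hd, ?_⟩, 0, ?_⟩
  · obtain ⟨k, rfl⟩ : ∃ k, n = k + 1 := ⟨n - 1, by simp⟩
    exact (h k).projective
  · intro Q hQ n f hf
    obtain ⟨k, rfl⟩ : ∃ k, n = k + 1 := ⟨n - 1, by simp⟩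
    rw [hd, Category.assoc] at hf
    have := (h (k + 1)).ses.epi
    obtain ⟨g, hg⟩ := (h k).ses.exists_desc f (zero_of_epi_comp _ hf)
    -- The map `f` has been factored through the cycle object `z k`; the next step of the chain
    -- extends the factor `g` to the following term.
    obtain ⟨m, rfl⟩ : ∃ m, k = m + 1 := ⟨k - 1, by simp⟩
    obtain ⟨g', hg'⟩ := (h m).exists_ext Q hQ g
    have : ∀ l (hl : l = m + 1), ∃ g : K.X l ⟶ Q, K.d (m + 1 + 1) l ≫ g = f := by
      rintro l rfl
      exact ⟨g', by rw [hd, Category.assoc, hg', hg]⟩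
    exact this _ (by simp)
  · have := cycles_of_splicing hs hd 0
    rwa [hz0] at this

theorem GInj.of_coinduction (E : C → Prop) (hl : ∀ G, E G → ∃ G', E G' ∧ InjStep G' G)
    (hr : ∀ G, E G → ∃ G', E G' ∧ InjStep G G') {G : C} (hG : E G) : GInj C G := by
  obtain ⟨z, hz0, hz⟩ := exists_int_chain (α := {G // E G}) (fun a b => InjStep a.1 b.1)
    (fun a => let ⟨b, hb, hb'⟩ := hl a.1 a.2; ⟨⟨b, hb⟩, hb'⟩)
    (fun a => let ⟨b, hb, hb'⟩ := hr a.1 a.2; ⟨⟨b, hb⟩, hb'⟩) ⟨G, hG⟩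
  obtain ⟨X, i, p, h⟩ : ∃ (X : ℤ → C) (i : ∀ n, (z n).1 ⟶ X n) (p : ∀ n, X (n + 1) ⟶ (z n).1),
      ∀ n, IsInjStep (i (n + 1)) (p n) := by
    choose P i p h using hz
    have aux : ∀ n : ℤ, n - 1 + 1 = n := by simp
    refine ⟨fun n => P (n - 1), fun n => eqToHom (by rw [aux]) ≫ i (n - 1),
      fun n => eqToHom (by simp) ≫ p n, fun n => ?_⟩
    have key : ∀ m (hm : m = n), IsInjStep (eqToHom (by rw [hm]) ≫ i m :
        (z (n + 1)).1 ⟶ P m) (eqToHom (by rw [hm]) ≫ p n : P m ⟶ (z n).1) := by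
      rintro m rfl
      simpa using h m
    exact key _ (by simp)
  obtain ⟨K, i, p, h, hd⟩ : ∃ (K : ChainComplex C ℤ) (i : ∀ n, (z n).1 ⟶ K.X n)
      (p : ∀ n, K.X (n + 1) ⟶ (z n).1), (∀ n, IsInjStep (i (n + 1)) (p n)) ∧
        ∀ n, K.d (n + 1) n = p n ≫ i n :=
    ⟨splice fun n => (h n).ses, i, p, h, fun n => ChainComplex.of_d _ (fun n => p n ≫ i n) ..⟩
  have hs := fun n => (h n).ses
  refine ⟨K, ⟨fun n => ?_, acyclic_of_splicing hs hd, ?_⟩, 0, ?_⟩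
  · obtain ⟨k, rfl⟩ : ∃ k, n = k + 1 := ⟨n - 1, by simp⟩
    exact (h k).injective
  · intro J hJ n f hf
    obtain ⟨k, rfl⟩ : ∃ k, n = k + 1 := ⟨n - 1, by simp⟩
    rw [show k + 1 - 1 = k by simp] at hf
    obtain ⟨g, hg⟩ := exists_lift_of_splicing hs hd k f hf
    obtain ⟨g', hg'⟩ := (h (k + 1)).exists_lift J hJ g
    exact ⟨g', by rw [hd, ← Category.assoc, hg', hg]⟩
  · have := cycles_of_splicing hs hd 0
    rwa [hz0] at this

lemma IsTotallyAcyclicProj.isProjStep {P : ChainComplex C ℤ} (hP : IsTotallyAcyclicProj P)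
    (j : ℤ) : IsProjStep (P.iCycles (j + 1)) (P.toCycles (j + 1) j) where
  ses := cycles_isSES P hP.acyclic j
  projective := hP.projective _
  exists_ext Q hQ f := by
    have := epi_toCycles hP.acyclic (j + 1)
    have h := hP.hom_exact Q hQ (j + 1 + 1) (P.toCycles (j + 1 + 1) (j + 1) ≫ f) (by simp)
    rw [show j + 1 + 1 - 1 = j + 1 by simp] at h
    obtain ⟨g, hg⟩ := h
    exact ⟨g, by rw [← cancel_epi (P.toCycles (j + 1 + 1) (j + 1)), ← hg]; simp⟩

lemma IsTotallyAcyclicInj.isInjStep {I : ChainComplex C ℤ} (hI : IsTotallyAcyclicInj I)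
    (j : ℤ) : IsInjStep (I.iCycles (j + 1)) (I.toCycles (j + 1) j) where
  ses := cycles_isSES I hI.acyclic j
  injective := hI.injective _
  exists_lift J hJ f := by
    obtain ⟨g, hg⟩ := hI.hom_exact J hJ j (f ≫ I.iCycles j) (by simp)
    exact ⟨g, by rw [← cancel_mono (I.iCycles j), ← hg]; simp⟩

lemma GProj.exists_left {G : C} (hG : GProj C G) : ∃ G', GProj C G' ∧ ProjStep G' G := by
  obtain ⟨P, hP, j, ⟨e⟩⟩ := hG
  exact ⟨_, ⟨P, hP, j + 1, ⟨Iso.refl _⟩⟩, _, _, _, (hP.isProjStep j).of_iso (Iso.refl _) e.symm⟩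

lemma GProj.exists_right {G : C} (hG : GProj C G) : ∃ G', GProj C G' ∧ ProjStep G G' := by
  obtain ⟨P, hP, j, ⟨e⟩⟩ := hG
  obtain ⟨j, rfl⟩ : ∃ k, j = k + 1 := ⟨j - 1, by simp⟩
  exact ⟨_, ⟨P, hP, j, ⟨Iso.refl _⟩⟩, _, _, _, (hP.isProjStep j).of_iso e (Iso.refl _)⟩

lemma GInj.exists_left {G : C} (hG : GInj C G) : ∃ G', GInj C G' ∧ InjStep G' G := by
  obtain ⟨P, hP, j, ⟨e⟩⟩ := hG
  exact ⟨_, ⟨P, hP, j + 1, ⟨Iso.refl _⟩⟩, _, _, _, (hP.isInjStep j).of_iso (Iso.refl _) e.symm⟩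

lemma GInj.exists_right {G : C} (hG : GInj C G) : ∃ G', GInj C G' ∧ InjStep G G' := by
  obtain ⟨P, hP, j, ⟨e⟩⟩ := hG
  obtain ⟨j, rfl⟩ : ∃ k, j = k + 1 := ⟨j - 1, by simp⟩
  exact ⟨_, ⟨P, hP, j, ⟨Iso.refl _⟩⟩, _, _, _, (hP.isInjStep j).of_iso e (Iso.refl _)⟩

lemma GProj.of_iso {G H : C} (hG : GProj C G) (e : G ≅ H) : GProj C H := by
  obtain ⟨P, hP, j, ⟨e'⟩⟩ := hG
  exact ⟨P, hP, j, ⟨e.symm ≪≫ e'⟩⟩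

lemma gproj_of_projective (P : C) [Projective P] : GProj C P := (isProInjective_GProj P).prop

/-- The class of Gorenstein projectives enlarged by `G` is stable under steps, so a single step on
each side suffices. -/
lemma GProj.of_steps {G N N' : C} (hN : GProj C N) (hN' : GProj C N') (h : ProjStep N G)
    (h' : ProjStep G N') : GProj C G := by
  refine GProj.of_coinduction (fun H => GProj C H ∨ H = G) ?_ ?_ (Or.inr rfl)
  · rintro H (hH | rfl)
    · obtain ⟨G', h1, h2⟩ := hH.exists_left
      exact ⟨G', Or.inl h1, h2⟩
    · exact ⟨N, Or.inl hN, h⟩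
  · rintro H (hH | rfl)
    · obtain ⟨G', h1, h2⟩ := hH.exists_right
      exact ⟨G', Or.inl h1, h2⟩
    · exact ⟨N', Or.inl hN', h'⟩

/-! ### Duality -/

lemma IsInjStep.op {G I G' : C} {i : G ⟶ I} {p : I ⟶ G'} (h : IsInjStep i p) :
    IsProjStep p.op i.op where
  ses := h.ses.op
  projective := have := h.injective; inferInstance
  exists_ext Q hQ f := by
    obtain ⟨g, hg⟩ := h.exists_lift Q.unop inferInstance f.unop
    exact ⟨g.op, by rw [← op_comp, hg]; rfl⟩

lemma IsProjStep.unop {G I G' : Cᵒᵖ} {i : G ⟶ I} {p : I ⟶ G'} (h : IsProjStep i p) :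
    IsInjStep p.unop i.unop where
  ses := h.ses.unop
  injective := have := h.projective; inferInstance
  exists_lift J hJ f := by
    obtain ⟨g, hg⟩ := h.exists_ext (Opposite.op J) inferInstance f.op
    exact ⟨g.unop, by rw [← unop_comp, hg]; rfl⟩

lemma InjStep.op {G G' : C} (h : InjStep G G') : ProjStep (Opposite.op G') (Opposite.op G) :=
  let ⟨_, _, _, h⟩ := h
  ⟨_, _, _, h.op⟩

lemma ProjStep.unop {G G' : Cᵒᵖ} (h : ProjStep G G') : InjStep G'.unop G.unop :=
  let ⟨_, _, _, h⟩ := h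
  ⟨_, _, _, h.unop⟩

/-- Steps dualise one at a time, so coinduction transfers the notion to the opposite category
without reindexing complexes. -/
lemma GInj.op {G : C} (h : GInj C G) : GProj Cᵒᵖ (Opposite.op G) := by
  refine GProj.of_coinduction (fun G => GInj C G.unop) (fun G hG => ?_) (fun G hG => ?_) h
  · obtain ⟨G', h1, h2⟩ := hG.exists_right
    exact ⟨.op G', h1, h2.op⟩
  · obtain ⟨G', h1, h2⟩ := hG.exists_left
    exact ⟨.op G', h1, h2.op⟩

lemma GProj.unop {G : Cᵒᵖ} (h : GProj Cᵒᵖ G) : GInj C G.unop := by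
  refine GInj.of_coinduction (fun G => GProj Cᵒᵖ (.op G)) (fun G hG => ?_) (fun G hG => ?_) h
  · obtain ⟨G', h1, h2⟩ := hG.exists_right
    exact ⟨G'.unop, h1, h2.unop⟩
  · obtain ⟨G', h1, h2⟩ := hG.exists_left
    exact ⟨G'.unop, h1, h2.unop⟩

end Coinduction

/-! ## Closure properties of Gorenstein projective objects -/

section Closure

variable {C : Type u} [Category.{v} C] [Abelian C]

/-- Extensions of `G` by projective objects split; stated in the form of an extension property. -/
def Orth (G : C) : Prop :=
  ∀ ⦃K E : C⦄ (i : K ⟶ E) (p : E ⟶ G), IsSES i p → ∀ Q : C, Projective Q →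
    ∀ f : K ⟶ Q, ∃ g : E ⟶ Q, i ≫ g = f

/-- By projectivity of `P`, every extension of `G'` by `K` is the pushout of the step along some `a
: G ⟶ K`. To extend `f` it is thus enough to extend `a ≫ f` from `G` to `P`. -/
lemma IsProjStep.orth {G P G' : C} {i : G ⟶ P} {p : P ⟶ G'} (h : IsProjStep i p) : Orth G' := by
  intro K E j q hj Q hQ f
  have := h.projective
  have := hj.epi
  have hb := Projective.factorThru_comp p q
  obtain ⟨a, ha⟩ := hj.exists_lift (i ≫ Projective.factorThru p q) (by
    rw [Category.assoc, hb, h.ses.w])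
  obtain ⟨t, ht⟩ := h.exists_ext Q hQ (a ≫ f)
  exact exists_desc_of_map hj.shortExact h.ses.shortExact a _ (Iso.refl _) ha (by simp [hb]) f t
    ht.symm

lemma Orth.isProjStep {G P G' : C} {i : G ⟶ P} {p : P ⟶ G'} (hG : Orth G') (h : IsSES i p)
    [Projective P] : IsProjStep i p := ⟨h, inferInstance, hG i p h⟩

/-- Extend in two stages: over the preimage `N` of `K` in the given extension of `E`, then over the
whole, where the quotient is `M`. -/
lemma Orth.extension {K E M : C} {i : K ⟶ E} {p : E ⟶ M} (h : IsSES i p) (hK : Orth K)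
    (hM : Orth M) : Orth E := by
  intro K₀ W a q ha Q hQ f
  obtain ⟨N, n, c, d, h1, h2, h3, -⟩ := ha.comp_epi h
  obtain ⟨g₁, hg₁⟩ := hK c d h2 Q hQ f
  obtain ⟨g₂, hg₂⟩ := hM n _ h1 Q hQ g₁
  exact ⟨g₂, by rw [← h3, Category.assoc, hg₂, hg₁]⟩

lemma Orth.of_biprod {L P : C} (h : Orth (L ⊞ P)) : Orth L := by
  intro K E i p hi Q hQ f
  obtain ⟨g, hg⟩ := h _ _ (hi.biprod_right P) Q hQ f
  exact ⟨biprod.inl ≫ g, by simpa using hg⟩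

lemma GProj.orth {G : C} (hG : GProj C G) : Orth G :=
  let ⟨_, _, _, _, _, h⟩ := hG.exists_left
  h.orth

/-- Sequences `P ⟶ E ⟶ L` with `P` projective split if `L` is orthogonal to projective objects. -/
lemma Orth.nonempty_iso {P E L : C} {i : P ⟶ E} {p : E ⟶ L} (hL : Orth L) (h : IsSES i p)
    [Projective P] : Nonempty (E ≅ P ⊞ L) := by
  obtain ⟨r, hr⟩ := hL i p h P inferInstance (𝟙 P)
  exact h.nonempty_iso_of_retraction r hr

/-- A horseshoe construction in both directions, which keeps within the class of extensions of
Gorenstein projectives. -/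
theorem GProj.extension {K E M : C} {i : K ⟶ E} {p : E ⟶ M} (h : IsSES i p) (hK : GProj C K)
    (hM : GProj C M) : GProj C E := by
  refine GProj.of_coinduction (fun E => ∃ (K M : C) (i : K ⟶ E) (p : E ⟶ M), IsSES i p ∧
    GProj C K ∧ GProj C M) ?_ ?_ ⟨K, M, i, p, h, hK, hM⟩
  · rintro E ⟨K, M, i, p, h, hK, hM⟩
    obtain ⟨K', hK', P₁, k, e, h₁⟩ := hK.exists_left
    obtain ⟨M', hM', P₂, k', e', h₂⟩ := hM.exists_left
    have := h₁.projective
    have := h₂.projective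
    -- The pullback splits as `K ⊞ P₂` and covers `E` with kernel `M'`; covering it by `P₁ ⊞ P₂`
    -- gives a kernel that is an extension of `M'` by `K'`.
    obtain ⟨W, g', b, f', sq, -, hW⟩ := h.exists_pullback e'
    obtain ⟨f'', -, hW'⟩ := h₂.ses.of_isPullback sq.flip
    obtain ⟨φ⟩ := hW.nonempty_iso_of_projective
    obtain ⟨N, n, c, d, h3, h4, -⟩ := ((h₁.ses.biprod_right P₂).iso_right φ.symm).comp_epi hW'
    exact ⟨N, ⟨_, _, c, d, h4, hK', hM'⟩, _, n, _,
      (Orth.extension h hK.orth hM.orth).isProjStep h3⟩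
  · rintro E ⟨K, M, i, p, h, hK, hM⟩
    obtain ⟨K', hK', P₁, k, e, h₁⟩ := hK.exists_right
    obtain ⟨M', hM', P₂, k', e', h₂⟩ := hM.exists_right
    have := h₁.projective
    have := h₂.projective
    -- The pushout is an extension of `M` by the projective `P₁`, which splits because `M` is
    -- orthogonal to projectives. It then embeds in `P₁ ⊞ P₂`.
    obtain ⟨W, f', b, g', sq, -, hW⟩ := h.exists_pushout k
    obtain ⟨f'', -, hW'⟩ := h₁.ses.of_isPushout sq.flip
    obtain ⟨φ⟩ := hM.orth.nonempty_iso hW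
    have hs := (IsSES.id_zero P₁).biprod_map h₂.ses
    have hs' : IsSES (biprod.map (𝟙 P₁) k') (biprod.snd ≫ e') := by
      have := h₂.ses.epi
      have := h₂.ses.mono
      refine IsSES.of_lift (by simp [h₂.ses.w]) fun x hx => ?_
      obtain ⟨y, hy⟩ := h₂.ses.exists_lift (x ≫ biprod.snd) (by simpa using hx)
      exact ⟨biprod.lift (x ≫ biprod.fst) y, by apply biprod.hom_ext <;> simp [hy]⟩
    obtain ⟨N, n, c, d, h3, h4, -⟩ := hW'.comp_mono (hs'.iso_left φ)
    exact ⟨N, ⟨_, _, c, d, h4, hK', hM'⟩, _, _, n,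
      (Orth.extension h4 hK'.orth hM'.orth).isProjStep h3⟩

lemma GProj.biprod {G H : C} (hG : GProj C G) (hH : GProj C H) : GProj C (G ⊞ H) :=
  GProj.extension (IsSES.inl_snd G H) hG hH

/-- Compose the left step with the projection to `L` and the right step with the inclusion of `L`.
The new kernel and cokernel are extensions of `P` by `N` and of `N'` by `P`, so they are Gorenstein
projective. -/
theorem GProj.of_biprod {L P : C} [Projective P] (h : GProj C (L ⊞ P)) : GProj C L := by
  have hP := gproj_of_projective P
  obtain ⟨N, hN, P₁, k, e, h₁⟩ := h.exists_left
  obtain ⟨N', hN', P₂, k', e', h₂⟩ := h.exists_right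
  have := h₁.projective
  have := h₂.projective
  obtain ⟨A, n, c, d, h3, h4, -⟩ := h₁.ses.comp_epi (IsSES.inr_fst P L)
  obtain ⟨A', n', c', d', h3', h4', -⟩ := (IsSES.inl_snd L P).comp_mono h₂.ses
  have hA := GProj.extension h4 hN hP
  have hA' := GProj.extension h4' hP hN'
  exact GProj.of_steps hA hA' ⟨_, _, _, h.orth.of_biprod.isProjStep h3⟩
    ⟨_, _, _, hA'.orth.isProjStep h3'⟩

/-- The cokernel of a monomorphism between Gorenstein projectives is Gorenstein projective if it is
orthogonal to projective objects. -/
theorem GProj.of_cokernel {G G' L : C} {i : G ⟶ G'} {p : G' ⟶ L} (h : IsSES i p) (hG : GProj C G)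
    (hG' : GProj C G') (hL : Orth L) : GProj C L := by
  obtain ⟨N, hN, P, k, e, hk⟩ := hG.exists_right
  have := hk.projective
  -- The pushout is an extension of `N` by `G'`, hence Gorenstein projective, and it is also `P ⊞ L`
  -- by orthogonality of `L`.
  obtain ⟨E, f', b, g', sq, -, hE⟩ := h.exists_pushout k
  obtain ⟨f'', -, hE'⟩ := hk.ses.of_isPushout sq.flip
  obtain ⟨φ⟩ := hL.nonempty_iso hE
  exact GProj.of_biprod ((GProj.extension hE' hG' hN).of_iso (φ ≪≫ biprod.braiding _ _))

/-- Pulling back along a projective cover step `P ⟶ G` gives an object that is both `K ⊞ P` and an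
extension of `E` by `N`. -/
theorem GProj.of_kernel {K E G : C} {i : K ⟶ E} {p : E ⟶ G} (h : IsSES i p) (hE : GProj C E)
    (hG : GProj C G) : GProj C K := by
  obtain ⟨N, hN, P, k, e, hk⟩ := hG.exists_left
  have := hk.projective
  obtain ⟨W, g', b, f', sq, -, hW⟩ := h.exists_pullback e
  obtain ⟨f'', -, hW'⟩ := hk.ses.of_isPullback sq.flip
  obtain ⟨φ⟩ := hW.nonempty_iso_of_projective
  exact GProj.of_biprod ((GProj.extension hW' hN hE).of_iso φ)

/-! ### Dimensions -/

/-- `PdLE n M`: there is an exact sequence `0 ⟶ Pₙ ⟶ ⋯ ⟶ P₀ ⟶ M ⟶ 0` with projective terms. -/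
def PdLE : ℕ → C → Prop
  | 0, M => Projective M
  | n + 1, M => ∃ (K P : C) (i : K ⟶ P) (p : P ⟶ M), IsSES i p ∧ Projective P ∧ PdLE n K

/-- `IdLE n M`: there is an exact sequence `0 ⟶ M ⟶ I₀ ⟶ ⋯ ⟶ Iₙ ⟶ 0` with injective terms. -/
def IdLE : ℕ → C → Prop
  | 0, M => Injective M
  | n + 1, M => ∃ (I L : C) (i : M ⟶ I) (p : I ⟶ L), IsSES i p ∧ Injective I ∧ IdLE n L

lemma PdLE.hasProjectiveDimensionLT {n : ℕ} {M : C} (h : PdLE n M) :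
    HasProjectiveDimensionLT M (n + 1) := by
  induction n generalizing M with
  | zero =>
    have : Projective M := h
    infer_instance
  | succ n ih =>
    obtain ⟨K, P, i, p, hs, hP, hK⟩ := h
    exact (hs.shortExact.hasProjectiveDimensionLT_X₃_iff n hP).2 (ih hK)

lemma IdLE.hasInjectiveDimensionLT {n : ℕ} {M : C} (h : IdLE n M) :
    HasInjectiveDimensionLT M (n + 1) := by
  induction n generalizing M with
  | zero =>
    have : Injective M := h
    infer_instance
  | succ n ih =>
    obtain ⟨K, P, i, p, hs, hP, hK⟩ := h
    exact (hs.shortExact.hasInjectiveDimensionLT_X₃_iff n hP).1 (ih hK)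

lemma pdLE_of_hasProjectiveDimensionLT [EnoughProjectives C] {n : ℕ} {M : C}
    (h : HasProjectiveDimensionLT M (n + 1)) : PdLE n M := by
  induction n generalizing M with
  | zero => exact projective_iff_hasProjectiveDimensionLT_one.2 h
  | succ n ih =>
    have hs := IsSES.of_epi (Projective.π M)
    exact ⟨_, _, _, _, hs, inferInstance,
      ih ((hs.shortExact.hasProjectiveDimensionLT_X₃_iff n inferInstance).1 h)⟩

lemma idLE_of_hasInjectiveDimensionLT [EnoughInjectives C] {n : ℕ} {M : C}
    (h : HasInjectiveDimensionLT M (n + 1)) : IdLE n M := by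
  induction n generalizing M with
  | zero => exact injective_iff_hasInjectiveDimensionLT_one.2 h
  | succ n ih =>
    have hs := IsSES.of_mono (Injective.ι M)
    exact ⟨_, _, _, _, hs, inferInstance,
      ih ((hs.shortExact.hasInjectiveDimensionLT_X₃_iff n inferInstance).2 h)⟩

lemma projectiveDimension_le_iff_pdLE [EnoughProjectives C] {n : ℕ} {M : C} :
    projectiveDimension M ≤ n ↔ PdLE n M := by
  rw [projectiveDimension_le_iff]
  exact ⟨pdLE_of_hasProjectiveDimensionLT, PdLE.hasProjectiveDimensionLT⟩

lemma injectiveDimension_le_iff_idLE [EnoughInjectives C] {n : ℕ} {M : C} :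
    injectiveDimension M ≤ n ↔ IdLE n M := by
  rw [injectiveDimension_le_iff]
  exact ⟨idLE_of_hasInjectiveDimensionLT, IdLE.hasInjectiveDimensionLT⟩

lemma withBot_enat_lt_top {a : WithBot ℕ∞} : a < ⊤ ↔ ∃ n : ℕ, a ≤ n := by
  induction a with
  | bot => simp
  | coe a =>
    induction a with
    | top =>
      refine ⟨fun h => (lt_irrefl _ h).elim, fun ⟨n, hn⟩ => ?_⟩
      exact ((WithBot.coe_le_coe.1 hn).not_gt (ENat.natCast_lt_top n)).elim
    | coe a => exact ⟨fun _ => ⟨a, le_rfl⟩, fun _ => WithBot.coe_lt_coe.2 (ENat.natCast_lt_top a)⟩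

lemma finPd_iff_pdLE [EnoughProjectives C] {M : C} : FinPd C M ↔ ∃ n, PdLE n M := by
  simp only [FinPd, withBot_enat_lt_top, projectiveDimension_le_iff_pdLE]

lemma finId_iff_idLE [EnoughInjectives C] {M : C} : FinId C M ↔ ∃ n, IdLE n M := by
  simp only [FinId, withBot_enat_lt_top, injectiveDimension_le_iff_idLE]

lemma finPd_iff {M : C} : FinPd C M ↔ ∃ n, HasProjectiveDimensionLT M n := by
  simp only [FinPd, withBot_enat_lt_top, projectiveDimension_le_iff]
  exact ⟨fun ⟨n, h⟩ => ⟨n + 1, h⟩,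
    fun ⟨n, h⟩ => ⟨n, hasProjectiveDimensionLT_of_ge _ n _ n.le_succ⟩⟩

lemma finId_iff {M : C} : FinId C M ↔ ∃ n, HasInjectiveDimensionLT M n := by
  simp only [FinId, withBot_enat_lt_top, injectiveDimension_le_iff]
  exact ⟨fun ⟨n, h⟩ => ⟨n + 1, h⟩,
    fun ⟨n, h⟩ => ⟨n, hasInjectiveDimensionLT_of_ge _ n _ n.le_succ⟩⟩

lemma exists_pdLE_of_finitistic [EnoughProjectives C]
    (h : finitisticProjectiveDimension C < ⊤) : ∃ m, ∀ M : C, FinPd C M → PdLE m M := by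
  obtain ⟨m, hm⟩ := withBot_enat_lt_top.1 h
  exact ⟨m, fun M hM => projectiveDimension_le_iff_pdLE.1 ((le_iSup
    (fun M : {M : C // FinPd C M} => projectiveDimension M.1) ⟨M, hM⟩).trans hm)⟩

lemma exists_idLE_of_finitistic [EnoughInjectives C]
    (h : finitisticInjectiveDimension C < ⊤) : ∃ m, ∀ M : C, FinId C M → IdLE m M := by
  obtain ⟨m, hm⟩ := withBot_enat_lt_top.1 h
  exact ⟨m, fun M hM => injectiveDimension_le_iff_idLE.1 ((le_iSup
    (fun M : {M : C // FinId C M} => injectiveDimension M.1) ⟨M, hM⟩).trans hm)⟩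

lemma gpdLE_succ_iff {n : ℕ} {M : C} : GpdLE (n + 1) M ↔
    ∃ (K G : C) (i : K ⟶ G) (p : G ⟶ M), IsSES i p ∧ GProj C G ∧ GpdLE n K := by
  constructor
  · rintro ⟨X, hX, rfl, hG, hK⟩
    exact ⟨_, _, _, _, hX.isSES, hG, hK⟩
  · rintro ⟨K, G, i, p, h, hG, hK⟩
    exact ⟨_, h.shortExact, rfl, hG, hK⟩

lemma gidLE_succ_iff {n : ℕ} {M : C} : GidLE (n + 1) M ↔
    ∃ (H L : C) (i : M ⟶ H) (p : H ⟶ L), IsSES i p ∧ GInj C H ∧ GidLE n L := by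
  constructor
  · rintro ⟨X, hX, rfl, hG, hK⟩
    exact ⟨_, _, _, _, hX.isSES, hG, hK⟩
  · rintro ⟨K, G, i, p, h, hG, hK⟩
    exact ⟨_, h.shortExact, rfl, hG, hK⟩

lemma GpdLE.of_iso {n : ℕ} {M M' : C} (h : GpdLE n M) (e : M ≅ M') : GpdLE n M' := by
  cases n with
  | zero => exact GProj.of_iso h e
  | succ n =>
    obtain ⟨K, G, i, p, hs, hG, hK⟩ := gpdLE_succ_iff.1 h
    exact gpdLE_succ_iff.2 ⟨K, G, i, _, hs.iso_right e, hG, hK⟩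

lemma PdLE.gpdLE {n : ℕ} {M : C} (h : PdLE n M) : GpdLE n M := by
  induction n generalizing M with
  | zero =>
    have : Projective M := h
    exact gproj_of_projective M
  | succ n ih =>
    obtain ⟨K, P, i, p, hs, hP, hK⟩ := h
    exact gpdLE_succ_iff.2 ⟨K, P, i, p, hs, gproj_of_projective P, ih hK⟩

lemma GpdLE.biprod {n : ℕ} {M : C} (h : GpdLE n M) (P : C) [Projective P] :
    GpdLE n (M ⊞ P) := by
  cases n with
  | zero => exact GProj.biprod h (gproj_of_projective P)
  | succ n =>
    obtain ⟨K, G, i, p, hs, hG, hK⟩ := gpdLE_succ_iff.1 h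
    exact gpdLE_succ_iff.2 ⟨K, _, _, _, hs.biprod_right P, hG.biprod (gproj_of_projective P), hK⟩

/-- Replace the first term `G₀` of a resolution of `E` by the kernel of `G₀ ⟶ G`, and keep the same
syzygy. -/
lemma GpdLE.of_kernel {n : ℕ} {K E G : C} {i : K ⟶ E} {p : E ⟶ G} (h : IsSES i p)
    (hE : GpdLE n E) (hG : GProj C G) : GpdLE n K := by
  cases n with
  | zero => exact GProj.of_kernel h hE hG
  | succ n =>
    obtain ⟨E', G₀, j, q, hs, hG₀, hE'⟩ := gpdLE_succ_iff.1 hE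
    obtain ⟨N, k, c, d, h1, h2, -⟩ := hs.comp_epi h
    exact gpdLE_succ_iff.2 ⟨_, _, _, _, h2, GProj.of_kernel h1 hG₀ hG, hE'⟩

/-- Syzygies have smaller Gorenstein projective dimension. -/
lemma GpdLE.syzygy {n : ℕ} {K P M : C} {i : K ⟶ P} {p : P ⟶ M} (h : IsSES i p) [Projective P]
    (hM : GpdLE (n + 1) M) : GpdLE n K := by
  obtain ⟨K', G, j, q, hs, hG, hK'⟩ := gpdLE_succ_iff.1 hM
  -- Schanuel's argument: the pullback is `K' ⊞ P`, and it maps onto `G` with kernel `K`.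
  obtain ⟨W, g', b, f', sq, -, hW⟩ := hs.exists_pullback p
  obtain ⟨f'', -, hW'⟩ := h.of_isPullback sq.flip
  obtain ⟨φ⟩ := hW.nonempty_iso_of_projective
  exact GpdLE.of_kernel hW' ((hK'.biprod P).of_iso φ.symm) hG

/-- Objects of finite Gorenstein projective dimension embed into objects of finite projective
dimension with Gorenstein projective cokernel. -/
theorem GpdLE.exists_hull {n : ℕ} {M : C} (h : GpdLE n M) :
    ∃ (L G : C) (i : M ⟶ L) (p : L ⟶ G), IsSES i p ∧ PdLE n L ∧ GProj C G := by
  induction n generalizing M with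
  | zero =>
    obtain ⟨N, hN, P, k, e, hk⟩ := GProj.exists_right h
    exact ⟨P, N, k, e, hk.ses, hk.projective, hN⟩
  | succ n ih =>
    obtain ⟨K, G₀, j, q, hs, hG₀, hK⟩ := gpdLE_succ_iff.1 h
    obtain ⟨L', G', i', p', hs', hL', hG'⟩ := ih hK
    -- The pushout `W` is an extension of `G'` by `G₀`, hence Gorenstein projective, and `M` is `W`
    -- modulo `L'`. Embedding `W` in a projective `P` makes `P` modulo `L'` the hull.
    obtain ⟨W, f, b, g, sq, -, hW⟩ := hs.exists_pushout i'
    obtain ⟨f', -, hW'⟩ := hs'.of_isPushout sq.flip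
    obtain ⟨N, hN, P, k, e, hk⟩ := (GProj.extension hW' hG₀ hG').exists_right
    obtain ⟨L, l, c, d, h1, h2, -⟩ := hW.comp_mono hk.ses
    exact ⟨L, N, c, d, h2, ⟨_, _, _, _, h1, hk.projective, hL'⟩, hN⟩

/-- Special Gorenstein projective precovers. -/
theorem GpdLE.exists_cover {n : ℕ} {M : C} (h : GpdLE n M) :
    ∃ (L G : C) (i : L ⟶ G) (p : G ⟶ M), IsSES i p ∧ (∃ m, PdLE m L) ∧ GProj C G := by
  obtain ⟨L, G, i, p, hs, hL, hG⟩ := h.exists_hull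
  obtain ⟨K, P, j, q, hj, hP, hK⟩ : ∃ (K P : C) (j : K ⟶ P) (q : P ⟶ L), IsSES j q ∧
      Projective P ∧ ∃ m, PdLE m K := by
    cases n with
    | zero => exact ⟨_, _, _, _, IsSES.zero_id L, hL, 0, inferInstanceAs (Projective (0 : C))⟩
    | succ n =>
      obtain ⟨K, P, j, q, hj, hP, hK⟩ := hL
      exact ⟨K, P, j, q, hj, hP, n, hK⟩
  -- The cover is the preimage of `M` in the projective `P` that covers the hull.
  obtain ⟨W, w, c, d, h1, h2, -⟩ := hj.comp_epi hs
  exact ⟨K, W, c, d, h2, hK, GProj.of_kernel h1 (gproj_of_projective P) hG⟩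

/-- `M` is the kernel of a map from its hull to a Gorenstein projective, so it inherits the bound on
the hull. This converts finitistic dimension into a uniform Gorenstein bound. -/
lemma GpdLE.of_bound {n m : ℕ} {M : C} (h : GpdLE n M) (hm : ∀ L : C, PdLE n L → PdLE m L) :
    GpdLE m M := by
  obtain ⟨L, G, i, p, hs, hL, hG⟩ := h.exists_hull
  exact GpdLE.of_kernel hs (hm L hL).gpdLE hG

/-! ### Dimensions in the opposite category -/

lemma IdLE.op {n : ℕ} {M : C} (h : IdLE n M) : PdLE n (Opposite.op M) := by
  induction n generalizing M with
  | zero =>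
    have : Injective M := h
    exact inferInstanceAs (Projective (Opposite.op M))
  | succ n ih =>
    obtain ⟨I, L, i, p, hs, hI, hL⟩ := h
    exact ⟨_, _, _, _, hs.op, inferInstance, ih hL⟩

lemma PdLE.unop {n : ℕ} {M : Cᵒᵖ} (h : PdLE n M) : IdLE n M.unop := by
  induction n generalizing M with
  | zero =>
    have : Projective M := h
    exact inferInstanceAs (Injective M.unop)
  | succ n ih =>
    obtain ⟨I, L, i, p, hs, hI, hL⟩ := h
    exact ⟨_, _, _, _, hs.unop, inferInstance, ih hL⟩

lemma GidLE.op {n : ℕ} {M : C} (h : GidLE n M) : GpdLE n (Opposite.op M) := by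
  induction n generalizing M with
  | zero => exact GInj.op h
  | succ n ih =>
    obtain ⟨I, L, i, p, hs, hI, hL⟩ := gidLE_succ_iff.1 h
    exact gpdLE_succ_iff.2 ⟨_, _, _, _, hs.op, hI.op, ih hL⟩

lemma GpdLE.unop {n : ℕ} {M : Cᵒᵖ} (h : GpdLE n M) : GidLE n M.unop := by
  induction n generalizing M with
  | zero => exact GProj.unop h
  | succ n ih =>
    obtain ⟨I, L, i, p, hs, hI, hL⟩ := gpdLE_succ_iff.1 h
    exact gidLE_succ_iff.2 ⟨_, _, _, _, hs.unop, hI.unop, ih hL⟩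

lemma ginj_of_injective (I : C) [Injective I] : GInj C I := (isProInjective_GInj I).prop

lemma IdLE.gidLE {n : ℕ} {M : C} (h : IdLE n M) : GidLE n M := h.op.gpdLE.unop

theorem GInj.extension {K E M : C} {i : K ⟶ E} {p : E ⟶ M} (h : IsSES i p) (hK : GInj C K)
    (hM : GInj C M) : GInj C E :=
  (GProj.extension h.op hM.op hK.op).unop

/-- Special Gorenstein injective preenvelopes. -/
theorem GidLE.exists_envelope {n : ℕ} {M : C} (h : GidLE n M) :
    ∃ (H L : C) (i : M ⟶ H) (p : H ⟶ L), IsSES i p ∧ GInj C H ∧ ∃ m, IdLE m L := by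
  obtain ⟨L, G, i, p, hs, ⟨m, hL⟩, hG⟩ := h.op.exists_cover
  exact ⟨_, _, _, _, hs.unop, hG.unop, m, hL.unop⟩

lemma GidLE.of_bound {n m : ℕ} {M : C} (h : GidLE n M) (hm : ∀ L : C, IdLE n L → IdLE m L) :
    GidLE m M :=
  (h.op.of_bound fun _ hL => (hm _ hL.unop).op).unop

end Closure

/-! ## Frobenius families of functors -/

section Frobenius

variable {J : Type*} {D : Type*} [Category* D] {A : Type*} [Category* A]

/-- `R` is cofree on the family `P` and free on the family `P'`, with respect to the family of
functors `U`; moreover, the two families and `R` are linked by preservation of projective and of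
injective objects. -/
structure IsBifree (U : J → D ⥤ A) {R : D} {P P' : J → A} (π : ∀ j, (U j).obj R ⟶ P j)
    (ι : ∀ j, P' j ⟶ (U j).obj R) : Prop where
  exists_lift : ∀ {G : D} (f : ∀ j, (U j).obj G ⟶ P j),
    ∃ g : G ⟶ R, ∀ j, (U j).map g ≫ π j = f j
  lift_ext : ∀ {G : D} {g g' : G ⟶ R},
    (∀ j, (U j).map g ≫ π j = (U j).map g' ≫ π j) → g = g'
  exists_desc : ∀ {G : D} (f : ∀ j, P' j ⟶ (U j).obj G),
    ∃ g : R ⟶ G, ∀ j, ι j ≫ (U j).map g = f j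
  desc_ext : ∀ {G : D} {g g' : R ⟶ G},
    (∀ j, ι j ≫ (U j).map g = ι j ≫ (U j).map g') → g = g'
  projective_iff : (∀ j, Projective (P j)) ↔ ∀ j, Projective (P' j)
  injective_iff : (∀ j, Injective (P j)) ↔ ∀ j, Injective (P' j)
  projective_map : (∀ j, Projective (P j)) → ∀ j, Projective ((U j).obj R)
  injective_map : (∀ j, Injective (P j)) → ∀ j, Injective ((U j).obj R)

/-- The fields of `IsBifree` come in pairs exchanged by duality, free with cofree and projective
with injective. All Gorenstein injective statements for Frobenius families follow from this. -/
lemma IsBifree.op {U : J → D ⥤ A} {R : D} {P P' : J → A} {π : ∀ j, (U j).obj R ⟶ P j}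
    {ι : ∀ j, P' j ⟶ (U j).obj R} (h : IsBifree U π ι) :
    IsBifree (fun j => (U j).op) (R := .op R) (fun j => (ι j).op) (fun j => (π j).op) where
  exists_lift f := by
    obtain ⟨g, hg⟩ := h.exists_desc (fun j => (f j).unop)
    exact ⟨g.op, fun j => congrArg Quiver.Hom.op (hg j)⟩
  lift_ext hg := Quiver.Hom.unop_inj (h.desc_ext fun j => congrArg Quiver.Hom.unop (hg j))
  exists_desc f := by
    obtain ⟨g, hg⟩ := h.exists_lift (fun j => (f j).unop)
    exact ⟨g.op, fun j => congrArg Quiver.Hom.op (hg j)⟩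
  desc_ext hg := Quiver.Hom.unop_inj (h.lift_ext fun j => congrArg Quiver.Hom.unop (hg j))
  projective_iff := by
    simp only [← Injective.injective_iff_projective_op]
    exact h.injective_iff.symm
  injective_iff := by
    simp only [← Injective.projective_iff_injective_op]
    exact h.projective_iff.symm
  projective_map hP j := by
    simp only [← Injective.injective_iff_projective_op] at hP
    have := h.injective_map (h.injective_iff.2 hP) j
    exact inferInstanceAs (Projective (Opposite.op ((U j).obj R)))
  injective_map hP j := by
    simp only [← Injective.projective_iff_injective_op] at hP
    have := h.projective_map (h.projective_iff.2 hP) j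
    exact inferInstanceAs (Injective (Opposite.op ((U j).obj R)))

variable [Abelian D] [Abelian A]

/-- Jointly faithful exact functors whose left and right adjoints (as a functor to families)
have the same image. -/
structure IsFrobeniusFamily (U : J → D ⥤ A) : Prop where
  map_isSES : ∀ (j : J) {X Y Z : D} {f : X ⟶ Y} {g : Y ⟶ Z}, IsSES f g →
    IsSES ((U j).map f) ((U j).map g)
  map_zero : ∀ (j : J) (X Y : D), (U j).map (0 : X ⟶ Y) = 0
  faithful : ∀ {X Y : D} {f : X ⟶ Y}, (∀ j, (U j).map f = 0) → f = 0
  exists_cofree : ∀ P : J → A, ∃ (R : D) (P' : J → A) (π : ∀ j, (U j).obj R ⟶ P j)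
    (ι : ∀ j, P' j ⟶ (U j).obj R), IsBifree U π ι
  exists_free : ∀ P' : J → A, ∃ (R : D) (P : J → A) (π : ∀ j, (U j).obj R ⟶ P j)
    (ι : ∀ j, P' j ⟶ (U j).obj R), IsBifree U π ι

namespace IsFrobeniusFamily

variable {U : J → D ⥤ A}

lemma op (hU : IsFrobeniusFamily U) : IsFrobeniusFamily (fun j => (U j).op) where
  map_isSES j _ _ _ _ _ h := (hU.map_isSES j h.unop).op
  map_zero j X Y := congrArg Quiver.Hom.op (hU.map_zero j Y.unop X.unop)
  faithful h := Quiver.Hom.unop_inj (hU.faithful fun j => congrArg Quiver.Hom.unop (h j))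
  exists_cofree P := by
    obtain ⟨R, P', π, ι, h⟩ := hU.exists_free fun j => (P j).unop
    exact ⟨_, _, _, _, h.op⟩
  exists_free P := by
    obtain ⟨R, P', π, ι, h⟩ := hU.exists_cofree fun j => (P j).unop
    exact ⟨_, _, _, _, h.op⟩

lemma mono_of_mono (hU : IsFrobeniusFamily U) {X Y : D} (f : X ⟶ Y)
    (h : ∀ j, Mono ((U j).map f)) : Mono f := by
  refine Preadditive.mono_of_cancel_zero _ fun x hx => hU.faithful fun j => ?_
  rw [← cancel_mono ((U j).map f), ← (U j).map_comp, hx, hU.map_zero, zero_comp]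

lemma epi_of_epi (hU : IsFrobeniusFamily U) {X Y : D} (f : X ⟶ Y)
    (h : ∀ j, Epi ((U j).map f)) : Epi f := by
  refine Preadditive.epi_of_cancel_zero _ fun x hx => hU.faithful fun j => ?_
  rw [← cancel_epi ((U j).map f), ← (U j).map_comp, hx, hU.map_zero, comp_zero]

lemma epi_map (hU : IsFrobeniusFamily U) {X Y : D} (f : X ⟶ Y) [Epi f] (j : J) :
    Epi ((U j).map f) := (hU.map_isSES j (IsSES.of_epi f)).epi

lemma projective_of_isBifree (hU : IsFrobeniusFamily U) {R : D} {P P' : J → A}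
    {π : ∀ j, (U j).obj R ⟶ P j} {ι : ∀ j, P' j ⟶ (U j).obj R} (h : IsBifree U π ι)
    (hP : ∀ j, Projective (P j)) : Projective R where
  factors {X Y} f e he := by
    have := h.projective_iff.1 hP
    have := hU.epi_map e
    obtain ⟨g, hg⟩ := h.exists_desc fun j => Projective.factorThru (ι j ≫ (U j).map f) ((U j).map e)
    exact ⟨g, h.desc_ext fun j => by simp [reassoc_of% hg]⟩

/-- Epimorphisms from free objects on families of projective objects. -/
lemma exists_projective (hU : IsFrobeniusFamily U) [EnoughProjectives A] (X : D) :
    ∃ (R : D) (P P' : J → A) (π : ∀ j, (U j).obj R ⟶ P j) (ι : ∀ j, P' j ⟶ (U j).obj R)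
      (e : R ⟶ X), IsBifree U π ι ∧ (∀ j, Projective (P j)) ∧ Epi e := by
  obtain ⟨R, P, π, ι, h⟩ := hU.exists_free fun j => Projective.over ((U j).obj X)
  obtain ⟨e, he⟩ := h.exists_desc fun j => Projective.π ((U j).obj X)
  refine ⟨R, P, _, π, ι, e, h, h.projective_iff.2 fun j => inferInstance,
    hU.epi_of_epi _ fun j => ?_⟩
  have : Epi (ι j ≫ (U j).map e) := by rw [he]; infer_instance
  exact CategoryTheory.epi_of_epi (ι j) _

lemma enoughProjectives (hU : IsFrobeniusFamily U) [EnoughProjectives A] :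
    EnoughProjectives D where
  presentation X := by
    obtain ⟨R, P, P', π, ι, e, h, hP, he⟩ := hU.exists_projective X
    exact ⟨{ p := R, projective := hU.projective_of_isBifree h hP, f := e, epi := he }⟩

lemma exists_retract (hU : IsFrobeniusFamily U) [EnoughProjectives A] (Q : D) [Projective Q] :
    ∃ (R : D) (P P' : J → A) (π : ∀ j, (U j).obj R ⟶ P j) (ι : ∀ j, P' j ⟶ (U j).obj R),
      Nonempty (Retract Q R) ∧ IsBifree U π ι ∧ (∀ j, Projective (P j)) := by
  obtain ⟨R, P, P', π, ι, e, h, hP, he⟩ := hU.exists_projective Q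
  exact ⟨R, P, P', π, ι, ⟨{ i := Projective.factorThru (𝟙 Q) e, r := e }⟩, h, hP⟩

lemma projective_map (hU : IsFrobeniusFamily U) [EnoughProjectives A] (Q : D) [Projective Q]
    (j : J) : Projective ((U j).obj Q) := by
  obtain ⟨R, P, P', π, ι, ⟨r⟩, h, hP⟩ := hU.exists_retract Q
  have := h.projective_map hP j
  exact (r.map (U j)).projective

/-- A projective object is a retract of a free one on projectives, which is also cofree. Maps into
it are therefore families of maps into projectives of `A`, so they extend as soon as the families
do. -/
lemma exists_ext_of_map (hU : IsFrobeniusFamily U) [EnoughProjectives A] {K E : D} (i : K ⟶ E)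
    (hi : ∀ j, ∀ Q : A, Projective Q → ∀ f : (U j).obj K ⟶ Q, ∃ g, (U j).map i ≫ g = f)
    (Q : D) (hQ : Projective Q) (f : K ⟶ Q) : ∃ g : E ⟶ Q, i ≫ g = f := by
  obtain ⟨R, P, P', π, ι, ⟨r⟩, h, hP⟩ := hU.exists_retract Q
  choose g hg using fun j => hi j (P j) (hP j) ((U j).map (f ≫ r.i) ≫ π j)
  obtain ⟨k, hk⟩ := h.exists_lift g
  have : i ≫ k = f ≫ r.i := h.lift_ext fun j => by rw [(U j).map_comp, Category.assoc, hk, hg]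
  exact ⟨k ≫ r.r, by rw [reassoc_of% this, r.retract, Category.comp_id]⟩

lemma isProjStep_map (hU : IsFrobeniusFamily U) [EnoughProjectives A] {G P G' : D} {i : G ⟶ P}
    {p : P ⟶ G'} (h : IsProjStep i p) (j : J) : IsProjStep ((U j).map i) ((U j).map p) where
  ses := hU.map_isSES j h.ses
  projective := have := h.projective; hU.projective_map P j
  exists_ext Q hQ f := by
    classical
    -- A map `(U j).obj G ⟶ Q`, padded by zero at the other indices, is a map from `G` to the cofree
    -- object on the constant family `Q`; that object is projective, so the step in `D` extends it.
    obtain ⟨R, P', π, ι, hR⟩ := hU.exists_cofree fun _ => Q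
    obtain ⟨k, hk⟩ := hR.exists_lift
      (Function.update (fun j => (0 : (U j).obj G ⟶ Q)) j f)
    obtain ⟨g, rfl⟩ := h.exists_ext R (hU.projective_of_isBifree hR fun _ => hQ) k
    refine ⟨(U j).map g ≫ π j, ?_⟩
    have := hk j
    rw [Function.update_self] at this
    rw [← this, (U j).map_comp, Category.assoc]

/-- Frobenius families preserve and jointly reflect Gorenstein projective objects. -/
theorem gproj_iff (hU : IsFrobeniusFamily U) [EnoughProjectives A] {G : D} :
    GProj D G ↔ ∀ j, GProj A ((U j).obj G) := by
  constructor
  · intro hG j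
    refine GProj.of_coinduction (fun X => ∃ G, GProj D G ∧ X = (U j).obj G) ?_ ?_ ⟨G, hG, rfl⟩
    · rintro _ ⟨G, hG, rfl⟩
      obtain ⟨G', hG', P, i, p, h⟩ := hG.exists_left
      exact ⟨_, ⟨G', hG', rfl⟩, _, _, _, hU.isProjStep_map h j⟩
    · rintro _ ⟨G, hG, rfl⟩
      obtain ⟨G', hG', P, i, p, h⟩ := hG.exists_right
      exact ⟨_, ⟨G', hG', rfl⟩, _, _, _, hU.isProjStep_map h j⟩
  · intro hG
    refine GProj.of_coinduction (fun G => ∀ j, GProj A ((U j).obj G)) ?_ ?_ hG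
    · intro G hG
      obtain ⟨R, P, P', π, ι, e, h, hP, he⟩ := hU.exists_projective G
      have hs := IsSES.of_epi e
      have := h.projective_map hP
      exact ⟨_, fun j => GProj.of_kernel (hU.map_isSES j hs) (gproj_of_projective _) (hG j),
        _, _, _, hs, hU.projective_of_isBifree h hP,
        hU.exists_ext_of_map _ fun j => (hG j).orth _ _ (hU.map_isSES j hs)⟩
    · intro G hG
      -- The termwise embeddings into projectives assemble to `g : G ⟶ R` with `R` cofree. Composing
      -- with `π j` recovers `i j`, which makes `g` monic and gives it the termwise extension
      -- property; the cokernel is then termwise orthogonal to projectives.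
      choose N hN P i p hi using fun j => (hG j).exists_right
      obtain ⟨R, P', π, ι, h⟩ := hU.exists_cofree P
      have hP := fun j => (hi j).projective
      obtain ⟨g, hg⟩ := h.exists_lift i
      have : Mono g := hU.mono_of_mono _ fun j => by
        have := (hi j).ses.mono
        rw [← hg] at this
        exact CategoryTheory.mono_of_mono _ (π j)
      have hs := IsSES.of_mono g
      have hR := h.projective_map hP
      have hst : ∀ j, IsProjStep ((U j).map g) ((U j).map (cokernel.π g)) := fun j =>
        ⟨hU.map_isSES j hs, hR j, fun Q hQ f => by
          obtain ⟨k, hk⟩ := (hi j).exists_ext Q hQ f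
          exact ⟨π j ≫ k, by rw [reassoc_of% hg, hk]⟩⟩
      exact ⟨_, fun j => GProj.of_cokernel (hst j).ses (hG j) (gproj_of_projective _) (hst j).orth,
        _, _, _, hs, hU.projective_of_isBifree h hP,
        hU.exists_ext_of_map _ fun j => (hst j).exists_ext⟩

/-- For the converse no termwise resolutions need to be glued: any cover by a free object on
projectives has termwise projective middle, so its kernel has dimension one less termwise. -/
theorem gpdLE_iff (hU : IsFrobeniusFamily U) [EnoughProjectives A] {n : ℕ} {X : D} :
    GpdLE n X ↔ ∀ j, GpdLE n ((U j).obj X) := by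
  induction n generalizing X with
  | zero => exact hU.gproj_iff
  | succ n ih =>
    constructor
    · intro h j
      obtain ⟨K, G, i, p, hs, hG, hK⟩ := gpdLE_succ_iff.1 h
      exact gpdLE_succ_iff.2 ⟨_, _, _, _, hU.map_isSES j hs, hU.gproj_iff.1 hG j, ih.1 hK j⟩
    · intro h
      obtain ⟨R, P, P', π, ι, e, hR, hP, he⟩ := hU.exists_projective X
      have hs := IsSES.of_epi e
      have := hR.projective_map hP
      have := hU.projective_of_isBifree hR hP
      exact gpdLE_succ_iff.2 ⟨_, _, _, _, hs, gproj_of_projective R,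
        ih.2 fun j => (h j).syzygy (hU.map_isSES j hs)⟩

theorem gidLE_iff (hU : IsFrobeniusFamily U) [EnoughInjectives A] {n : ℕ} {X : D} :
    GidLE n X ↔ ∀ j, GidLE n ((U j).obj X) :=
  ⟨fun h j => (hU.op.gpdLE_iff.1 h.op j).unop,
    fun h => (hU.op.gpdLE_iff.2 fun j => (h j).op : GpdLE n (Opposite.op X)).unop⟩

lemma injective_of_isBifree (hU : IsFrobeniusFamily U) {R : D} {P P' : J → A}
    {π : ∀ j, (U j).obj R ⟶ P j} {ι : ∀ j, P' j ⟶ (U j).obj R} (h : IsBifree U π ι)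
    (hP : ∀ j, Injective (P j)) : Injective R := by
  have := h.injective_iff.1 hP
  have := hU.op.projective_of_isBifree h.op fun j => inferInstance
  exact inferInstanceAs (Injective (Opposite.unop (Opposite.op R)))

lemma enoughInjectives (hU : IsFrobeniusFamily U) [EnoughInjectives A] :
    EnoughInjectives D :=
  have := hU.op.enoughProjectives
  Injective.enoughInjectives_of_enoughProjectives_op

end IsFrobeniusFamily

end Frobenius

/-! ## Contractible complexes and Sharp–Foxby adjunctions on complexes -/

section Complexes

variable {A : Type u} [Category.{v} A]

/-- The complex `K` has terms `P n ⊞ Q n`, with `Q (n + 1) ≅ P n` through the differential. -/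
structure DiskData [Preadditive A] (K : ChainComplex A ℤ) (P Q : ℤ → A) where
  fst (n : ℤ) : K.X n ⟶ P n
  snd (n : ℤ) : K.X n ⟶ Q n
  inl (n : ℤ) : P n ⟶ K.X n
  inr (n : ℤ) : Q n ⟶ K.X n
  -- Both indices are free, so the pairs `(n + 1, n)` and `(n, n - 1)` are covered without
  -- transports.
  iso (m n : ℤ) (h : n + 1 = m) : Q m ≅ P n
  inl_fst (n : ℤ) : inl n ≫ fst n = 𝟙 _
  inl_snd (n : ℤ) : inl n ≫ snd n = 0
  inr_fst (n : ℤ) : inr n ≫ fst n = 0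
  inr_snd (n : ℤ) : inr n ≫ snd n = 𝟙 _
  total (n : ℤ) : fst n ≫ inl n + snd n ≫ inr n = 𝟙 _
  d_eq (m n : ℤ) (h : n + 1 = m) : K.d m n = snd m ≫ (iso m n h).hom ≫ inl n

namespace DiskData

attribute [simp] inl_fst inl_snd inr_fst inr_snd

@[simp]
lemma inl_fst_assoc [Preadditive A] {K : ChainComplex A ℤ} {P Q : ℤ → A}
    (h : DiskData K P Q) {n : ℤ}
    {X : A} (f : P n ⟶ X) : h.inl n ≫ h.fst n ≫ f = f := by
  rw [← Category.assoc, h.inl_fst]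
  simp

@[simp]
lemma inl_snd_assoc [Preadditive A] {K : ChainComplex A ℤ} {P Q : ℤ → A}
    (h : DiskData K P Q) {n : ℤ}
    {X : A} (f : Q n ⟶ X) : h.inl n ≫ h.snd n ≫ f = 0 := by
  rw [← Category.assoc, h.inl_snd]
  simp

@[simp]
lemma inr_fst_assoc [Preadditive A] {K : ChainComplex A ℤ} {P Q : ℤ → A}
    (h : DiskData K P Q) {n : ℤ}
    {X : A} (f : P n ⟶ X) : h.inr n ≫ h.fst n ≫ f = 0 := by
  rw [← Category.assoc, h.inr_fst]
  simp

@[simp]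
lemma inr_snd_assoc [Preadditive A] {K : ChainComplex A ℤ} {P Q : ℤ → A}
    (h : DiskData K P Q) {n : ℤ}
    {X : A} (f : Q n ⟶ X) : h.inr n ≫ h.snd n ≫ f = f := by
  rw [← Category.assoc, h.inr_snd]
  simp

/-- Additive functors preserve disk data. -/
def map [Preadditive A] {K : ChainComplex A ℤ} {P Q : ℤ → A} (h : DiskData K P Q) (F : A ⥤ A)
    [F.Additive] : DiskData ((F.mapHomologicalComplex _).obj K) (fun n => F.obj (P n))
      (fun n => F.obj (Q n)) where
  fst n := F.map (h.fst n)
  snd n := F.map (h.snd n)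
  inl n := F.map (h.inl n)
  inr n := F.map (h.inr n)
  iso m n hmn := F.mapIso (h.iso m n hmn)
  inl_fst n := (F.map_comp _ _).symm.trans ((congrArg F.map (h.inl_fst n)).trans (F.map_id _))
  inl_snd n := (F.map_comp _ _).symm.trans ((congrArg F.map (h.inl_snd n)).trans (F.map_zero _ _))
  inr_fst n := (F.map_comp _ _).symm.trans ((congrArg F.map (h.inr_fst n)).trans (F.map_zero _ _))
  inr_snd n := (F.map_comp _ _).symm.trans ((congrArg F.map (h.inr_snd n)).trans (F.map_id _))
  total n := by
    have := congrArg F.map (h.total n)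
    rw [F.map_add, F.map_comp, F.map_comp, F.map_id] at this
    exact this
  d_eq m n hmn := by
    have := congrArg F.map (h.d_eq m n hmn)
    rw [F.map_comp, F.map_comp] at this
    exact this

variable [Abelian A] {K : ChainComplex A ℤ} {P Q : ℤ → A}

/-- The terms of `K` are biproducts. -/
def isoX (h : DiskData K P Q) (n : ℤ) : P n ⊞ Q n ≅ K.X n where
  hom := biprod.desc (h.inl n) (h.inr n)
  inv := biprod.lift (h.fst n) (h.snd n)
  hom_inv_id := by apply biprod.hom_ext' <;> apply biprod.hom_ext <;> simp
  inv_hom_id := by rw [biprod.lift_desc, h.total]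

lemma hom_ext (h : DiskData K P Q) {n : ℤ} {X : A} {f g : X ⟶ K.X n}
    (h₁ : f ≫ h.fst n = g ≫ h.fst n) (h₂ : f ≫ h.snd n = g ≫ h.snd n) : f = g := by
  rw [← Category.comp_id f, ← Category.comp_id g, ← h.total, Preadditive.comp_add,
    Preadditive.comp_add, reassoc_of% h₁, reassoc_of% h₂]

lemma hom_ext' (h : DiskData K P Q) {n : ℤ} {X : A} {f g : K.X n ⟶ X}
    (h₁ : h.inl n ≫ f = h.inl n ≫ g) (h₂ : h.inr n ≫ f = h.inr n ≫ g) : f = g := by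
  rw [← Category.id_comp f, ← Category.id_comp g, ← h.total, Preadditive.add_comp,
    Preadditive.add_comp, Category.assoc, Category.assoc, Category.assoc, Category.assoc, h₁, h₂]

lemma exists_of_iso (P Q : ℤ → A) (e : ∀ n, Q (n + 1) ≅ P n) :
    ∃ K : ChainComplex A ℤ, Nonempty (DiskData K P Q) := by
  let d : ∀ n, P (n + 1) ⊞ Q (n + 1) ⟶ P n ⊞ Q n := fun n => biprod.snd ≫ (e n).hom ≫ biprod.inl
  refine ⟨ChainComplex.of (fun n => P n ⊞ Q n) d (fun n => by simp [d]), ⟨?_⟩⟩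
  exact
    { fst := fun n => (biprod.fst : P n ⊞ Q n ⟶ P n)
      snd := fun n => (biprod.snd : P n ⊞ Q n ⟶ Q n)
      inl := fun n => (biprod.inl : P n ⟶ P n ⊞ Q n)
      inr := fun n => (biprod.inr : Q n ⟶ P n ⊞ Q n)
      iso := fun m n hmn => eqToIso (by rw [hmn]) ≪≫ e n
      inl_fst := fun n => biprod.inl_fst
      inl_snd := fun n => biprod.inl_snd
      inr_fst := fun n => biprod.inr_fst
      inr_snd := fun n => biprod.inr_snd
      total := fun n => biprod.total
      d_eq := fun m n hmn => by
        subst hmn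
        refine (ChainComplex.of_d (fun n => P n ⊞ Q n) d n).trans ?_
        simp [d] }

lemma exists_right (P : ℤ → A) :
    ∃ (K : ChainComplex A ℤ) (Q : ℤ → A), Nonempty (DiskData K P Q) := by
  obtain ⟨K, hK⟩ := exists_of_iso P (fun n => P (n - 1)) (fun n => eqToIso (by simp))
  exact ⟨K, _, hK⟩

lemma exists_left (Q : ℤ → A) :
    ∃ (K : ChainComplex A ℤ) (P : ℤ → A), Nonempty (DiskData K P Q) := by
  obtain ⟨K, hK⟩ := exists_of_iso (fun n => Q (n + 1)) Q (fun n => Iso.refl _)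
  exact ⟨K, _, hK⟩

lemma prop_iff (h : DiskData K P Q) (R : A → Prop) (hR : ∀ X Y, (X ≅ Y) → R X → R Y) :
    (∀ n, R (P n)) ↔ ∀ n, R (Q n) :=
  ⟨fun hP n => hR _ _ (h.iso n (n - 1) (by simp)).symm (hP _),
    fun hQ n => hR _ _ (h.iso (n + 1) n rfl) (hQ _)⟩

/-- The morphism to `K` determined by morphisms to the objects `P n`. -/
def lift (h : DiskData K P Q) {G : ChainComplex A ℤ} (f : ∀ n, G.X n ⟶ P n) : G ⟶ K where
  f n := f n ≫ h.inl n +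
    -- The differential carries `Q n` isomorphically to `P (n - 1)`, so compatibility with it forces
    -- this component.
    G.d n (n - 1) ≫ f (n - 1) ≫ (h.iso n (n - 1) (by simp)).inv ≫ h.inr n
  comm' m n hmn := by
    obtain rfl : n = m - 1 := by simp at hmn; omega
    rw [h.d_eq _ _ (by simp)]
    simp

lemma lift_fst (h : DiskData K P Q) {G : ChainComplex A ℤ} (f : ∀ n, G.X n ⟶ P n) (n : ℤ) :
    (h.lift f).f n ≫ h.fst n = f n := by
  simp [lift]

lemma lift_ext (h : DiskData K P Q) {G : ChainComplex A ℤ} {g g' : G ⟶ K}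
    (hg : ∀ n, g.f n ≫ h.fst n = g'.f n ≫ h.fst n) : g = g' := by
  have key : ∀ (g : G ⟶ K) (n : ℤ), g.f n ≫ h.snd n =
      G.d n (n - 1) ≫ g.f (n - 1) ≫ h.fst (n - 1) ≫ (h.iso n (n - 1) (by simp)).inv := by
    intro g n
    rw [← g.comm_assoc, h.d_eq n (n - 1) (by simp)]
    simp
  ext n
  refine h.hom_ext (hg n) ?_
  rw [key, key, reassoc_of% hg]

/-- The morphism from `K` determined by morphisms from the objects `Q n`. -/
def desc (h : DiskData K P Q) {G : ChainComplex A ℤ} (f : ∀ n, Q n ⟶ G.X n) : K ⟶ G where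
  f n := h.snd n ≫ f n + h.fst n ≫ (h.iso (n + 1) n rfl).inv ≫ f (n + 1) ≫ G.d (n + 1) n
  comm' m n hmn := by
    obtain rfl : m = n + 1 := by simp at hmn; omega
    rw [h.d_eq _ _ rfl]
    simp

lemma inr_desc (h : DiskData K P Q) {G : ChainComplex A ℤ} (f : ∀ n, Q n ⟶ G.X n) (n : ℤ) :
    h.inr n ≫ (h.desc f).f n = f n := by
  simp [desc]

lemma desc_ext (h : DiskData K P Q) {G : ChainComplex A ℤ} {g g' : K ⟶ G}
    (hg : ∀ n, h.inr n ≫ g.f n = h.inr n ≫ g'.f n) : g = g' := by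
  have key : ∀ (g : K ⟶ G) (n : ℤ), h.inl n ≫ g.f n =
      (h.iso (n + 1) n rfl).inv ≫ h.inr (n + 1) ≫ g.f (n + 1) ≫ G.d (n + 1) n := by
    intro g n
    rw [g.comm, h.d_eq (n + 1) n rfl]
    simp
  ext n
  refine h.hom_ext' ?_ (hg n)
  rw [key, key, reassoc_of% (hg (n + 1))]

lemma isBifree (h : DiskData K P Q) :
    IsBifree (fun n : ℤ => HomologicalComplex.eval A (ComplexShape.down ℤ) n) (R := K)
      h.fst h.inr where
  exists_lift f := ⟨h.lift f, h.lift_fst f⟩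
  lift_ext hg := h.lift_ext hg
  exists_desc f := ⟨h.desc f, h.inr_desc f⟩
  desc_ext hg := h.desc_ext hg
  projective_iff := h.prop_iff (fun X => Projective X) fun _ _ e hX => Projective.of_iso e hX
  injective_iff := h.prop_iff (fun X => Injective X) fun _ _ e hX => Injective.of_iso e hX
  projective_map hP n := by
    have := h.prop_iff (fun X => Projective X) (fun _ _ e hX => Projective.of_iso e hX) |>.1 hP
    exact Projective.of_iso (h.isoX n) inferInstance
  injective_map hP n := by
    have := h.prop_iff (fun X => Injective X) (fun _ _ e hX => Injective.of_iso e hX) |>.1 hP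
    exact Injective.of_iso (h.isoX n) inferInstance

/-- The morphism of complexes induced by a family of morphisms. -/
def homMk (h : DiskData K P Q) {K' : ChainComplex A ℤ} {P' Q' : ℤ → A} (h' : DiskData K' P' Q')
    (a : ∀ n, P n ⟶ P' n) : K ⟶ K' where
  f n := h.fst n ≫ a n ≫ h'.inl n + h.snd n ≫ (h.iso n (n - 1) (by simp)).hom ≫ a (n - 1) ≫
    (h'.iso n (n - 1) (by simp)).inv ≫ h'.inr n
  comm' m n hmn := by
    obtain rfl : n = m - 1 := by simp at hmn; omega
    rw [h.d_eq _ _ (by simp), h'.d_eq _ _ (by simp)]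
    simp

end DiskData

variable [Abelian A]

lemma isFrobeniusFamily_eval :
    IsFrobeniusFamily fun n : ℤ => HomologicalComplex.eval A (ComplexShape.down ℤ) n where
  map_isSES n _ _ _ _ _ h := h.map _
  map_zero _ _ _ := rfl
  faithful h := by
    ext n
    exact h n
  exists_cofree P := by
    obtain ⟨K, Q, ⟨h⟩⟩ := DiskData.exists_right P
    exact ⟨K, Q, _, _, h.isBifree⟩
  exists_free Q := by
    obtain ⟨K, P, ⟨h⟩⟩ := DiskData.exists_left Q
    exact ⟨K, P, _, _, h.isBifree⟩

lemma isSES_of_eval {X Y Z : ChainComplex A ℤ} {f : X ⟶ Y} {g : Y ⟶ Z}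
    (h : ∀ n, IsSES (f.f n) (g.f n)) : IsSES f g :=
  ⟨by ext n; exact (h n).w,
    HomologicalComplex.shortExact_of_degreewise_shortExact _ fun n => (h n).shortExact⟩

lemma DiskData.isSES {K K' K'' : ChainComplex A ℤ} {P Q P' Q' P'' Q'' : ℤ → A}
    (h : DiskData K P Q) (h' : DiskData K' P' Q') (h'' : DiskData K'' P'' Q'')
    {a : ∀ n, P n ⟶ P' n} {b : ∀ n, P' n ⟶ P'' n} (hab : ∀ n, IsSES (a n) (b n)) :
    IsSES (h.homMk h' a) (h'.homMk h'' b) := by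
  refine isSES_of_eval fun n => ?_
  have hQ : IsSES ((h.iso n (n - 1) (by simp)).hom ≫ a (n - 1) ≫ (h'.iso n (n - 1) (by simp)).inv)
      ((h'.iso n (n - 1) (by simp)).hom ≫ b (n - 1) ≫ (h''.iso n (n - 1) (by simp)).inv) :=
    (hab (n - 1)).of_iso (h.iso n (n - 1) (by simp)).symm (h'.iso n (n - 1) (by simp)).symm
      (h''.iso n (n - 1) (by simp)).symm (by simp) (by simp)
  refine ((hab n).biprod_map hQ).of_iso (h.isoX n) (h'.isoX n) (h''.isoX n) ?_ ?_
  · apply biprod.hom_ext' <;> simp [DiskData.isoX, DiskData.homMk]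
  · apply biprod.hom_ext' <;> simp [DiskData.isoX, DiskData.homMk]

/-- Forming disks is exact and sends families of injectives to injective complexes, so it carries
termwise coresolutions of length `m` to a coresolution of `K`. -/
lemma DiskData.idLE {m : ℕ} {K : ChainComplex A ℤ} {P Q : ℤ → A} (h : DiskData K P Q)
    (hP : ∀ n, IdLE m (P n)) : IdLE m K := by
  induction m generalizing K P Q with
  | zero => exact isFrobeniusFamily_eval.injective_of_isBifree h.isBifree hP
  | succ m ih =>
    choose I L i p hs hI hL using hP
    obtain ⟨K', Q', ⟨h'⟩⟩ := DiskData.exists_right I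
    obtain ⟨K'', Q'', ⟨h''⟩⟩ := DiskData.exists_right L
    exact ⟨_, _, _, _, h.isSES h' h'' hs,
      isFrobeniusFamily_eval.injective_of_isBifree h'.isBifree hI, ih h'' hL⟩

lemma DiskData.pdLE {m : ℕ} {K : ChainComplex A ℤ} {P Q : ℤ → A} (h : DiskData K P Q)
    (hP : ∀ n, PdLE m (P n)) : PdLE m K := by
  induction m generalizing K P Q with
  | zero => exact isFrobeniusFamily_eval.projective_of_isBifree h.isBifree hP
  | succ m ih =>
    choose L I i p hs hI hL using hP
    obtain ⟨K', Q', ⟨h'⟩⟩ := DiskData.exists_right I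
    obtain ⟨K'', Q'', ⟨h''⟩⟩ := DiskData.exists_right L
    exact ⟨_, _, _, _, h''.isSES h' h hs,
      isFrobeniusFamily_eval.projective_of_isBifree h'.isBifree hI, ih h'' hL⟩

instance [EnoughProjectives A] : EnoughProjectives (ChainComplex A ℤ) :=
  isFrobeniusFamily_eval.enoughProjectives

instance [EnoughInjectives A] : EnoughInjectives (ChainComplex A ℤ) :=
  isFrobeniusFamily_eval.enoughInjectives

end Complexes

/-! ### The degreewise adjunction on complexes is Sharp–Foxby. -/

section Degreewise

variable {C : Type u} [Category.{v} C] [Abelian C] {S T : C ⥤ C} {adj : S ⊣ T}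

lemma additive_of_adjunction (adj : S ⊣ T) : S.Additive := by
  have := adj.isLeftAdjoint
  have : PreservesColimitsOfSize.{0, 0} S := adj.leftAdjoint_preservesColimits
  have := preservesBinaryBiproducts_of_preservesBinaryCoproducts S
  exact Functor.additive_of_preservesBinaryBiproducts S

lemma FinPd.finGpd [EnoughProjectives C] {M : C} (h : FinPd C M) : FinGpd C M :=
  let ⟨n, hn⟩ := finPd_iff_pdLE.1 h
  ⟨n, hn.gpdLE⟩

lemma FinId.finGid [EnoughInjectives C] {M : C} (h : FinId C M) : FinGid C M :=
  let ⟨n, hn⟩ := finId_iff_idLE.1 h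
  ⟨n, hn.gidLE⟩

lemma finPd_of_projective (P : C) [Projective P] : FinPd C P := finPd_iff.2 ⟨1, inferInstance⟩

lemma finId_of_injective (I : C) [Injective I] : FinId C I := finId_iff.2 ⟨1, inferInstance⟩

lemma IsSharpFoxby.map_left_isSES (hadj : IsSharpFoxby adj) {X Y Z : C} {f : X ⟶ Y} {g : Y ⟶ Z}
    (h : IsSES f g) (hX : FinGpd C X) (hY : FinGpd C Y) (hZ : FinGpd C Z) :
    IsSES (S.map f) (S.map g) :=
  hadj.exact_left _ h.shortExact hX hY hZ

lemma IsSharpFoxby.map_right_isSES (hadj : IsSharpFoxby adj) {X Y Z : C} {f : X ⟶ Y}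
    {g : Y ⟶ Z} (h : IsSES f g) (hX : FinGid C X) (hY : FinGid C Y) (hZ : FinGid C Z) :
    IsSES (T.map f) (T.map g) :=
  hadj.exact_right _ h.shortExact hX hY hZ

lemma FinId.of_isSES₃ {X Y Z : C} {f : X ⟶ Y} {g : Y ⟶ Z} (h : IsSES f g) (hX : FinId C X)
    (hY : FinId C Y) : FinId C Z := by
  obtain ⟨n, hn⟩ := finId_iff.1 hX
  obtain ⟨m, hm⟩ := finId_iff.1 hY
  exact finId_iff.2 ⟨max n m, h.shortExact.hasInjectiveDimensionLT_X₃ _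
    (hasInjectiveDimensionLT_of_ge _ m _ (le_max_right _ _))
    (hasInjectiveDimensionLT_of_ge _ n _ (by omega))⟩

lemma FinPd.of_isSES₁ {X Y Z : C} {f : X ⟶ Y} {g : Y ⟶ Z} (h : IsSES f g) (hY : FinPd C Y)
    (hZ : FinPd C Z) : FinPd C X := by
  obtain ⟨n, hn⟩ := finPd_iff.1 hY
  obtain ⟨m, hm⟩ := finPd_iff.1 hZ
  exact finPd_iff.2 ⟨max n m, h.shortExact.hasProjectiveDimensionLT_X₁ _
    (hasProjectiveDimensionLT_of_ge _ n _ (le_max_left _ _))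
    (hasProjectiveDimensionLT_of_ge _ m _ (by omega))⟩

variable {A : Type u} [Category.{v} A] [Abelian A]

/-- The terms may have dimensions that grow with the degree; the finitistic dimension gives one
bound for all of them. -/
lemma finGpd_complex_iff [EnoughProjectives A] (hf : finitisticProjectiveDimension A < ⊤)
    {X : ChainComplex A ℤ} : FinGpd (ChainComplex A ℤ) X ↔ ∀ n, FinGpd A (X.X n) := by
  constructor
  · rintro ⟨m, hm⟩ n
    exact ⟨m, isFrobeniusFamily_eval.gpdLE_iff.1 hm n⟩
  · intro h
    obtain ⟨m, hm⟩ := exists_pdLE_of_finitistic hf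
    refine ⟨m, isFrobeniusFamily_eval.gpdLE_iff.2 fun n => ?_⟩
    obtain ⟨k, hk⟩ := h n
    exact hk.of_bound fun L hL => hm L (finPd_iff_pdLE.2 ⟨k, hL⟩)

lemma finGid_complex_iff [EnoughInjectives A] (hf : finitisticInjectiveDimension A < ⊤)
    {X : ChainComplex A ℤ} : FinGid (ChainComplex A ℤ) X ↔ ∀ n, FinGid A (X.X n) := by
  constructor
  · rintro ⟨m, hm⟩ n
    exact ⟨m, isFrobeniusFamily_eval.gidLE_iff.1 hm n⟩
  · intro h
    obtain ⟨m, hm⟩ := exists_idLE_of_finitistic hf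
    refine ⟨m, isFrobeniusFamily_eval.gidLE_iff.2 fun n => ?_⟩
    obtain ⟨k, hk⟩ := h n
    exact hk.of_bound fun L hL => hm L (finId_iff_idLE.2 ⟨k, hL⟩)

/-- Unlike `IsFrobeniusFamily.exists_retract`, this retains the disk structure, which additive
functors preserve. -/
lemma exists_retract_diskData_projective [EnoughProjectives A] (X : ChainComplex A ℤ)
    [Projective X] : ∃ (K : ChainComplex A ℤ) (P Q : ℤ → A), Nonempty (Retract X K) ∧
      Nonempty (DiskData K P Q) ∧ ∀ n, Projective (P n) := by
  obtain ⟨K, P, ⟨h⟩⟩ := DiskData.exists_left fun n => Projective.over (X.X n)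
  let e : K ⟶ X := h.desc fun n => Projective.π (X.X n)
  have : Epi e := HomologicalComplex.epi_of_epi_f _ fun n => by
    have : Epi (h.inr n ≫ e.f n) := by rw [h.inr_desc]; infer_instance
    exact CategoryTheory.epi_of_epi (h.inr n) _
  exact ⟨K, P, _, ⟨{ i := Projective.factorThru (𝟙 X) e, r := e }⟩, ⟨h⟩,
    h.isBifree.projective_iff.2 fun n => inferInstance⟩

lemma exists_retract_diskData_injective [EnoughInjectives A] (X : ChainComplex A ℤ)
    [Injective X] : ∃ (K : ChainComplex A ℤ) (P Q : ℤ → A), Nonempty (Retract X K) ∧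
      Nonempty (DiskData K P Q) ∧ ∀ n, Injective (P n) := by
  obtain ⟨K, Q, ⟨h⟩⟩ := DiskData.exists_right fun n => Injective.under (X.X n)
  let e : X ⟶ K := h.lift fun n => Injective.ι (X.X n)
  have : Mono e := HomologicalComplex.mono_of_mono_f _ fun n => by
    have : Mono (e.f n ≫ h.fst n) := by rw [h.lift_fst]; infer_instance
    exact CategoryTheory.mono_of_mono _ (h.fst n)
  exact ⟨K, _, Q, ⟨{ i := e, r := Injective.factorThru (𝟙 X) e }⟩, ⟨h⟩, fun n => inferInstance⟩

lemma isIso_of_isIso_f {X Y : ChainComplex A ℤ} (f : X ⟶ Y) (h : ∀ n, IsIso (f.f n)) : IsIso f :=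
  HomologicalComplex.Hom.isIso_of_components f

theorem IsSharpFoxby.degreewise [EnoughProjectives A] [EnoughInjectives A] {S T : A ⥤ A}
    {adj : S ⊣ T} (hadj : IsSharpFoxby adj) (hp : finitisticProjectiveDimension A < ⊤)
    (hi : finitisticInjectiveDimension A < ⊤) : IsSharpFoxby (degreewiseAdjunction adj) := by
  have := adj.isLeftAdjoint
  have := adj.isRightAdjoint
  have := additive_of_adjunction adj
  have := adj.right_adjoint_additive
  have map_gpd : ∀ X, FinGpd (ChainComplex A ℤ) X →
      FinGid (ChainComplex A ℤ) ((degreewiseLeft adj).obj X) := fun X hX =>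
    (finGid_complex_iff hi).2 fun n => hadj.map_finGpd _ ((finGpd_complex_iff hp).1 hX n)
  have map_gid : ∀ X, FinGid (ChainComplex A ℤ) X →
      FinGpd (ChainComplex A ℤ) ((degreewiseRight adj).obj X) := fun X hX =>
    (finGpd_complex_iff hp).2 fun n => hadj.map_finGid _ ((finGid_complex_iff hi).1 hX n)
  have exact_left : ∀ {X Y Z : ChainComplex A ℤ} {f : X ⟶ Y} {g : Y ⟶ Z}, IsSES f g →
      FinGpd (ChainComplex A ℤ) X → FinGpd (ChainComplex A ℤ) Y → FinGpd (ChainComplex A ℤ) Z →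
      IsSES ((degreewiseLeft adj).map f) ((degreewiseLeft adj).map g) := fun h hX hY hZ =>
    isSES_of_eval fun n => hadj.map_left_isSES (isFrobeniusFamily_eval.map_isSES n h)
      ((finGpd_complex_iff hp).1 hX n) ((finGpd_complex_iff hp).1 hY n)
      ((finGpd_complex_iff hp).1 hZ n)
  have exact_right : ∀ {X Y Z : ChainComplex A ℤ} {f : X ⟶ Y} {g : Y ⟶ Z}, IsSES f g →
      FinGid (ChainComplex A ℤ) X → FinGid (ChainComplex A ℤ) Y → FinGid (ChainComplex A ℤ) Z →
      IsSES ((degreewiseRight adj).map f) ((degreewiseRight adj).map g) := fun h hX hY hZ =>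
    isSES_of_eval fun n => hadj.map_right_isSES (isFrobeniusFamily_eval.map_isSES n h)
      ((finGid_complex_iff hi).1 hX n) ((finGid_complex_iff hi).1 hY n)
      ((finGid_complex_iff hi).1 hZ n)
  -- A complex with projective terms need not have finite projective dimension, so this axiom cannot
  -- be checked degreewise. The image of a disk is the disk on the objects `S.obj (P n)`, whose
  -- injective dimensions have the common bound `m`.
  have map_proj : ∀ X : ChainComplex A ℤ, Projective X →
      FinId (ChainComplex A ℤ) ((degreewiseLeft adj).obj X) := by
    intro X hX
    obtain ⟨K, P, Q, ⟨r⟩, ⟨h⟩, hP⟩ := exists_retract_diskData_projective X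
    obtain ⟨m, hm⟩ := exists_idLE_of_finitistic hi
    have h' : DiskData ((degreewiseLeft adj).obj K) _ _ := h.map S
    have := (h'.idLE fun n => hm _ (hadj.map_finPd _
      (have := hP n; finPd_of_projective (P n)))).hasInjectiveDimensionLT
    exact finId_iff.2 ⟨m + 1, (r.map (degreewiseLeft adj)).hasInjectiveDimensionLT _⟩
  have map_inj : ∀ X : ChainComplex A ℤ, Injective X →
      FinPd (ChainComplex A ℤ) ((degreewiseRight adj).obj X) := by
    intro X hX
    obtain ⟨K, P, Q, ⟨r⟩, ⟨h⟩, hP⟩ := exists_retract_diskData_injective X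
    obtain ⟨m, hm⟩ := exists_pdLE_of_finitistic hp
    have h' : DiskData ((degreewiseRight adj).obj K) _ _ := h.map T
    have := (h'.pdLE fun n => hm _ (hadj.map_finId _
      (have := hP n; finId_of_injective (P n)))).hasProjectiveDimensionLT
    exact finPd_iff.2 ⟨m + 1, (r.map (degreewiseRight adj)).hasProjectiveDimensionLT _⟩
  -- Induction along a projective resolution, whose short exact sequences have terms of finite
  -- Gorenstein projective dimension and so stay exact.
  have map_pd : ∀ (n : ℕ) (X : ChainComplex A ℤ), PdLE n X →
      FinId (ChainComplex A ℤ) ((degreewiseLeft adj).obj X) := by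
    intro n
    induction n with
    | zero => exact fun X hX => map_proj X hX
    | succ n ih =>
      rintro X ⟨K, P, i, p, hs, hP, hK⟩
      exact FinId.of_isSES₃ (exact_left hs ⟨n, hK.gpdLE⟩ (finPd_of_projective P).finGpd
        ⟨n + 1, PdLE.gpdLE ⟨K, P, i, p, hs, hP, hK⟩⟩) (ih K hK) (map_proj P hP)
  have map_id : ∀ (n : ℕ) (X : ChainComplex A ℤ), IdLE n X →
      FinPd (ChainComplex A ℤ) ((degreewiseRight adj).obj X) := by
    intro n
    induction n with
    | zero => exact fun X hX => map_inj X hX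
    | succ n ih =>
      rintro X ⟨I, L, i, p, hs, hI, hL⟩
      exact FinPd.of_isSES₁ (exact_right hs ⟨n + 1, IdLE.gidLE ⟨I, L, i, p, hs, hI, hL⟩⟩
        (finId_of_injective I).finGid ⟨n, hL.gidLE⟩) (map_inj I hI) (ih L hL)
  exact
    { map_finGpd := map_gpd
      map_finPd := fun X hX => let ⟨n, hn⟩ := finPd_iff_pdLE.1 hX; map_pd n X hn
      exact_left := fun X hX h₁ h₂ h₃ => exact_left hX.isSES h₁ h₂ h₃
      map_finGid := map_gid
      map_finId := fun X hX => let ⟨n, hn⟩ := finId_iff_idLE.1 hX; map_id n X hn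
      exact_right := fun X hX h₁ h₂ h₃ => exact_right hX.isSES h₁ h₂ h₃
      isIso_unit := fun X hX => isIso_of_isIso_f _ fun n =>
        hadj.isIso_unit _ ((finGpd_complex_iff hp).1 hX n)
      isIso_counit := fun X hX => isIso_of_isIso_f _ fun n =>
        hadj.isIso_counit _ ((finGid_complex_iff hi).1 hX n) }

end Degreewise

/-! ## Extension groups and maps modulo injective or projective objects -/

section ExtGroups

open Abelian

variable {C : Type u} [Category.{v} C] [Abelian C] [HasExt.{w} C]

namespace IsSES

variable {X Y Z : C} {f : X ⟶ Y} {g : Y ⟶ Z}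

/-- The class of a short exact sequence. -/
def ext (h : IsSES f g) : Ext.{w} Z X 1 := h.shortExact.extClass

lemma mk₀_ext (h : IsSES f g) : (Ext.mk₀ g).comp h.ext (zero_add 1) = 0 :=
  h.shortExact.comp_extClass

lemma ext_mk₀_assoc (h : IsSES f g) {W : C} {n n' : ℕ} (x : Ext.{w} Y W n) (hn : 1 + n = n') :
    h.ext.comp ((Ext.mk₀ f).comp x (zero_add n)) hn = 0 :=
  h.shortExact.extClass_comp_assoc x

lemma mk₀_mk₀_assoc (h : IsSES f g) {W : C} {n : ℕ} (x : Ext.{w} Z W n) :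
    (Ext.mk₀ f).comp ((Ext.mk₀ g).comp x (zero_add n)) (zero_add n) = 0 := by
  rw [Ext.mk₀_comp_mk₀_assoc, h.w, Ext.mk₀_zero, Ext.zero_comp]

lemma co_exact₁ (h : IsSES f g) {W : C} {n m : ℕ} (x : Ext.{w} W X m)
    (hx : x.comp (Ext.mk₀ f) (add_zero m) = 0) (hn : n + 1 = m) :
    ∃ y : Ext.{w} W Z n, y.comp h.ext hn = x :=
  Ext.covariant_sequence_exact₁ W h.shortExact x hx hn

lemma co_exact₂ (h : IsSES f g) {W : C} {n : ℕ} (x : Ext.{w} W Y n)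
    (hx : x.comp (Ext.mk₀ g) (add_zero n) = 0) :
    ∃ y : Ext.{w} W X n, y.comp (Ext.mk₀ f) (add_zero n) = x :=
  Ext.covariant_sequence_exact₂ W h.shortExact x hx

lemma co_exact₃ (h : IsSES f g) {W : C} {n m : ℕ} (x : Ext.{w} W Z n) (hn : n + 1 = m)
    (hx : x.comp h.ext hn = 0) :
    ∃ y : Ext.{w} W Y n, y.comp (Ext.mk₀ g) (add_zero n) = x :=
  Ext.covariant_sequence_exact₃ W h.shortExact x hn hx

lemma contra_exact₁ (h : IsSES f g) {W : C} {n m : ℕ} (x : Ext.{w} X W n) (hn : 1 + n = m)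
    (hx : h.ext.comp x hn = 0) :
    ∃ y : Ext.{w} Y W n, (Ext.mk₀ f).comp y (zero_add n) = x :=
  Ext.contravariant_sequence_exact₁ h.shortExact W x hn hx

lemma contra_exact₂ (h : IsSES f g) {W : C} {n : ℕ} (x : Ext.{w} Y W n)
    (hx : (Ext.mk₀ f).comp x (zero_add n) = 0) :
    ∃ y : Ext.{w} Z W n, (Ext.mk₀ g).comp y (zero_add n) = x :=
  Ext.contravariant_sequence_exact₂ h.shortExact W x hx

lemma contra_exact₃ (h : IsSES f g) {W : C} {n m : ℕ} (x : Ext.{w} Z W m)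
    (hx : (Ext.mk₀ g).comp x (zero_add m) = 0) (hn : 1 + n = m) :
    ∃ y : Ext.{w} X W n, h.ext.comp y hn = x :=
  Ext.contravariant_sequence_exact₃ h.shortExact W x hx hn

lemma ext_naturality (h : IsSES f g) {X' Y' Z' : C} {f' : X' ⟶ Y'} {g' : Y' ⟶ Z'}
    (h' : IsSES f' g') {a : X ⟶ X'} {b : Y ⟶ Y'} {c : Z ⟶ Z'} (hab : a ≫ f' = f ≫ b)
    (hbc : b ≫ g' = g ≫ c) :
    h.ext.{v, u, w}.comp (Ext.mk₀ a) (add_zero 1) = (Ext.mk₀ c).comp h'.ext (zero_add 1) :=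
  ShortComplex.ShortExact.extClass_naturality h.shortExact h'.shortExact
    (ShortComplex.homMk (S₁ := ShortComplex.mk f g h.w) (S₂ := ShortComplex.mk f' g' h'.w)
      a b c hab hbc)

end IsSES

lemma exists_mk₀ {X Y : C} (x : Ext.{w} X Y 0) : ∃ f : X ⟶ Y, Ext.mk₀ f = x :=
  (Ext.mk₀_bijective X Y).2 x

/-- In degree one this is the lifting property of an injective step out of `H`; higher degrees shift
along such steps. -/
lemma GInj.ext_eq_zero_of_injective {H J : C} (hH : GInj C H) [Injective J] {n : ℕ}
    (x : Ext.{w} J H (n + 1)) : x = 0 := by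
  induction n generalizing H with
  | zero =>
    obtain ⟨H', hH', I, i, p, h⟩ := hH.exists_right
    have := h.injective
    obtain ⟨y, rfl⟩ := h.ses.co_exact₁ x (Ext.eq_zero_of_injective _) (n := 0) rfl
    obtain ⟨y, rfl⟩ := exists_mk₀ y
    obtain ⟨z, rfl⟩ := h.exists_lift J inferInstance y
    rw [← Ext.mk₀_comp_mk₀, Ext.comp_assoc_of_second_deg_zero, h.ses.mk₀_ext, Ext.comp_zero]
  | succ n ih =>
    obtain ⟨H', hH', I, i, p, h⟩ := hH.exists_right
    have := h.injective
    obtain ⟨y, rfl⟩ := h.ses.co_exact₁ x (Ext.eq_zero_of_injective _) (n := n + 1) rfl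
    rw [ih hH' y, Ext.zero_comp]

lemma GInj.ext_eq_zero [EnoughInjectives C] {H L : C} (hH : GInj C H) (hL : FinId C L) {n : ℕ}
    (x : Ext.{w} L H (n + 1)) : x = 0 := by
  obtain ⟨m, hm⟩ := finId_iff_idLE.1 hL
  clear hL
  induction m generalizing L n with
  | zero =>
    have : Injective L := hm
    exact hH.ext_eq_zero_of_injective x
  | succ m ih =>
    obtain ⟨J, L', i, p, h, hJ, hL'⟩ := hm
    obtain ⟨y, rfl⟩ := h.contra_exact₁ x (Nat.add_comm _ _) (ih _ hL')
    rw [hH.ext_eq_zero_of_injective y, Ext.comp_zero]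

lemma GProj.ext_eq_zero_of_projective {G P : C} (hG : GProj C G) [Projective P] {n : ℕ}
    (x : Ext.{w} G P (n + 1)) : x = 0 := by
  induction n generalizing G with
  | zero =>
    obtain ⟨G', hG', Q, i, p, h⟩ := hG.exists_left
    have := h.projective
    obtain ⟨y, rfl⟩ := h.ses.contra_exact₃ x (Ext.eq_zero_of_projective _) (n := 0) rfl
    obtain ⟨y, rfl⟩ := exists_mk₀ y
    obtain ⟨z, rfl⟩ := h.exists_ext P inferInstance y
    rw [← Ext.mk₀_comp_mk₀, h.ses.ext_mk₀_assoc]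
  | succ n ih =>
    obtain ⟨G', hG', Q, i, p, h⟩ := hG.exists_left
    have := h.projective
    obtain ⟨y, rfl⟩ := h.ses.contra_exact₃ x (Ext.eq_zero_of_projective _) (n := n + 1)
      (Nat.add_comm _ _)
    rw [ih hG' y, Ext.comp_zero]

lemma GProj.ext_eq_zero [EnoughProjectives C] {G L : C} (hG : GProj C G) (hL : FinPd C L) {n : ℕ}
    (x : Ext.{w} G L (n + 1)) : x = 0 := by
  obtain ⟨m, hm⟩ := finPd_iff_pdLE.1 hL
  clear hL
  induction m generalizing L n with
  | zero =>
    have : Projective L := hm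
    exact hG.ext_eq_zero_of_projective x
  | succ m ih =>
    obtain ⟨K, P, i, p, h, hP, hK⟩ := hm
    obtain ⟨y, rfl⟩ := h.co_exact₃ x rfl (ih _ hK)
    rw [hG.ext_eq_zero_of_projective y, Ext.zero_comp]

end ExtGroups

/-! ### Morphisms that factor through injective or projective objects. -/

section Factor

variable {C : Type u} [Category.{v} C]

/-- The morphism `f` factors through an injective object. -/
def FacInj {X Y : C} (f : X ⟶ Y) : Prop :=
  ∃ (J : C) (a : X ⟶ J) (b : J ⟶ Y), Injective J ∧ f = a ≫ b

/-- The morphism `f` factors through a projective object. -/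
def FacProj {X Y : C} (f : X ⟶ Y) : Prop :=
  ∃ (P : C) (a : X ⟶ P) (b : P ⟶ Y), Projective P ∧ f = a ≫ b

variable {X Y Z : C}

lemma FacInj.comp_left {f : X ⟶ Y} (h : FacInj f) (g : Z ⟶ X) : FacInj (g ≫ f) := by
  obtain ⟨J, a, b, hJ, rfl⟩ := h
  exact ⟨J, g ≫ a, b, hJ, by simp⟩

lemma FacInj.comp_right {f : X ⟶ Y} (h : FacInj f) (g : Y ⟶ Z) : FacInj (f ≫ g) := by
  obtain ⟨J, a, b, hJ, rfl⟩ := h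
  exact ⟨J, a, b ≫ g, hJ, by simp⟩

lemma FacProj.comp_left {f : X ⟶ Y} (h : FacProj f) (g : Z ⟶ X) : FacProj (g ≫ f) := by
  obtain ⟨J, a, b, hJ, rfl⟩ := h
  exact ⟨J, g ≫ a, b, hJ, by simp⟩

lemma FacProj.comp_right {f : X ⟶ Y} (h : FacProj f) (g : Y ⟶ Z) : FacProj (f ≫ g) := by
  obtain ⟨J, a, b, hJ, rfl⟩ := h
  exact ⟨J, a, b ≫ g, hJ, by simp⟩

variable [Abelian C]

lemma FacInj.zero : FacInj (0 : X ⟶ Y) := ⟨0, 0, 0, inferInstance, by simp⟩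

lemma FacInj.neg {f : X ⟶ Y} (h : FacInj f) : FacInj (-f) := by
  obtain ⟨J, a, b, hJ, rfl⟩ := h
  exact ⟨J, a, -b, hJ, by simp⟩

lemma FacInj.add {f g : X ⟶ Y} (hf : FacInj f) (hg : FacInj g) : FacInj (f + g) := by
  obtain ⟨J, a, b, hJ, rfl⟩ := hf
  obtain ⟨J', a', b', hJ', rfl⟩ := hg
  exact ⟨J ⊞ J', biprod.lift a a', biprod.desc b b', inferInstance, by simp⟩

lemma FacProj.zero : FacProj (0 : X ⟶ Y) := ⟨0, 0, 0, inferInstance, by simp⟩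

lemma FacProj.neg {f : X ⟶ Y} (h : FacProj f) : FacProj (-f) := by
  obtain ⟨J, a, b, hJ, rfl⟩ := h
  exact ⟨J, a, -b, hJ, by simp⟩

lemma FacProj.add {f g : X ⟶ Y} (hf : FacProj f) (hg : FacProj g) : FacProj (f + g) := by
  obtain ⟨J, a, b, hJ, rfl⟩ := hf
  obtain ⟨J', a', b', hJ', rfl⟩ := hg
  exact ⟨J ⊞ J', biprod.lift a a', biprod.desc b b', inferInstance, by simp⟩

end Factor

/-! ### Morphisms that positive Ext into Gorenstein injectives does not distinguish from
isomorphisms. -/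

section WeakEquiv

open Abelian

variable {C : Type u} [Category.{v} C] [Abelian C] [HasExt.{w} C]

/-- `f` induces isomorphisms on extensions by Gorenstein injective objects in positive degrees. -/
def IsExtIso {Y Y' : C} (f : Y ⟶ Y') : Prop :=
  ∀ H : C, GInj C H → ∀ n : ℕ, Function.Bijective fun x : Ext.{w} Y' H (n + 1) =>
    (Ext.mk₀ f).comp x (zero_add (n + 1))

lemma precomp_injective {Y Y' H : C} {f : Y ⟶ Y'} {n : ℕ}
    (h : ∀ x : Ext.{w} Y' H n, (Ext.mk₀ f).comp x (zero_add n) = 0 → x = 0) :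
    Function.Injective fun x : Ext.{w} Y' H n => (Ext.mk₀ f).comp x (zero_add n) :=
  (injective_iff_map_eq_zero ((Ext.mk₀ f).precomp H (zero_add n))).2 h

lemma IsExtIso.eq_zero {Y Y' H : C} {f : Y ⟶ Y'} (hf : IsExtIso.{v, u, w} f) (hH : GInj C H) {n : ℕ}
    {x : Ext.{w} Y' H (n + 1)} (hx : (Ext.mk₀ f).comp x (zero_add (n + 1)) = 0) : x = 0 :=
  (hf H hH n).1 (by simpa using hx)

lemma IsExtIso.comp {Y Y' Y'' : C} {f : Y ⟶ Y'} {g : Y' ⟶ Y''} (hf : IsExtIso.{v, u, w} f)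
    (hg : IsExtIso.{v, u, w} g) : IsExtIso.{v, u, w} (f ≫ g) := fun H hH n => by
  simpa [Function.comp_def] using (hf H hH n).comp (hg H hH n)

lemma IsExtIso.of_comp {Y Y' Y'' : C} {f : Y ⟶ Y'} {g : Y' ⟶ Y''} (hf : IsExtIso.{v, u, w} f)
    (hfg : IsExtIso.{v, u, w} (f ≫ g)) : IsExtIso.{v, u, w} g := fun H hH n => by
  refine (Function.Bijective.of_comp_iff' (hf H hH n) _).1 ?_
  simpa [Function.comp_def] using hfg H hH n

/-- By dimension shift, it suffices to check large degrees. -/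
lemma isExtIso_of_succ {Y Y' : C} {f : Y ⟶ Y'} (hf : ∀ H : C, GInj C H → ∀ n : ℕ,
    Function.Bijective fun x : Ext.{w} Y' H (n + 2) => (Ext.mk₀ f).comp x (zero_add (n + 2))) :
    IsExtIso.{v, u, w} f := by
  intro H hH n
  -- As `I` is injective, the connecting map identifies Ext in degree `n + 1` with values in `H` and
  -- Ext in degree `n + 2` with values in `H₀`.
  obtain ⟨H₀, hH₀, I, i, p, h⟩ := hH.exists_left
  have := h.injective
  have inj : ∀ {W : C} (x : Ext.{w} W H (n + 1)), x.comp h.ses.ext rfl = 0 → x = 0 := by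
    intro W x hx
    obtain ⟨y, rfl⟩ := h.ses.co_exact₃ x rfl hx
    rw [Ext.eq_zero_of_injective y, Ext.zero_comp]
  have surj : ∀ {W : C} (x : Ext.{w} W H₀ (n + 2)), ∃ y : Ext.{w} W H (n + 1),
      y.comp h.ses.ext rfl = x := fun x => h.ses.co_exact₁ x (Ext.eq_zero_of_injective _) rfl
  have key := hf H₀ hH₀ n
  constructor
  · refine precomp_injective fun x hx => inj x (key.1 ?_)
    have := congrArg (fun y => y.comp h.ses.ext (rfl : n + 1 + 1 = n + 2)) hx
    simp only [Ext.zero_comp] at this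
    rw [Ext.comp_assoc _ _ _ (zero_add _) rfl (by omega)] at this
    simpa using this
  · intro x
    obtain ⟨y, hy⟩ := key.2 (x.comp h.ses.ext rfl)
    obtain ⟨z, rfl⟩ := surj y
    refine ⟨z, sub_eq_zero.1 (inj _ ?_)⟩
    rw [sub_eq_add_neg, Ext.add_comp, Ext.neg_comp, ← hy, ← sub_eq_add_neg, sub_eq_zero]
    exact Ext.comp_assoc _ _ _ (zero_add _) rfl (by omega)

lemma isExtIso_of_mono [EnoughInjectives C] {Y Y' L : C} {f : Y ⟶ Y'} {g : Y' ⟶ L}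
    (h : IsSES f g) (hL : FinId C L) : IsExtIso.{v, u, w} f := by
  intro H hH n
  constructor
  · refine precomp_injective fun x hx => ?_
    obtain ⟨y, rfl⟩ := h.contra_exact₂ x hx
    rw [hH.ext_eq_zero hL y, Ext.comp_zero]
  · intro x
    exact h.contra_exact₁ x (Nat.add_comm _ _) (hH.ext_eq_zero hL _)

/-- In degree one the long exact sequence involves Hom(L, H), which need not vanish. From degree two
on only positive Ext of `L` occurs, whence `isExtIso_of_succ`. -/
lemma isExtIso_of_epi [EnoughInjectives C] {L Y Y' : C} {f : L ⟶ Y} {g : Y ⟶ Y'}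
    (h : IsSES f g) (hL : FinId C L) : IsExtIso.{v, u, w} g := by
  refine isExtIso_of_succ fun H hH n => ⟨?_, ?_⟩
  · refine precomp_injective fun x hx => ?_
    obtain ⟨y, rfl⟩ := h.contra_exact₃ x hx (n := n + 1) (by omega)
    rw [hH.ext_eq_zero hL y, Ext.comp_zero]
  · intro x
    exact h.contra_exact₂ x (hH.ext_eq_zero hL _)

/-- The five lemma for the third terms of short exact sequences. -/
lemma IsExtIso.third {X Y Z X' Y' Z' : C} {f : X ⟶ Y} {g : Y ⟶ Z} {f' : X' ⟶ Y'} {g' : Y' ⟶ Z'}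
    (h : IsSES f g) (h' : IsSES f' g') {a : X ⟶ X'} {b : Y ⟶ Y'} {c : Z ⟶ Z'}
    (hab : a ≫ f' = f ≫ b) (hbc : b ≫ g' = g ≫ c) (ha : IsExtIso.{v, u, w} a)
    (hb : IsExtIso.{v, u, w} b) :
    IsExtIso.{v, u, w} c := by
  have nat : ∀ {H : C} {n m : ℕ} (hn : 1 + n = m) (y : Ext.{w} X' H n),
      (Ext.mk₀ c).comp (h'.ext.comp y hn) (zero_add m) =
        h.ext.comp ((Ext.mk₀ a).comp y (zero_add n)) hn := by
    intro H n m hn y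
    rw [← Ext.comp_assoc _ _ _ (zero_add 1) hn (by omega), ← h.ext_naturality h' hab hbc,
      Ext.comp_assoc_of_second_deg_zero]
  -- The diagram chase also uses the degree below, which is positive only after this shift.
  refine isExtIso_of_succ fun H hH n => ⟨?_, ?_⟩
  · refine precomp_injective fun x hx => ?_
    obtain ⟨y, rfl⟩ := h'.contra_exact₃ x (hb.eq_zero hH (by
      rw [Ext.mk₀_comp_mk₀_assoc, hbc, ← Ext.mk₀_comp_mk₀_assoc, hx, Ext.comp_zero]))
      (n := n + 1) (by omega)
    rw [nat] at hx
    obtain ⟨z, hz⟩ := h.contra_exact₁ _ _ hx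
    obtain ⟨z, rfl⟩ := (hb H hH n).2 z
    rw [Ext.mk₀_comp_mk₀_assoc, ← hab, ← Ext.mk₀_comp_mk₀_assoc] at hz
    rw [← (ha H hH n).1 hz, h'.ext_mk₀_assoc]
  · intro x
    obtain ⟨u, hu⟩ := (hb H hH (n + 1)).2 ((Ext.mk₀ g).comp x (zero_add _))
    dsimp only at hu
    obtain ⟨t, rfl⟩ := h'.contra_exact₂ u (ha.eq_zero hH (by
      rw [Ext.mk₀_comp_mk₀_assoc, hab, ← Ext.mk₀_comp_mk₀_assoc, hu, h.mk₀_mk₀_assoc]))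
    rw [Ext.mk₀_comp_mk₀_assoc, hbc, ← Ext.mk₀_comp_mk₀_assoc] at hu
    obtain ⟨y, hy⟩ := h.contra_exact₃ (x - (Ext.mk₀ c).comp t (zero_add _)) (by
      rw [sub_eq_add_neg, Ext.comp_add, Ext.comp_neg, hu, add_neg_cancel]) (n := n + 1) (by omega)
    obtain ⟨y, rfl⟩ := (ha H hH n).2 y
    refine ⟨t + h'.ext.comp y (by omega), ?_⟩
    dsimp only
    rw [Ext.comp_add, nat, hy]
    abel

/-- A map to `H` that factors through an injective already factors through `p`, by the lifting
property of the step. So the pullback of the extension class detects morphisms modulo injectives. -/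
lemma facInj_iff {Y H₀ I H : C} {i : H₀ ⟶ I} {p : I ⟶ H} (h : IsInjStep i p) (f : Y ⟶ H) :
    FacInj f ↔ (Ext.mk₀ f).comp h.ses.ext.{v, u, w} (zero_add 1) = 0 := by
  have := h.injective
  constructor
  · rintro ⟨J, a, b, hJ, rfl⟩
    obtain ⟨c, rfl⟩ := h.exists_lift J hJ b
    rw [← Category.assoc, ← Ext.mk₀_comp_mk₀, Ext.comp_assoc_of_second_deg_zero, h.ses.mk₀_ext,
      Ext.comp_zero]
  · intro hf
    obtain ⟨y, hy⟩ := h.ses.co_exact₃ _ _ hf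
    obtain ⟨y, rfl⟩ := exists_mk₀ y
    rw [Ext.mk₀_comp_mk₀] at hy
    exact ⟨I, y, p, inferInstance, ((Ext.mk₀_bijective _ _).1 hy).symm⟩

lemma facProj_iff {G P G₁ X : C} {i : G ⟶ P} {p : P ⟶ G₁} (h : IsProjStep i p) (f : G ⟶ X) :
    FacProj f ↔ h.ses.ext.{v, u, w}.comp (Ext.mk₀ f) (add_zero 1) = 0 := by
  have := h.projective
  constructor
  · rintro ⟨J, a, b, hJ, rfl⟩
    obtain ⟨c, rfl⟩ := h.exists_ext J hJ a
    rw [Category.assoc, ← Ext.mk₀_comp_mk₀, h.ses.ext_mk₀_assoc]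
  · intro hf
    obtain ⟨y, hy⟩ := h.ses.contra_exact₁ _ _ hf
    obtain ⟨y, rfl⟩ := exists_mk₀ y
    rw [Ext.mk₀_comp_mk₀] at hy
    exact ⟨P, i, y, inferInstance, ((Ext.mk₀_bijective _ _).1 hy).symm⟩

/-- Together with `IsExtIso.facInj`: precomposition with `f` is bijective on maps into `H` modulo
injectives, since these are first Ext groups with values in `H₀`. -/
lemma IsExtIso.exists_facInj {Y Y' H : C} {f : Y ⟶ Y'} (hf : IsExtIso.{v, u, w} f) (hH : GInj C H)
    (g : Y ⟶ H) : ∃ k : Y' ⟶ H, FacInj (f ≫ k - g) := by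
  obtain ⟨H₀, hH₀, I, i, p, h⟩ := hH.exists_left
  have := h.injective
  obtain ⟨x, hx⟩ := (hf H₀ hH₀ 0).2 ((Ext.mk₀ g).comp h.ses.ext (zero_add 1))
  obtain ⟨y, rfl⟩ := h.ses.co_exact₁ x (Ext.eq_zero_of_injective _) (n := 0) rfl
  obtain ⟨k, rfl⟩ := exists_mk₀ y
  refine ⟨k, (facInj_iff.{v, u, w} h _).2 ?_⟩
  rw [sub_eq_add_neg, Ext.mk₀_add, Ext.mk₀_neg, Ext.add_comp, Ext.neg_comp, ← hx,
    ← Ext.mk₀_comp_mk₀, Ext.comp_assoc_of_second_deg_zero]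
  exact add_neg_cancel _

lemma IsExtIso.facInj {Y Y' H : C} {f : Y ⟶ Y'} (hf : IsExtIso.{v, u, w} f) (hH : GInj C H)
    {g : Y' ⟶ H} (hg : FacInj (f ≫ g)) : FacInj g := by
  obtain ⟨H₀, hH₀, I, i, p, h⟩ := hH.exists_left
  rw [facInj_iff.{v, u, w} h] at hg ⊢
  rw [← Ext.mk₀_comp_mk₀, Ext.comp_assoc_of_second_deg_zero] at hg
  exact hf.eq_zero hH₀ hg

end WeakEquiv

/-! ### Consequences for objects of finite injective or projective dimension, in statements free of
Ext. -/

section Finite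

open Abelian

variable {C : Type u} [Category.{v} C] [Abelian C]

lemma exists_ext_of_finId [EnoughInjectives C] {Y Y' L H : C} {f : Y ⟶ Y'} {g : Y' ⟶ L}
    (h : IsSES f g) (hL : FinId C L) (hH : GInj C H) (k : Y ⟶ H) : ∃ k' : Y' ⟶ H, f ≫ k' = k := by
  have := HasExt.standard C
  obtain ⟨y, hy⟩ := h.contra_exact₁ (Ext.mk₀ k) rfl (hH.ext_eq_zero hL _)
  obtain ⟨y, rfl⟩ := exists_mk₀ y
  rw [Ext.mk₀_comp_mk₀] at hy
  exact ⟨y, (Ext.mk₀_bijective _ _).1 hy⟩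

lemma facInj_of_finId [EnoughInjectives C] {L H : C} (hL : FinId C L) (hH : GInj C H)
    (f : L ⟶ H) : FacInj f := by
  have := HasExt.standard C
  obtain ⟨H₀, hH₀, I, i, p, h⟩ := hH.exists_left
  exact (facInj_iff h f).2 (hH₀.ext_eq_zero hL _)

lemma facProj_of_finPd [EnoughProjectives C] {L G : C} (hL : FinPd C L) (hG : GProj C G)
    (f : G ⟶ L) : FacProj f := by
  have := HasExt.standard C
  obtain ⟨H₀, hH₀, I, i, p, h⟩ := hG.exists_right
  exact (facProj_iff h f).2 (hH₀.ext_eq_zero hL _)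

/-- With `facProj_of_comp`, postcomposition with a monomorphism whose cokernel has finite projective
dimension is bijective on maps out of `G` modulo projectives. -/
lemma exists_facProj [EnoughProjectives C] {X X' N G : C} {w : X ⟶ X'} {q : X' ⟶ N}
    (hw : IsSES w q) (hN : FinPd C N) (hG : GProj C G) (f : G ⟶ X') :
    ∃ g : G ⟶ X, FacProj (g ≫ w - f) := by
  have := HasExt.standard C
  obtain ⟨G₁, hG₁, P, i, p, h⟩ := hG.exists_right
  have := h.projective
  obtain ⟨x, hx⟩ := hw.co_exact₂ (h.ses.ext.comp (Ext.mk₀ f) (add_zero 1)) (hG₁.ext_eq_zero hN _)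
  obtain ⟨y, rfl⟩ := h.ses.contra_exact₃ x (Ext.eq_zero_of_projective _) (n := 0) rfl
  obtain ⟨g, rfl⟩ := exists_mk₀ y
  refine ⟨g, (facProj_iff h _).2 ?_⟩
  rw [sub_eq_add_neg, Ext.mk₀_add, Ext.mk₀_neg, Ext.comp_add, Ext.comp_neg, ← hx,
    ← Ext.mk₀_comp_mk₀, Ext.comp_assoc_of_third_deg_zero]
  exact add_neg_cancel _

lemma facProj_of_comp [EnoughProjectives C] {X X' N G : C} {w : X ⟶ X'} {q : X' ⟶ N}
    (hw : IsSES w q) (hN : FinPd C N) (hG : GProj C G) {g : G ⟶ X} (hg : FacProj (g ≫ w)) :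
    FacProj g := by
  have := HasExt.standard C
  obtain ⟨G₁, hG₁, P, i, p, h⟩ := hG.exists_right
  -- One step would leave the obstruction in Hom(G₁, N), which need not vanish. A second step moves
  -- it to Ext¹(G₂, N), which is zero.
  obtain ⟨G₂, hG₂, P', i', p', h'⟩ := hG₁.exists_right
  have := h'.projective
  rw [facProj_iff h] at hg ⊢
  rw [← Ext.mk₀_comp_mk₀, ← Ext.comp_assoc_of_third_deg_zero] at hg
  obtain ⟨y, hy⟩ := hw.co_exact₁ (h'.ses.ext.comp (h.ses.ext.comp (Ext.mk₀ g) (add_zero 1))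
    (rfl : 1 + 1 = 2)) (by rw [Ext.comp_assoc_of_third_deg_zero, hg, Ext.comp_zero]) (n := 1) rfl
  rw [hG₂.ext_eq_zero hN y, Ext.zero_comp] at hy
  obtain ⟨z, hz⟩ := h'.ses.contra_exact₁ _ _ hy.symm
  rw [← hz, Ext.eq_zero_of_projective z, Ext.comp_zero]

end Finite

/-! ## Morphisms in the stable categories -/

section StableHom

variable {C : Type u} [Category.{v} C] [Abelian C]

/-- Relative injectivity splits the embedding of `P` in a projective with Gorenstein projective
cokernel. The stable relation thus becomes factoring through a projective of the ambient category.
-/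
lemma IsProInjective.projective_of_gproj {P : C} (h : IsProInjective (GProj C) P) :
    Projective P := by
  obtain ⟨G', hG', Q, i, p, hs⟩ := h.prop.exists_right
  have := hs.projective
  obtain ⟨r, hr⟩ := h.injective (ShortComplex.mk i p hs.ses.w)
    ⟨hs.ses.shortExact, h.prop, gproj_of_projective Q, hG'⟩ (𝟙 P)
  exact ({ i := i, r := r, retract := hr } : Retract P Q).projective

lemma IsProInjective.injective_of_ginj {P : C} (h : IsProInjective (GInj C) P) :
    Injective P := by
  obtain ⟨G', hG', Q, i, p, hs⟩ := h.prop.exists_left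
  have := hs.injective
  obtain ⟨r, hr⟩ := h.projective (ShortComplex.mk i p hs.ses.w)
    ⟨hs.ses.shortExact, hG', ginj_of_injective Q, h.prop⟩ (𝟙 P)
  exact ({ i := r, r := p, retract := hr } : Retract P Q).injective

lemma stableRel_gproj_iff {X Y : (GProj C).FullSubcategory} (f g : X ⟶ Y) :
    stableRel (GProj C) f g ↔ FacProj (f.hom - g.hom) :=
  ⟨fun ⟨P, a, b, hP, h⟩ => ⟨P, a, b, hP.projective_of_gproj, h⟩,
    fun ⟨P, a, b, _, h⟩ => ⟨P, a, b, isProInjective_GProj P, h⟩⟩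

lemma stableRel_ginj_iff {X Y : (GInj C).FullSubcategory} (f g : X ⟶ Y) :
    stableRel (GInj C) f g ↔ FacInj (f.hom - g.hom) :=
  ⟨fun ⟨P, a, b, hP, h⟩ => ⟨P, a, b, hP.injective_of_ginj, h⟩,
    fun ⟨P, a, b, _, h⟩ => ⟨P, a, b, isProInjective_GInj P, h⟩⟩

instance : Congruence (stableRel (GProj C)) where
  equivalence :=
    { refl f := (stableRel_gproj_iff f f).2 (by simpa using FacProj.zero)
      symm {f g} h := (stableRel_gproj_iff g f).2 (by
        simpa using ((stableRel_gproj_iff f g).1 h).neg)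
      trans {f g k} h h' := (stableRel_gproj_iff f k).2 (by
        simpa using ((stableRel_gproj_iff f g).1 h).add ((stableRel_gproj_iff g k).1 h')) }
  comp_left := fun {_ _ _} f {g g'} h => (stableRel_gproj_iff _ _).2 (by
    simpa using ((stableRel_gproj_iff g g').1 h).comp_left f.hom)
  comp_right := fun {_ _ _} {f f'} g h => (stableRel_gproj_iff _ _).2 (by
    simpa using ((stableRel_gproj_iff f f').1 h).comp_right g.hom)

instance : Congruence (stableRel (GInj C)) where
  equivalence :=
    { refl f := (stableRel_ginj_iff f f).2 (by simpa using FacInj.zero)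
      symm {f g} h := (stableRel_ginj_iff g f).2 (by
        simpa using ((stableRel_ginj_iff f g).1 h).neg)
      trans {f g k} h h' := (stableRel_ginj_iff f k).2 (by
        simpa using ((stableRel_ginj_iff f g).1 h).add ((stableRel_ginj_iff g k).1 h')) }
  comp_left := fun {_ _ _} f {g g'} h => (stableRel_ginj_iff _ _).2 (by
    simpa using ((stableRel_ginj_iff g g').1 h).comp_left f.hom)
  comp_right := fun {_ _ _} {f f'} g h => (stableRel_ginj_iff _ _).2 (by
    simpa using ((stableRel_ginj_iff f f').1 h).comp_right g.hom)

lemma toStable_gproj_eq_iff {X Y : (GProj C).FullSubcategory} {f g : X ⟶ Y} :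
    (toStable _).map f = (toStable _).map g ↔ FacProj (f.hom - g.hom) :=
  (Quotient.functor_map_eq_iff _ f g).trans (stableRel_gproj_iff f g)

lemma toStable_ginj_eq_iff {X Y : (GInj C).FullSubcategory} {f g : X ⟶ Y} :
    (toStable _).map f = (toStable _).map g ↔ FacInj (f.hom - g.hom) :=
  (Quotient.functor_map_eq_iff _ f g).trans (stableRel_ginj_iff f g)

lemma isIso_toStable_of_isExtIso [HasExt.{w} C] {H H' : (GInj C).FullSubcategory} (k : H ⟶ H')
    (hk : IsExtIso.{v, u, w} k.hom) : IsIso ((toStable _).map k) := by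
  obtain ⟨r, hr⟩ := hk.exists_facInj H.property (𝟙 H.obj)
  have hr' : FacInj (r ≫ k.hom - 𝟙 H'.obj) := by
    refine hk.facInj H'.property ?_
    simpa using hr.comp_right k.hom
  refine ⟨(toStable _).map (ObjectProperty.homMk r), ?_, ?_⟩
  · rw [← Functor.map_comp]
    exact (toStable_ginj_eq_iff.2 hr).trans (CategoryTheory.Functor.map_id _ _)
  · rw [← Functor.map_comp]
    exact (toStable_ginj_eq_iff.2 hr').trans (CategoryTheory.Functor.map_id _ _)

lemma GProj.finGpd {G : C} (hG : GProj C G) : FinGpd C G := ⟨0, hG⟩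

lemma GInj.finGid {H : C} (hH : GInj C H) : FinGid C H := ⟨0, hH⟩

end StableHom

/-! ## The equivalence of stable categories -/

namespace IsSharpFoxby

variable {C : Type u} [Category.{v} C] [Abelian C]
  {S T : C ⥤ C} {adj : S ⊣ T} (hadj : IsSharpFoxby adj)

/-- `S` sends projectives to objects of finite injective dimension, whose maps to Gorenstein
injectives factor through injectives. The next two lemmas show in this way that the adjunction
bijection respects the two kinds of factorization. -/
lemma facInj_map_comp [EnoughInjectives C] (hadj : IsSharpFoxby adj) {X Y H : C} {k : X ⟶ Y}
    (hk : FacProj k)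
    (hH : GInj C H) (m : S.obj Y ⟶ H) : FacInj (S.map k ≫ m) := by
  obtain ⟨P, a, b, hP, rfl⟩ := hk
  rw [S.map_comp, Category.assoc]
  exact (facInj_of_finId (hadj.map_finPd P (finPd_of_projective P)) hH _).comp_left _

lemma facProj_homEquiv [EnoughProjectives C] (hadj : IsSharpFoxby adj) {G Y : C} (hG : GProj C G)
    {m : S.obj G ⟶ Y}
    (hm : FacInj m) : FacProj (adj.homEquiv G Y m) := by
  obtain ⟨J, a, b, hJ, rfl⟩ := hm
  rw [adj.homEquiv_naturality_right]
  exact (facProj_of_finPd (hadj.map_finId J (finId_of_injective J)) hG _).comp_right _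

lemma facInj_homEquiv_symm [EnoughInjectives C] (hadj : IsSharpFoxby adj) {X H : C} (hH : GInj C H)
    {n : X ⟶ T.obj H} (hn : FacProj n) : FacInj ((adj.homEquiv X H).symm n) := by
  obtain ⟨P, a, b, hP, rfl⟩ := hn
  rw [adj.homEquiv_naturality_left_symm]
  exact (facInj_of_finId (hadj.map_finPd P (finPd_of_projective P)) hH _).comp_left _

variable [EnoughInjectives C]

lemma exists_ginj (hadj : IsSharpFoxby adj) (G : (GProj C).FullSubcategory) :
    ∃ (H : (GInj C).FullSubcategory) (i : S.obj G.obj ⟶ H.obj) (L : C) (p : H.obj ⟶ L),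
      IsSES i p ∧ FinId C L := by
  obtain ⟨n, hn⟩ := hadj.map_finGpd _ (GProj.finGpd G.property)
  obtain ⟨H, L, i, p, h, hH, hL⟩ := hn.exists_envelope
  exact ⟨⟨H, hH⟩, i, L, p, h, finId_iff_idLE.2 hL⟩

/-- A Gorenstein injective envelope of `S G` with cokernel of finite injective dimension. -/
def env (G : (GProj C).FullSubcategory) : (GInj C).FullSubcategory := (hadj.exists_ginj G).choose

/-- The embedding of `S G` into `hadj.env G`. -/
def envι (G : (GProj C).FullSubcategory) : S.obj G.obj ⟶ (hadj.env G).obj :=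
  (hadj.exists_ginj G).choose_spec.choose

lemma envι_spec (G : (GProj C).FullSubcategory) :
    ∃ (L : C) (p : (hadj.env G).obj ⟶ L), IsSES (hadj.envι G) p ∧ FinId C L :=
  (hadj.exists_ginj G).choose_spec.choose_spec

lemma isExtIso_envι [HasExt.{w} C] (G : (GProj C).FullSubcategory) :
    IsExtIso.{v, u, w} (hadj.envι G) := by
  obtain ⟨L, p, h, hL⟩ := hadj.envι_spec G
  exact isExtIso_of_mono h hL

lemma exists_env_desc (G : (GProj C).FullSubcategory) {H : (GInj C).FullSubcategory}
    (k : S.obj G.obj ⟶ H.obj) : ∃ g : hadj.env G ⟶ H, hadj.envι G ≫ g.hom = k := by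
  obtain ⟨L, p, h, hL⟩ := hadj.envι_spec G
  obtain ⟨g, hg⟩ := exists_ext_of_finId h hL H.property k
  exact ⟨ObjectProperty.homMk g, hg⟩

/-- Stable maps out of an envelope are determined on `S G`; this replaces uniqueness in the
functoriality checks below. -/
lemma env_sound {G : (GProj C).FullSubcategory} {H : (GInj C).FullSubcategory}
    {g g' : hadj.env G ⟶ H} (h : FacInj (hadj.envι G ≫ g.hom - hadj.envι G ≫ g'.hom)) :
    (toStable _).map g = (toStable _).map g' := by
  have := HasExt.standard C
  refine toStable_ginj_eq_iff.2 ((hadj.isExtIso_envι G).facInj H.property ?_)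
  rwa [Preadditive.comp_sub]

lemma exists_env_map {G G' : (GProj C).FullSubcategory} (f : G ⟶ G') :
    ∃ g : hadj.env G ⟶ hadj.env G', hadj.envι G ≫ g.hom = S.map f.hom ≫ hadj.envι G' :=
  hadj.exists_env_desc G _

/-- The functor sending `G` to the chosen envelope of `S G`. -/
def envFunctor : (GProj C).FullSubcategory ⥤ StableCategory (GInj C) where
  obj G := (toStable _).obj (hadj.env G)
  map f := (toStable _).map (hadj.exists_env_map f).choose
  map_id G := by
    refine (hadj.env_sound ?_).trans (CategoryTheory.Functor.map_id _ (hadj.env G))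
    rw [(hadj.exists_env_map _).choose_spec]
    simpa using FacInj.zero
  map_comp {G G' G''} f g := by
    rw [← Functor.map_comp]
    refine hadj.env_sound ?_
    obtain ⟨k, hk, hk'⟩ : ∃ k, hadj.envι G ≫ k.hom = S.map f.hom ≫ hadj.envι G' ∧
      (hadj.exists_env_map f).choose = k := ⟨_, (hadj.exists_env_map f).choose_spec, rfl⟩
    obtain ⟨l, hl, hl'⟩ : ∃ k, hadj.envι G' ≫ k.hom = S.map g.hom ≫ hadj.envι G'' ∧
      (hadj.exists_env_map g).choose = k := ⟨_, (hadj.exists_env_map g).choose_spec, rfl⟩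
    rw [(hadj.exists_env_map (f ≫ g)).choose_spec, hk', hl',
      ObjectProperty.FullSubcategory.comp_hom, ObjectProperty.FullSubcategory.comp_hom,
      S.map_comp, ← Category.assoc (hadj.envι G), hk, Category.assoc, Category.assoc, hl, sub_self]
    exact FacInj.zero

lemma facInj_envι (hadj : IsSharpFoxby adj) {G G' : (GProj C).FullSubcategory} {f f' : G ⟶ G'}
    (h : FacProj (f.hom - f'.hom)) :
    FacInj (S.map f.hom ≫ hadj.envι G' - S.map f'.hom ≫ hadj.envι G') := by
  have := additive_of_adjunction adj
  rw [← Preadditive.sub_comp, ← S.map_sub]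
  exact hadj.facInj_map_comp h (hadj.env G').property _

/-- The functor between stable categories induced by `S`. -/
def stableFunctor : StableCategory (GProj C) ⥤ StableCategory (GInj C) :=
  CategoryTheory.Quotient.lift _ hadj.envFunctor fun _ _ f f' h => by
    refine hadj.env_sound ?_
    rw [(hadj.exists_env_map f).choose_spec, (hadj.exists_env_map f').choose_spec]
    exact hadj.facInj_envι ((stableRel_gproj_iff f f').1 h)

lemma stableFunctor_map {G G' : (GProj C).FullSubcategory} {f : G ⟶ G'}
    {g : hadj.env G ⟶ hadj.env G'}
    (h : FacInj (S.map f.hom ≫ hadj.envι G' - hadj.envι G ≫ g.hom)) :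
    hadj.stableFunctor.map ((toStable _).map f) = (toStable _).map g := by
  have h' : FacInj (hadj.envι G ≫ (hadj.exists_env_map f).choose.hom - hadj.envι G ≫ g.hom) := by
    rwa [(hadj.exists_env_map f).choose_spec]
  exact hadj.env_sound h'

/-- The morphism `G ⟶ T H` corresponding to the envelope `S G ⟶ H`. -/
lemma homEquiv_envι_spec (G : (GProj C).FullSubcategory) :
    ∃ (N : C) (q : T.obj (hadj.env G).obj ⟶ N),
      IsSES (adj.homEquiv _ _ (hadj.envι G)) q ∧ FinPd C N := by
  obtain ⟨L, p, h, hL⟩ := hadj.envι_spec G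
  have := hadj.isIso_unit _ (GProj.finGpd G.property)
  refine ⟨_, T.map p, ?_, hadj.map_finId L hL⟩
  rw [adj.homEquiv_unit]
  exact (hadj.map_right_isSES h (hadj.map_finGpd _ (GProj.finGpd G.property))
    (GInj.finGid (hadj.env G).property) hL.finGid).iso_left (asIso (adj.unit.app G.obj))

variable [EnoughProjectives C]

/-- Modulo injectives or projectives, Hom(env G, env G') is Hom(S G, env G'), by adjunction Hom(G, T
(env G')), and finally Hom(G, G'), because `G'` embeds in `T (env G')` with cokernel of finite
projective dimension. Fullness follows the same chain. -/
instance : hadj.stableFunctor.Faithful where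
  map_injective {X Y} := by
    obtain ⟨G⟩ := X
    obtain ⟨G'⟩ := Y
    rintro ⟨f⟩ ⟨f'⟩ h
    have := additive_of_adjunction adj
    obtain ⟨g, hg⟩ := hadj.exists_env_map f
    obtain ⟨g', hg'⟩ := hadj.exists_env_map f'
    obtain ⟨N, q, hq, hN⟩ := hadj.homEquiv_envι_spec G'
    refine toStable_gproj_eq_iff.2 (facProj_of_comp hq hN G.property ?_)
    rw [← adj.homEquiv_naturality_left, S.map_sub, Preadditive.sub_comp, ← hg, ← hg',
      ← Preadditive.comp_sub]
    refine hadj.facProj_homEquiv G.property (FacInj.comp_left ?_ _)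
    refine toStable_ginj_eq_iff.1 ?_
    rw [← hadj.stableFunctor_map (f := f) (g := g) (by rw [hg, sub_self]; exact .zero),
      ← hadj.stableFunctor_map (f := f') (g := g') (by rw [hg', sub_self]; exact .zero)]
    exact h

instance : hadj.stableFunctor.Full where
  map_surjective {X Y} := by
    obtain ⟨G⟩ := X
    obtain ⟨G'⟩ := Y
    rintro ⟨h⟩
    have := additive_of_adjunction adj
    have := adj.right_adjoint_additive
    change hadj.env G ⟶ hadj.env G' at h
    obtain ⟨N, q, hq, hN⟩ := hadj.homEquiv_envι_spec G'
    obtain ⟨f, hf⟩ := exists_facProj hq hN G.property (adj.homEquiv _ _ (hadj.envι G ≫ h.hom))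
    refine ⟨(toStable _).map (ObjectProperty.homMk f), hadj.stableFunctor_map ?_⟩
    have h' := hadj.facInj_homEquiv_symm (hadj.env G').property hf
    rw [← adj.homEquiv_naturality_left] at h'
    simpa [adj.homEquiv_counit, adj.homEquiv_unit, T.map_sub] using h'

/-- Take a Gorenstein projective cover `G` of `T H` whose kernel has finite projective dimension.
Then `S G ⟶ S (T H) ≅ H` has kernel of finite injective dimension, so its extension to the envelope
is a stable isomorphism. -/
instance : hadj.stableFunctor.EssSurj where
  mem_essImage := by
    rintro ⟨H⟩
    have := HasExt.standard C
    obtain ⟨n, hn⟩ := hadj.map_finGid _ (GInj.finGid H.property)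
    obtain ⟨L, G, i, p, h, hL, hG⟩ := hn.exists_cover
    replace hL : FinPd C L := finPd_iff_pdLE.2 hL
    have := hadj.isIso_counit _ (GInj.finGid H.property)
    have h' := (hadj.map_left_isSES h hL.finGpd hG.finGpd ⟨n, hn⟩).iso_right
      (asIso (adj.counit.app H.obj))
    obtain ⟨k, hk⟩ := hadj.exists_env_desc ⟨G, hG⟩ (H := H)
      (S.map p ≫ (asIso (adj.counit.app H.obj)).hom)
    have := isIso_toStable_of_isExtIso k ((hadj.isExtIso_envι ⟨G, hG⟩).of_comp (by
      rw [hk]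
      exact isExtIso_of_epi h' (hadj.map_finPd L hL)))
    have e := asIso ((toStable _).map k)
    exact ⟨(toStable _).obj ⟨G, hG⟩, ⟨e⟩⟩

instance : hadj.stableFunctor.IsEquivalence where

end IsSharpFoxby

/-! ## Compatibility with suspensions and triangles -/

section Triangles

variable {C : Type u} [Category.{v} C] [Abelian C]

lemma sus_isSES (E : ObjectProperty C) [HasProInjectiveEmbeddings E] (G : E.FullSubcategory) :
    IsSES (susι E G) (susπ E G) :=
  (sus_conflation E G).shortExact.isSES

instance (G : (GProj C).FullSubcategory) : Projective (susMid (GProj C) G) :=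
  (susMid_proInjective _ G).projective_of_gproj

instance (G : (GInj C).FullSubcategory) : Injective (susMid (GInj C) G) :=
  (susMid_proInjective _ G).injective_of_ginj

lemma isSES_of_isPushout {X Y Z W : C} {f : X ⟶ Y} {g : X ⟶ Z} {h : Y ⟶ W} {k : Z ⟶ W}
    (sq : IsPushout f g h k) [Mono f] : IsSES (biprod.lift f (-g)) (biprod.desc h k) := by
  have : Mono (biprod.lift f (-g)) := mono_of_mono_fac (biprod.lift_fst f (-g))
  have : Epi (biprod.desc h k) := ⟨fun x y hxy => sq.hom_ext
    (by simpa using biprod.inl ≫= hxy) (by simpa using biprod.inr ≫= hxy)⟩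
  refine IsSES.of_desc (by simp [sq.w]) fun {A} x hx => ?_
  have hx' : f ≫ biprod.inl ≫ x = g ≫ biprod.inr ≫ x := by
    rw [← sub_eq_zero, ← hx, biprod.lift_eq]
    simp [sub_eq_add_neg]
  exact ⟨sq.desc _ _ hx', by ext <;> simp⟩

section

variable [HasExt.{w} C] [EnoughInjectives C]

lemma isExtIso_of_finId {L L' : C} (hL : FinId C L) (hL' : FinId C L') (f : L ⟶ L') :
    IsExtIso.{v, u, w} f := fun _ hH _ =>
  ⟨fun x y _ => (hH.ext_eq_zero hL' x).trans (hH.ext_eq_zero hL' y).symm,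
    fun x => ⟨0, (hH.ext_eq_zero hL _).trans (hH.ext_eq_zero hL x).symm⟩⟩

/-- The inclusions of `Y` and `Y'` have cokernels of finite injective dimension, so cancellation
against them leaves only `f`. -/
lemma IsExtIso.biprod_map {L L' Y Y' : C} (hL : FinId C L) (hL' : FinId C L') (b : L ⟶ L')
    {f : Y ⟶ Y'} (hf : IsExtIso.{v, u, w} f) : IsExtIso.{v, u, w} (biprod.map b f) := by
  refine IsExtIso.of_comp (isExtIso_of_mono (IsSES.inr_fst Y L) hL) ?_
  rw [biprod.inr_map]
  exact hf.comp (isExtIso_of_mono (IsSES.inr_fst Y' L') hL')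

end

lemma Tri.Iso.trans {D : Type*} [Category* D] {sus : D ⥤ D} {A B B' : Tri sus} (h : A.Iso B)
    (h' : B.Iso B') : A.Iso B' := by
  obtain ⟨a, b, c, h₁, h₂, h₃⟩ := h
  obtain ⟨a', b', c', h₁', h₂', h₃'⟩ := h'
  refine ⟨a ≪≫ a', b ≪≫ b', c ≪≫ c', ?_, ?_, ?_⟩
  · rw [Iso.trans_hom, Iso.trans_hom, ← Category.assoc, h₁, Category.assoc, h₁', Category.assoc]
  · rw [Iso.trans_hom, Iso.trans_hom, ← Category.assoc, h₂, Category.assoc, h₂', Category.assoc]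
  · rw [Iso.trans_hom, Iso.trans_hom, sus.map_comp, ← Category.assoc, h₃, Category.assoc, h₃',
      Category.assoc]

lemma Tri.Iso.map {D D' : Type*} [Category* D] [Category* D'] {sus : D ⥤ D} {sus' : D' ⥤ D'}
    {A B : Tri sus} (h : A.Iso B) (F : D ⥤ D') (φ : sus ⋙ F ≅ F ⋙ sus') :
    (A.map F φ).Iso (B.map F φ) := by
  obtain ⟨a, b, c, h₁, h₂, h₃⟩ := h
  refine ⟨F.mapIso a, F.mapIso b, F.mapIso c, ?_, ?_, ?_⟩
  · change F.map A.f ≫ F.map b.hom = F.map a.hom ≫ F.map B.f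
    rw [← F.map_comp, h₁, F.map_comp]
  · change F.map A.g ≫ F.map c.hom = F.map b.hom ≫ F.map B.g
    rw [← F.map_comp, h₂, F.map_comp]
  · change (F.map A.h ≫ φ.hom.app A.X) ≫ sus'.map (F.map a.hom) =
      F.map c.hom ≫ F.map B.h ≫ φ.hom.app B.X
    have h := φ.hom.naturality a.hom
    change F.map (sus.map a.hom) ≫ φ.hom.app B.X = φ.hom.app A.X ≫ sus'.map (F.map a.hom) at h
    rw [Category.assoc, ← h, ← Category.assoc, ← F.map_comp, h₃, F.map_comp, Category.assoc]

end Triangles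

namespace IsSharpFoxby

variable {C : Type u} [Category.{v} C] [Abelian C]
  {S T : C ⥤ C} {adj : S ⊣ T} (hadj : IsSharpFoxby adj)

lemma finId_map_susMid (hadj : IsSharpFoxby adj) (G : (GProj C).FullSubcategory) :
    FinId C (S.obj (susMid (GProj C) G)) :=
  hadj.map_finPd _ (finPd_of_projective _)

lemma map_sus_isSES [EnoughProjectives C] (hadj : IsSharpFoxby adj)
    (G : (GProj C).FullSubcategory) :
    IsSES (S.map (susι _ G)) (S.map (susπ _ G)) :=
  hadj.map_left_isSES (sus_isSES _ G) (GProj.finGpd G.property)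
    (finPd_of_projective _).finGpd (GProj.finGpd (susObj _ G).property)

variable [EnoughInjectives C]

/-- `k` is induced by the envelope of `S G`, through the morphism `b` between middle terms. -/
structure IsSusComparison (G : (GProj C).FullSubcategory)
    (b : S.obj (susMid (GProj C) G) ⟶ susMid (GInj C) (hadj.env G))
    (k : hadj.env (susObj _ G) ⟶ susObj _ (hadj.env G)) : Prop where
  left : S.map (susι _ G) ≫ b = hadj.envι G ≫ susι _ (hadj.env G)
  right : S.map (susπ _ G) ≫ hadj.envι (susObj _ G) ≫ k.hom = b ≫ susπ _ (hadj.env G)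

variable [EnoughProjectives C]

lemma exists_susComparison (G : (GProj C).FullSubcategory) :
    ∃ b k, hadj.IsSusComparison G b k := by
  have h := hadj.map_sus_isSES G
  have := h.mono
  have hb := Injective.comp_factorThru (hadj.envι G ≫ susι _ (hadj.env G)) (S.map (susι _ G))
  obtain ⟨s, hs⟩ := h.exists_desc (Injective.factorThru (hadj.envι G ≫ susι _ (hadj.env G))
    (S.map (susι _ G)) ≫ susπ _ (hadj.env G)) (by
      rw [← Category.assoc, hb, Category.assoc, susι_π, comp_zero])
  obtain ⟨k, hk⟩ := hadj.exists_env_desc (susObj _ G) s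
  exact ⟨_, k, hb, by rw [hk, hs]⟩

/-- A map between middle terms covering the comparison of suspensions. -/
def susMidComparison (G : (GProj C).FullSubcategory) :
    S.obj (susMid (GProj C) G) ⟶ susMid (GInj C) (hadj.env G) :=
  (hadj.exists_susComparison G).choose

/-- The comparison of suspensions. -/
def susComparison (G : (GProj C).FullSubcategory) :
    hadj.env (susObj _ G) ⟶ susObj _ (hadj.env G) :=
  (hadj.exists_susComparison G).choose_spec.choose

lemma isSusComparison (G : (GProj C).FullSubcategory) :
    hadj.IsSusComparison G (hadj.susMidComparison G) (hadj.susComparison G) :=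
  (hadj.exists_susComparison G).choose_spec.choose_spec

/-- Five lemma for the map from the image under `S` of the suspension sequence of `G` to that of the
envelope. Both middle terms have finite injective dimension, so the middle map is harmless. -/
lemma isIso_susComparison (G : (GProj C).FullSubcategory) :
    IsIso ((toStable _).map (hadj.susComparison G)) := by
  have := HasExt.standard C
  have h := hadj.isSusComparison G
  refine isIso_toStable_of_isExtIso _ ((hadj.isExtIso_envι _).of_comp ?_)
  exact IsExtIso.third (hadj.map_sus_isSES G) (sus_isSES _ _) h.left.symm h.right.symm
    (hadj.isExtIso_envι G)
    (isExtIso_of_finId (hadj.finId_map_susMid G) (finId_of_injective _) _)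

lemma susComparison_naturality {G G' : (GProj C).FullSubcategory} {f : G ⟶ G'}
    {f' : susObj _ G ⟶ susObj _ G'} (hf : IsSusLift _ f f') {g : hadj.env G ⟶ hadj.env G'}
    (hg : hadj.envι G ≫ g.hom = S.map f.hom ≫ hadj.envι G')
    {g' : susObj _ (hadj.env G) ⟶ susObj _ (hadj.env G')} (hg' : IsSusLift _ g g')
    {k : hadj.env (susObj _ G) ⟶ hadj.env (susObj _ G')}
    (hk : hadj.envι _ ≫ k.hom = S.map f'.hom ≫ hadj.envι _) :
    (toStable _).map (k ≫ hadj.susComparison G') =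
      (toStable _).map (hadj.susComparison G ≫ g') := by
  have := additive_of_adjunction adj
  obtain ⟨a, ha, ha'⟩ := hf
  obtain ⟨a', hb, hb'⟩ := hg'
  have h := hadj.isSusComparison G
  have h' := hadj.isSusComparison G'
  have hs := hadj.map_sus_isSES G
  have := hs.epi
  -- The two maps between middle terms agree on `S G`, so their difference descends to `t`. It shows
  -- that the two sides of the naturality square differ by a map through an injective middle term.
  obtain ⟨t, ht⟩ := hs.exists_desc
    (S.map a ≫ hadj.susMidComparison G' - hadj.susMidComparison G ≫ a') (by
      rw [Preadditive.comp_sub, ← Category.assoc, ← Category.assoc, ← S.map_comp, ha, h.left,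
        S.map_comp, Category.assoc, Category.assoc, h'.left, hb, ← Category.assoc, ← hg,
        Category.assoc, sub_self])
  refine hadj.env_sound ⟨_, t, susπ _ (hadj.env G'), inferInstance, ?_⟩
  rw [← cancel_epi (S.map (susπ _ G)), ← Category.assoc _ t, ht, Preadditive.comp_sub,
    Preadditive.sub_comp]
  congr 1
  · rw [ObjectProperty.FullSubcategory.comp_hom, ← Category.assoc (hadj.envι _), hk,
      Category.assoc, ← Category.assoc, ← S.map_comp, ha', S.map_comp, Category.assoc, h'.right,
      Category.assoc]
  · rw [ObjectProperty.FullSubcategory.comp_hom, ← Category.assoc (hadj.envι _),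
      ← Category.assoc, h.right, Category.assoc, hb', Category.assoc]

/-- The functor between stable categories commutes with the suspensions. -/
def stableFunctorSuspension :
    suspension (GProj C) ⋙ hadj.stableFunctor ≅ hadj.stableFunctor ⋙ suspension (GInj C) :=
  NatIso.ofComponents (fun X => @asIso _ _ _ _ _ (hadj.isIso_susComparison X.as)) (by
    rintro ⟨G⟩ ⟨G'⟩ ⟨f⟩
    exact hadj.susComparison_naturality (exists_susLift f).choose_spec
      (hadj.exists_env_map f).choose_spec (exists_susLift _).choose_spec
      (hadj.exists_env_map _).choose_spec)

lemma isDistinguished_map_stdTri {X Y Z : (GProj C).FullSubcategory} {u : X ⟶ Y} {v : Y ⟶ Z}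
    {w : Z ⟶ susObj _ X} (h : IsStandard _ u v w) :
    IsDistinguished (GInj C) ((stdTri _ u v w).map hadj.stableFunctor
      hadj.stableFunctorSuspension) := by
  have := HasExt.standard C
  have := adj.isLeftAdjoint
  have : PreservesColimitsOfSize.{0, 0} S := adj.leftAdjoint_preservesColimits
  have := additive_of_adjunction adj
  obtain ⟨t, sq, htw, hvw⟩ := h
  obtain ⟨u', hu'⟩ := hadj.exists_env_map u
  obtain ⟨v', hv'⟩ := hadj.exists_env_map v
  obtain ⟨w', hw'⟩ := hadj.exists_env_map w
  have sq' := IsPushout.of_hasPushout (susι _ (hadj.env X)) u'.hom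
  obtain ⟨q, hq, hses⟩ := (sus_isSES _ (hadj.env X)).of_isPushout sq'
  let Z' : (GInj C).FullSubcategory :=
    ⟨_, GInj.extension hses (hadj.env Y).property (susObj _ (hadj.env X)).property⟩
  let j : hadj.env Y ⟶ Z' := ObjectProperty.homMk (pushout.inr _ _)
  let r : Z' ⟶ susObj _ (hadj.env X) := ObjectProperty.homMk q
  have hc := hadj.isSusComparison X
  have sqS := sq.map S
  have := (hadj.map_sus_isSES X).mono
  have := (sus_isSES _ (hadj.env X)).mono
  -- As a left adjoint, `S` preserves the pushout that defines the cone, so the envelopes and the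
  -- comparison of middle terms induce a map to the cone of `u'`.
  obtain ⟨m, hm₁, hm₂⟩ : ∃ m : S.obj Z.obj ⟶ Z'.obj,
      S.map t ≫ m = hadj.susMidComparison X ≫ pushout.inl _ _ ∧
      S.map v.hom ≫ m = hadj.envι Y ≫ j.hom :=
    ⟨sqS.desc _ _ (by
      rw [← Category.assoc, hc.left, Category.assoc, ← Category.assoc (S.map _), ← hu',
        Category.assoc, sq'.w]
      rfl), sqS.inl_desc _ _ _, sqS.inr_desc _ _ _⟩
  have hm : IsExtIso m := by
    -- Each pushout square is read as a short exact sequence with a biproduct in the middle, which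
    -- brings the comparison of cones under the five lemma.
    refine IsExtIso.third (isSES_of_isPushout sqS) (isSES_of_isPushout sq')
      (a := hadj.envι X) (b := biprod.map (hadj.susMidComparison X) (hadj.envι Y)) ?_ ?_
      (hadj.isExtIso_envι X) (.biprod_map (hadj.finId_map_susMid X) (finId_of_injective _) _
        (hadj.isExtIso_envι Y))
    · ext
      · simp [hc.left]
      · simp [hu']
    · ext
      · simp [hm₁]
      · simpa [j] using hm₂.symm
  obtain ⟨c, hcm⟩ := hadj.exists_env_desc Z m
  have hc' := isIso_toStable_of_isExtIso c ((hadj.isExtIso_envι Z).of_comp (hcm ▸ hm))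
  refine ⟨hadj.env X, hadj.env Y, Z', u', j, r, ⟨pushout.inl _ _, sq', hq, hses.w⟩,
    Iso.refl _, Iso.refl _, @asIso _ _ _ _ _ hc', ?_, ?_, ?_⟩
  · have h₁ : hadj.stableFunctor.map ((toStable _).map u) = (toStable _).map u' :=
      hadj.stableFunctor_map (by rw [hu', sub_self]; exact .zero)
    exact (Category.comp_id _).trans (h₁.trans (Category.id_comp _).symm)
  · have h₂ : hadj.stableFunctor.map ((toStable _).map v) = (toStable _).map v' :=
      hadj.stableFunctor_map (by rw [hv', sub_self]; exact .zero)
    refine Eq.trans ?_ (Category.id_comp _).symm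
    change hadj.stableFunctor.map ((toStable _).map v) ≫ (toStable _).map c = (toStable _).map j
    rw [h₂]
    refine hadj.env_sound (g := v' ≫ c) (g' := j) ?_
    rw [ObjectProperty.FullSubcategory.comp_hom, ← Category.assoc, hv', Category.assoc, hcm, hm₂,
      sub_self]
    exact .zero
  · have h₃ : hadj.stableFunctor.map ((toStable _).map w) = (toStable _).map w' :=
      hadj.stableFunctor_map (by rw [hw', sub_self]; exact .zero)
    change (hadj.stableFunctor.map ((toStable _).map w) ≫
      (toStable _).map (hadj.susComparison X)) ≫
        (suspension _).map (𝟙 ((toStable (GInj C)).obj (hadj.env X))) =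
        (toStable _).map c ≫ (toStable _).map r
    rw [h₃, CategoryTheory.Functor.map_id]
    refine (Category.comp_id _).trans ?_
    refine hadj.env_sound (g := w' ≫ hadj.susComparison X) (g' := c ≫ r) ?_
    rw [ObjectProperty.FullSubcategory.comp_hom, ObjectProperty.FullSubcategory.comp_hom,
      ← Category.assoc, hw', ← Category.assoc, hcm, sub_eq_zero.2]
    · exact .zero
    -- Both sides agree even before passing to the stable category, as is seen on the two legs of
    -- the pushout `S.obj Z.obj`.
    · refine sqS.hom_ext ?_ ?_
      · rw [← Category.assoc, ← Category.assoc, ← S.map_comp, htw, Category.assoc, hc.right,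
          ← Category.assoc, hm₁, Category.assoc]
        exact congrArg (_ ≫ ·) hq.symm
      · rw [← Category.assoc, ← Category.assoc, ← S.map_comp, hvw, S.map_zero, zero_comp, zero_comp,
          ← Category.assoc, hm₂, Category.assoc]
        exact (comp_zero.symm.trans (congrArg (_ ≫ ·) hses.w.symm))

/-- The stable categories of Gorenstein projective and of Gorenstein injective objects are
equivalent as triangulated categories if there is a Sharp–Foxby adjunction. -/
theorem triangulatedEquivalent (hadj : IsSharpFoxby adj) :
    TriangulatedEquivalent (GProj C) (GInj C) := by
  refine ⟨hadj.stableFunctor.asEquivalence, hadj.stableFunctorSuspension, ?_⟩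
  rintro A ⟨X, Y, Z, u, v, w, h, hA⟩
  obtain ⟨X', Y', Z', u', v', w', h', hB⟩ := hadj.isDistinguished_map_stdTri h
  exact ⟨X', Y', Z', u', v', w', h', (hA.map _ _).trans hB⟩

end IsSharpFoxby

end

end SharpFoxby

theorem theorem4p5 {A : Type u} [Category.{v} A] [Abelian A] [HasLimits A] [HasColimits A]
    [EnoughProjectives A] [EnoughInjectives A] {S T : A ⥤ A} (adj : S ⊣ T)
    (hadj : SharpFoxby.IsSharpFoxby adj) :
    SharpFoxby.TriangulatedEquivalent (SharpFoxby.GProj A) (SharpFoxby.GInj A) ∧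
      (SharpFoxby.finitisticProjectiveDimension A < ⊤ →
        SharpFoxby.finitisticInjectiveDimension A < ⊤ →
        SharpFoxby.IsSharpFoxby (SharpFoxby.degreewiseAdjunction adj) ∧
          SharpFoxby.TriangulatedEquivalent (SharpFoxby.GProj (ChainComplex A ℤ))
            (SharpFoxby.GInj (ChainComplex A ℤ))) :=
  ⟨hadj.triangulatedEquivalent, fun hp hi =>
    have h := hadj.degreewise hp hi
    ⟨h, h.triangulatedEquivalent⟩⟩
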